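/- A code of block length $n$ over a finite alphabet $\Sigma$ is a set $C\subseteq\Sigma^n$; its rate is $\frac{\log|C|}{n\log|\Sigma|}$. For words $s,s'\in\Sigma^*$, let $\Delta(s,s')$ be the least number of insertions and deletions of single symbols that turn $s$ into $s'$. Theorem. There are constants $c_0>0$ and $A,\kappa,B\in\mathbb R$, $a,d,b\in\mathbb N$ such that the following holds for every real $\varepsilon$ with $0<\varepsilon\le 1$. There are an integer $2\le k\le A(1/\varepsilon)^a$ and codes $C_0,C_1,C_2,\dots$ over an alphabet of size $k$, with block lengths $N_0<N_1<N_2<\cdots$, such that, with $$T(N)=\kappa\,N^{d}\,(\log_2 N)^{B(1/\varepsilon)^b},$$ for every $i$, writing $N=N_i$ and $C=C_i$: 1. $C$ has rate at least $c_0\,\varepsilon^9$; 2. $C$ is constructible in time $T(N)$: one program, which depends only on $\varepsilon$, computes from $i$ in time $T(N)$ a description of $C$ and of its encoding and decoding functions, that is, $N$, $|C|$ and the texts of an encoding program and of a decoding program; 3. $C$ is encodable in time $T(N)$: for a map $\mathrm{Enc}:\{0,\dots,|C|-1\}\to\Sigma^N$ with image $C$, that encoding program computes $\mathrm{Enc}(m)$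 from every message $m$ in time $T(N)$; 4. $C$ is decodable from a $1-\varepsilon$ fraction of worst-case insertions and deletions in time $T(N)$: for every $c\in C$ and every $s\in\Sigma^*$ with $\Delta(s,c)\le(1-\varepsilon)N$, that decoding program computes $c$ from $s$ in time $T(N)$. (In short: the alphabet has size $\mathrm{poly}(1/\varepsilon)$, the rate is $\Omega(\varepsilon^9)$, and the codes are constructible, encodable and decodable in time $\mathrm{poly}(N)\cdot(\log N)^{\mathrm{poly}(1/\varepsilon)}$.) Numbers are given in binary. Time is the number of steps, plus the size of the output, of a program in a WHILE language over binary trees, a model that is equivalent to multitape Turing machines up to a polynomial change of the running time, under which time bounds of the above form are invariant. -/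

import Mathlib

namespace IndelCode

/-! ### Insertion/deletion distance -/

/-- `IndelSteps t s s'`: the word `s` is turned into `s'` by exactly `t` successive operations, each
of which inserts one symbol or deletes one symbol, at any position. -/
inductive IndelSteps {α : Type} : ℕ → List α → List α → Prop
  | refl (s : List α) : IndelSteps 0 s s
  | insertion {t : ℕ} {s u v : List α} (a : α) :
      IndelSteps t s (u ++ v) → IndelSteps (t + 1) s (u ++ a :: v)
  | deletion {t : ℕ} {s u v : List α} (a : α) :
      IndelSteps t s (u ++ a :: v) → IndelSteps (t + 1) s (u ++ v)

/-- The insertion/deletion distance: the least number of insertions and deletions of single symbols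
that turn `s` into `s'`. -/
noncomputable def indelDist {α : Type} (s s' : List α) : ℕ :=
  sInf {t | IndelSteps t s s'}

/-- Any word can be turned into any other one, so that the infimum above is attained. -/
theorem exists_indelSteps {α : Type} (s s' : List α) : ∃ t, IndelSteps t s s' := by
  have h1 : ∀ (w r : List α) (t : ℕ), IndelSteps t s (w ++ r) → ∃ t', IndelSteps t' s r := by
    intro w
    induction w with
    | nil => intro r t h; exact ⟨t, h⟩
    | cons a w ih =>
      intro r t h
      exact ih r (t + 1) (IndelSteps.deletion (u := []) (v := w ++ r) a h)
  have h2 : ∀ (w : List α), ∃ t, IndelSteps t s w := by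
    intro w
    induction w with
    | nil => exact h1 s [] 0 (by simpa using IndelSteps.refl s)
    | cons a w ih =>
      obtain ⟨t, h⟩ := ih
      exact ⟨t + 1, IndelSteps.insertion (u := []) (v := w) a h⟩
  exact h2 s'

/-! ### Codes -/

/-- The rate `log |C| / (n log |Σ|)` of a code `C ⊆ Σⁿ` over the alphabet `Σ = Fin k`. -/
noncomputable def rate {n k : ℕ} (C : Finset (Fin n → Fin k)) : ℝ :=
  Real.log (C.card : ℝ) / ((n : ℝ) * Real.log (k : ℝ))

/-! ### A model of computation

Data are binary trees (S-expressions); programs are those of a small `WHILE` language whose basic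
operations are those of a machine with `cons` cells. The running time is the number of executed
program nodes. This model and multitape Turing machines simulate each other with polynomial
overhead. -/

/-- Binary trees without labels. -/
inductive Sexp : Type
  | nil : Sexp
  | cons : Sexp → Sexp → Sexp

namespace Sexp

/-- The first component (`nil` for `nil`). -/
def head : Sexp → Sexp
  | nil => nil
  | cons x _ => x

/-- The second component (`nil` for `nil`). -/
def tail : Sexp → Sexp
  | nil => nil
  | cons _ y => y

/-- The number of nodes and leaves of the tree. -/
def size : Sexp → ℕ
  | nil => 1
  | cons x y => x.size + y.size + 1

/-- A list of trees as a tree. -/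
def ofList : List Sexp → Sexp
  | [] => nil
  | x :: l => cons x (ofList l)

/-- A bit as a tree. -/
def ofBool : Bool → Sexp
  | false => nil
  | true => cons nil nil

/-- A natural number as the list of its binary digits, the least significant one first. -/
def ofNat (n : ℕ) : Sexp := ofList (n.bits.map ofBool)

/-- A word over the alphabet `Fin k` as the list of its symbols. -/
def ofWord {k : ℕ} (s : List (Fin k)) : Sexp := ofList (s.map fun a => ofNat a)

end Sexp

/-- Programs. Each program is run on one tree and returns one tree if it terminates:
`nil` returns the empty tree, `input` returns its input, `head` and `tail` take components,
`cons p q` pairs the results of `p` and `q`, `seq p q` runs `p` and then `q` on the result of `p`,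
`ifte c p q` runs `p` if the result of `c` is not `nil` and `q` otherwise, and `loop c p` replaces
the current tree by the result of `p` on it as long as the result of `c` on it is not `nil`. -/
inductive Prog : Type
  | nil : Prog
  | input : Prog
  | head : Prog
  | tail : Prog
  | cons : Prog → Prog → Prog
  | seq : Prog → Prog → Prog
  | ifte : Prog → Prog → Prog → Prog
  | loop : Prog → Prog → Prog

/-- `Run p x y t`: the program `p` on the input `x` terminates with the output `y` after `t` steps. -/
inductive Run : Prog → Sexp → Sexp → ℕ → Prop
  | nil (x : Sexp) : Run Prog.nil x Sexp.nil 1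
  | input (x : Sexp) : Run Prog.input x x 1
  | head (x : Sexp) : Run Prog.head x x.head 1
  | tail (x : Sexp) : Run Prog.tail x x.tail 1
  | cons {p q : Prog} {x y z : Sexp} {t u : ℕ} :
      Run p x y t → Run q x z u → Run (Prog.cons p q) x (Sexp.cons y z) (t + u + 1)
  | seq {p q : Prog} {x y z : Sexp} {t u : ℕ} :
      Run p x y t → Run q y z u → Run (Prog.seq p q) x z (t + u + 1)
  | ifte_true {c p q : Prog} {x y a b : Sexp} {t u : ℕ} :
      Run c x (Sexp.cons a b) t → Run p x y u → Run (Prog.ifte c p q) x y (t + u + 1)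
  | ifte_false {c p q : Prog} {x y : Sexp} {t u : ℕ} :
      Run c x Sexp.nil t → Run q x y u → Run (Prog.ifte c p q) x y (t + u + 1)
  | loop_exit {c p : Prog} {x : Sexp} {t : ℕ} :
      Run c x Sexp.nil t → Run (Prog.loop c p) x x (t + 1)
  | loop_next {c p : Prog} {x y z a b : Sexp} {t u v : ℕ} :
      Run c x (Sexp.cons a b) t → Run p x y u → Run (Prog.loop c p) y z v →
        Run (Prog.loop c p) x z (t + u + v + 1)

/-- The text of a program as a tree: the number of its outermost construct, followed by the texts of
its parts. -/
def Prog.text : Prog → Sexp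
  | nil => Sexp.ofList [Sexp.ofNat 0]
  | input => Sexp.ofList [Sexp.ofNat 1]
  | head => Sexp.ofList [Sexp.ofNat 2]
  | tail => Sexp.ofList [Sexp.ofNat 3]
  | cons p q => Sexp.ofList [Sexp.ofNat 4, p.text, q.text]
  | seq p q => Sexp.ofList [Sexp.ofNat 5, p.text, q.text]
  | ifte c p q => Sexp.ofList [Sexp.ofNat 6, c.text, p.text, q.text]
  | loop c p => Sexp.ofList [Sexp.ofNat 7, c.text, p.text]

/-- On the input `x`, the program `p` returns `y` within time `T`. The size of the output is part of
the time, so that no output is longer than the time spent on it, even if it has equal parts that the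
program has computed only once. -/
def ComputesWithin (p : Prog) (x y : Sexp) (T : ℝ) : Prop :=
  ∃ t : ℕ, Run p x y t ∧ ((t + y.size : ℕ) : ℝ) ≤ T

/-! ### Encoding, decoding and constructing codes in bounded time -/

/-- The program `e` encodes `C` in time `T`: for an enumeration `Enc` of `C` by messages in
`{0, …, |C| - 1}`, it computes `Enc m` from each message `m` in time `T`. -/
def EncodesWithin {n k : ℕ} (C : Finset (Fin n → Fin k)) (e : Prog) (T : ℝ) : Prop :=
  ∃ Enc : Fin C.card → (Fin n → Fin k), Set.range Enc = (C : Set (Fin n → Fin k)) ∧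
    ∀ m : Fin C.card,
      ComputesWithin e (Sexp.ofNat (m : ℕ)) (Sexp.ofWord (List.ofFn (Enc m))) T

/-- The program `d` decodes `C` from a `δ` fraction of worst-case insertions and deletions in time
`T`: from every word `s` at insertion/deletion distance at most `δ n` from a codeword `c`, it
computes `c` in time `T`. -/
def DecodesWithin {n k : ℕ} (C : Finset (Fin n → Fin k)) (d : Prog) (δ T : ℝ) : Prop :=
  ∀ c ∈ C, ∀ s : List (Fin k), (indelDist (List.ofFn c) s : ℝ) ≤ δ * (n : ℝ) →
    ComputesWithin d (Sexp.ofWord s) (Sexp.ofWord (List.ofFn c)) T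

/-- The description of a code of block length `n` and of its encoding and decoding functions: the
block length, the number of codewords, and the texts of an encoding program `e` and of a decoding
program `d` (the code is the set of the outputs of `e` on the numbers below `|C|`). -/
def description {n k : ℕ} (C : Finset (Fin n → Fin k)) (e d : Prog) : Sexp :=
  Sexp.ofList [Sexp.ofNat n, Sexp.ofNat C.card, e.text, d.text]

end IndelCode

/-!
The codes are concatenated codes, and the bound on the running time that is proved is a polynomial
in the block length `N` whose degree does not depend on `ε`; the logarithmic factor is not needed
(the exponent `B` is `0`).

Put `e = ⌈1 / ε⌉`. The outer code is a Reed–Solomon code of length `n = 2 ^ r` and dimension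
`n / (4 e)` over a prime field. At the point `x`, the value `y` of the polynomial is transmitted as
the inner codeword of the pair `(x, y)`, so that the inner codewords carry the positions with them.
The inner code has at most `2 n ^ 2` words of length `l = O(e ^ 4 log n)` over an alphabet of size
`O(e ^ 8)`, and common subsequences of two of its words have length at most
`σ = 4 (r + 1)`, a fraction `O(1 / e ^ 4)` of `l`. It is constructed greedily, letter by letter, by the method of
conditional expectations applied to a weighted count of common subsequences
(`greedyCode_spec`); the greedy choice takes time polynomial in `n`, because the inner words have
length logarithmic in `n`, and all numbers involved are polynomial in `n`.

The decoder cuts the received word into chunks of about `48 e` inner block lengths. A chunk cannot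
have long common subsequences with many inner codewords, because these have short common
subsequences with each other: by Bonferroni's inequality (`sum_length_le_add`), the lengths of these
common subsequences add up to little more than the length of the chunk (`sum_chunkLcs_le`). On the
other hand, a common subsequence of the sent and the received word decomposes, up to boundary
effects, into common subsequences of the sent inner codewords and the chunks
(`length_le_sum_chunkLcs`). If at most `(1 - ε) N` symbols were inserted or deleted, it has length
at least `|s| / 2 + N / (2 e)`. Hence the scores of the sent values exceed the best scores of
the other values by a total of more than `l` times the outer dimension, and generalized
minimum distance decoding (`gmdDecode_spec`), with the algorithm of Berlekamp and Welch for the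
outer code (`rsDecode_spec`), recovers the message (`decodeCoeffs_spec`).

Running times are treated by the class `PolyTime` of functions between types that are represented
by trees. It is closed under the usual operations on lists and on numbers in unary, so that for the
functions that make up the code membership follows from their definitions. The programs of all codes
are obtained from two fixed programs by supplying the parameters as constants; this makes the
degrees of the time bounds independent of `ε`, and the texts of the programs computable.
-/

namespace IndelCode

/-- Types whose elements are represented by trees. -/
class Enc (α : Type) where
  /-- The tree that represents an element. -/
  enc : α → Sexp

open Enc

instance : Enc Sexp := ⟨id⟩
instance : Enc Unit := ⟨fun _ => Sexp.nil⟩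
instance : Enc Bool := ⟨Sexp.ofBool⟩
/-- Natural numbers are represented in unary; the binary representation of `n` is that of the list
`Nat.bits n`. -/
instance : Enc ℕ := ⟨fun n => Sexp.ofList (List.replicate n Sexp.nil)⟩
instance {α β : Type} [Enc α] [Enc β] : Enc (α × β) := ⟨fun x => .cons (enc x.1) (enc x.2)⟩
instance {α : Type} [Enc α] : Enc (List α) := ⟨fun l => Sexp.ofList (l.map enc)⟩

/-- The size of the tree that represents `a`. -/
def sz {α : Type} [Enc α] (a : α) : ℕ := (enc a).size

section Basic

variable {α β γ δ σ : Type} [Enc α] [Enc β] [Enc γ] [Enc δ] [Enc σ]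

theorem Sexp.size_pos (x : Sexp) : 1 ≤ x.size := by
  cases x <;> simp [Sexp.size]

theorem sz_pos (a : α) : 1 ≤ sz a := Sexp.size_pos _

theorem sz_pair (a : α) (b : β) : sz (a, b) = sz a + sz b + 1 := rfl

theorem sz_list_nil : sz ([] : List α) = 1 := rfl

theorem sz_list_cons (a : α) (l : List α) : sz (a :: l) = sz a + sz l + 1 := rfl

theorem sz_list_append (l m : List α) : sz (l ++ m) + 1 = sz l + sz m := by
  induction l with
  | nil => simp [sz_list_nil, add_comm]
  | cons a l ih => simp only [List.cons_append, sz_list_cons]; omega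

theorem sz_le_of_mem {a : α} {l : List α} (h : a ∈ l) : sz a ≤ sz l := by
  induction l with
  | nil => simp at h
  | cons b l ih =>
    rw [sz_list_cons]
    rcases List.mem_cons.1 h with rfl | h
    · omega
    · have := ih h; omega

theorem length_lt_sz (l : List α) : l.length < sz l := by
  induction l with
  | nil => simp [sz_list_nil]
  | cons b l ih => simp only [sz_list_cons, List.length_cons]; omega

theorem sz_le_of_forall {l : List α} {B : ℕ} (h : ∀ a ∈ l, sz a ≤ B) :
    sz l ≤ l.length * (B + 1) + 1 := by
  induction l with
  | nil => simp [sz_list_nil]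
  | cons b l ih =>
    have h1 := h b (by simp)
    have h2 := ih fun a ha => h a (by simp [ha])
    simp only [sz_list_cons, List.length_cons, add_mul]; omega

theorem sz_sublist {l m : List α} (h : l.Sublist m) : sz l ≤ sz m := by
  induction h with
  | slnil => exact le_rfl
  | cons a _ ih => rw [sz_list_cons]; omega
  | cons_cons a _ ih => rw [sz_list_cons, sz_list_cons]; omega

theorem sz_bool (b : Bool) : sz b ≤ 3 := by cases b <;> decide

theorem enc_nat_eq (n : ℕ) : enc n = enc (List.replicate n ()) := by
  simp only [enc, List.map_replicate]

theorem sz_nat (n : ℕ) : sz n = 2 * n + 1 := by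
  induction n with
  | zero => rfl
  | succ n ih =>
    simp only [sz, enc, List.replicate_succ, Sexp.ofList, Sexp.size] at ih ⊢; omega

/-- `τ a` is at most a polynomial in the size of `a`. -/
def PolyBd (τ : α → ℕ) : Prop := ∃ d : ℕ, ∀ a, τ a ≤ (sz a + 1) ^ d

theorem PolyBd.mono {τ υ : α → ℕ} (h : PolyBd υ) (hle : ∀ a, τ a ≤ υ a) : PolyBd τ := by
  obtain ⟨d, h⟩ := h
  exact ⟨d, fun a => (hle a).trans (h a)⟩

theorem PolyBd.const (n : ℕ) : PolyBd (fun _ : α => n) := by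
  refine ⟨n, fun a => ?_⟩
  have h1 : 2 ≤ sz a + 1 := by have := sz_pos a; omega
  exact (Nat.lt_two_pow_self).le.trans (Nat.pow_le_pow_left h1 n)

theorem PolyBd.sz : PolyBd (fun a : α => IndelCode.sz a) := ⟨1, fun a => by simp⟩

theorem PolyBd.add {τ υ : α → ℕ} (h : PolyBd τ) (h' : PolyBd υ) :
    PolyBd (fun a => τ a + υ a) := by
  obtain ⟨d, h⟩ := h
  obtain ⟨d', h'⟩ := h'
  refine ⟨max d d' + 1, fun a => ?_⟩
  have h1 : 2 ≤ IndelCode.sz a + 1 := by have := sz_pos a; omega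
  have h2 := (h a).trans (Nat.pow_le_pow_right (by omega) (le_max_left d d'))
  have h3 := (h' a).trans (Nat.pow_le_pow_right (by omega) (le_max_right d d'))
  rw [pow_succ]
  nlinarith

theorem PolyBd.mul {τ υ : α → ℕ} (h : PolyBd τ) (h' : PolyBd υ) :
    PolyBd (fun a => τ a * υ a) := by
  obtain ⟨d, h⟩ := h
  obtain ⟨d', h'⟩ := h'
  refine ⟨d + d', fun a => ?_⟩
  rw [pow_add]
  exact Nat.mul_le_mul (h a) (h' a)

theorem PolyBd.pow {τ : α → ℕ} (h : PolyBd τ) (m : ℕ) : PolyBd (fun a => τ a ^ m) := by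
  obtain ⟨d, h⟩ := h
  refine ⟨d * m, fun a => ?_⟩
  rw [pow_mul]
  exact Nat.pow_le_pow_left (h a) m

theorem PolyBd.comp {τ : β → ℕ} {g : α → β} (h : PolyBd τ)
    (hg : PolyBd fun a => IndelCode.sz (g a)) : PolyBd (fun a => τ (g a)) := by
  obtain ⟨d, h⟩ := h
  exact ((hg.add (PolyBd.const 1)).pow d).mono fun a => h (g a)

/-- `f` is computed by a program whose running time and output are bounded by a polynomial in the
size of the input. The size has to be bounded separately, because trees with equal parts can be
built in fewer steps than they have nodes. -/
@[fun_prop]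
def PolyTime (f : α → β) : Prop :=
  ∃ (p : Prog) (τ : α → ℕ), PolyBd τ ∧ ∀ a, ∃ t, Run p (enc a) (enc (f a)) t ∧ t + sz (f a) ≤ τ a

theorem PolyTime.polyBd_sz {f : α → β} (hf : PolyTime f) : PolyBd (fun a => sz (f a)) := by
  obtain ⟨p, τ, hτ, h⟩ := hf
  refine hτ.mono fun a => ?_
  obtain ⟨t, -, ht⟩ := h a
  omega

theorem PolyTime.polyBd {f : α → ℕ} (hf : PolyTime f) : PolyBd f :=
  hf.polyBd_sz.mono fun a => by rw [sz_nat]; omega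

theorem PolyTime.of_run {f : α → β} (p : Prog) (τ : α → ℕ) (hτ : PolyBd τ)
    (hf : PolyBd fun a => sz (f a)) (h : ∀ a, ∃ t, Run p (enc a) (enc (f a)) t ∧ t ≤ τ a) :
    PolyTime f :=
  ⟨p, fun a => τ a + sz (f a), hτ.add hf, fun a => by
    obtain ⟨t, h1, h2⟩ := h a
    exact ⟨t, h1, Nat.add_le_add_right h2 _⟩⟩

/-- Polynomial time depends only on the trees that represent the values. -/
theorem PolyTime.of_enc_eq {f : α → β} {g : α → γ} (hf : PolyTime f)
    (h : ∀ a, enc (g a) = enc (f a)) : PolyTime g := by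
  obtain ⟨p, τ, hτ, h'⟩ := hf
  refine ⟨p, τ, hτ, fun a => ?_⟩
  obtain ⟨t, h1, h2⟩ := h' a
  exact ⟨t, by rwa [h a], by rwa [sz, h a]⟩

@[fun_prop]
theorem PolyTime.id : PolyTime (fun x : α => x) :=
  .of_run .input (fun _ => 1) (.const 1) .sz fun _ => ⟨1, .input _, le_rfl⟩

/-- A program that returns a given tree. -/
def Prog.const : Sexp → Prog
  | .nil => .nil
  | .cons x y => .cons (Prog.const x) (Prog.const y)

theorem run_const (x y : Sexp) : Run (Prog.const y) x y y.size := by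
  induction y with
  | nil => exact .nil x
  | cons y z hy hz => exact .cons hy hz

@[fun_prop]
theorem PolyTime.const (b : β) : PolyTime (fun _ : α => b) :=
  .of_run (Prog.const (enc b)) (fun _ => sz b) (.const _) (.const _)
    fun _ => ⟨_, run_const _ _, le_rfl⟩

@[fun_prop]
theorem PolyTime.comp {f : β → γ} {g : α → β} (hf : PolyTime f) (hg : PolyTime g) :
    PolyTime (fun x => f (g x)) := by
  have hsz := hg.polyBd_sz
  have hsf := hf.polyBd_sz
  obtain ⟨p, τ, hτ, h⟩ := hf
  obtain ⟨q, υ, hυ, h'⟩ := hg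
  refine .of_run (.seq q p) (fun a => υ a + τ (g a) + 1)
    ((hυ.add (hτ.comp hsz)).add (.const 1)) (hsf.comp hsz) fun a => ?_
  obtain ⟨t, h1, h2⟩ := h' a
  obtain ⟨u, h3, h4⟩ := h (g a)
  exact ⟨_, .seq h1 h3, by omega⟩

@[fun_prop]
theorem PolyTime.mk {f : α → β} {g : α → γ} (hf : PolyTime f) (hg : PolyTime g) :
    PolyTime (fun x => (f x, g x)) := by
  have hsz := hg.polyBd_sz
  have hsf := hf.polyBd_sz
  obtain ⟨p, τ, hτ, h⟩ := hf
  obtain ⟨q, υ, hυ, h'⟩ := hg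
  refine .of_run (.cons p q) (fun a => τ a + υ a + 1) ((hτ.add hυ).add (.const 1))
    ((hsf.add hsz).add (.const 1)) fun a => ?_
  obtain ⟨t, h1, h2⟩ := h a
  obtain ⟨u, h3, h4⟩ := h' a
  exact ⟨_, .cons h1 h3, by omega⟩

theorem PolyTime.fst' : PolyTime (fun x : α × β => x.1) :=
  .of_run .head (fun _ => 1) (.const 1) (PolyBd.sz.mono fun a => by
    rw [← Prod.mk.eta (p := a), sz_pair]; simp only; omega) fun _ => ⟨1, .head _, le_rfl⟩

theorem PolyTime.snd' : PolyTime (fun x : α × β => x.2) :=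
  .of_run .tail (fun _ => 1) (.const 1) (PolyBd.sz.mono fun a => by
    rw [← Prod.mk.eta (p := a), sz_pair]; simp only; omega) fun _ => ⟨1, .tail _, le_rfl⟩

@[fun_prop]
theorem PolyTime.fst {f : γ → α × β} (hf : PolyTime f) : PolyTime (fun x => (f x).1) :=
  PolyTime.fst'.comp hf

@[fun_prop]
theorem PolyTime.snd {f : γ → α × β} (hf : PolyTime f) : PolyTime (fun x => (f x).2) :=
  PolyTime.snd'.comp hf

@[fun_prop]
theorem PolyTime.ite {c : α → Prop} [DecidablePred c] {f g : α → β}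
    (hc : PolyTime fun x => decide (c x)) (hf : PolyTime f) (hg : PolyTime g) :
    PolyTime (fun x => if c x then f x else g x) := by
  have hsz := hg.polyBd_sz
  have hsf := hf.polyBd_sz
  obtain ⟨o, ρ, hρ, h₀⟩ := hc
  obtain ⟨p, τ, hτ, h⟩ := hf
  obtain ⟨q, υ, hυ, h'⟩ := hg
  refine .of_run (.ifte o p q) (fun a => ρ a + (τ a + υ a) + 1)
    ((hρ.add (hτ.add hυ)).add (.const 1)) ((hsf.add hsz).mono fun a => ?_) fun a => ?_
  · split_ifs <;> omega
  · obtain ⟨s, h5, h6⟩ := h₀ a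
    obtain ⟨t, h1, h2⟩ := h a
    obtain ⟨u, h3, h4⟩ := h' a
    by_cases hca : c a
    · simp only [hca, decide_true] at h5
      simp only [hca, if_true]
      exact ⟨_, .ifte_true h5 h1, by omega⟩
    · simp only [hca, decide_false] at h5
      simp only [hca, if_false]
      exact ⟨_, .ifte_false h5 h3, by omega⟩

@[fun_prop]
theorem PolyTime.cons {f : α → β} {g : α → List β} (hf : PolyTime f) (hg : PolyTime g) :
    PolyTime (fun x => f x :: g x) :=
  (hf.mk hg).of_enc_eq fun _ => rfl

theorem PolyTime.tail' : PolyTime (fun x : List α => x.tail) :=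
  .of_run .tail (fun _ => 1) (.const 1) (PolyBd.sz.mono fun a => sz_sublist a.tail_sublist)
    fun a => ⟨1, by cases a <;> exact .tail _, le_rfl⟩

@[fun_prop]
theorem PolyTime.tail {f : γ → List α} (hf : PolyTime f) : PolyTime (fun x => (f x).tail) :=
  PolyTime.tail'.comp hf

/-- The program tests whether its first component is `nil`. -/
theorem PolyTime.headD' : PolyTime (fun x : List α × α => x.1.headD x.2) := by
  refine .of_run (.ifte .head (.seq .head .head) .tail) (fun _ => 5) (.const 5)
    (PolyBd.sz.mono ?_) ?_
  · rintro ⟨l, a⟩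
    rw [sz_pair]
    cases l with
    | nil => simp only [List.headD_nil]; omega
    | cons b l => rw [sz_list_cons]; simp only [List.headD_cons]; omega
  · rintro ⟨l, a⟩
    cases l with
    | nil => exact ⟨_, .ifte_false (.head _) (.tail _), by omega⟩
    | cons b l => exact ⟨_, .ifte_true (.head _) (.seq (.head _) (.head _)), by omega⟩

@[fun_prop]
theorem PolyTime.headD {f : γ → List α} {g : γ → α} (hf : PolyTime f) (hg : PolyTime g) :
    PolyTime (fun x => (f x).headD (g x)) :=
  PolyTime.headD'.comp (hf.mk hg)

theorem PolyTime.isEmpty' : PolyTime (fun x : List α => x.isEmpty) := by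
  refine .of_run (.ifte .input .nil (.cons .nil .nil)) (fun _ => 5) (.const 5)
    ((PolyBd.const 3).mono fun a => sz_bool _) ?_
  rintro (_ | ⟨b, l⟩)
  · exact ⟨_, .ifte_false (.input _) (.cons (.nil _) (.nil _)), by omega⟩
  · exact ⟨_, .ifte_true (.input _) (.nil _), by omega⟩

@[fun_prop]
theorem PolyTime.isEmpty {f : γ → List α} (hf : PolyTime f) :
    PolyTime (fun x => (f x).isEmpty) :=
  PolyTime.isEmpty'.comp hf

/-! ### Folds -/

/-- One round of the loop that computes a left fold: the current tree consists of the rest of the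
list, the context and the accumulator. -/
def Prog.foldBody (p : Prog) : Prog :=
  .cons (.seq .head .tail) (.cons (.seq .tail .head)
    (.seq (.cons (.seq .tail .head) (.cons (.seq .tail .tail) (.seq .head .head))) p))

/-- A program that computes a left fold, from programs for the list, the initial value and the
step. -/
def Prog.fold (pl pi ps : Prog) : Prog :=
  .seq (.cons pl (.cons .input pi)) (.seq (.loop .head (Prog.foldBody ps)) (.seq .tail .tail))

theorem run_fold_loop {step : σ → α → σ} {ps : Prog} {x : Sexp} {T : ℕ} (l : List α) :
    ∀ s : σ, (∀ l₁ a l₂, l = l₁ ++ a :: l₂ → ∃ t,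
        Run ps (.cons x (.cons (enc (l₁.foldl step s)) (enc a)))
          (enc (step (l₁.foldl step s) a)) t ∧ t ≤ T) →
      ∃ t, Run (.loop .head (Prog.foldBody ps)) (.cons (enc l) (.cons x (enc s)))
        (.cons .nil (.cons x (enc (l.foldl step s)))) t ∧ t ≤ l.length * (T + 30) + 2 := by
  induction l with
  | nil => exact fun s _ => ⟨_, .loop_exit (.head _), by simp⟩
  | cons a l ih =>
    intro s h
    obtain ⟨t, h1, h2⟩ := h [] a l rfl
    obtain ⟨u, h3, h4⟩ := ih (step s a) fun l₁ b l₂ hl => by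
      simpa using h (a :: l₁) b l₂ (by simp [hl])
    refine ⟨_, .loop_next (.head _) (.cons (.seq (.head _) (.tail _)) (.cons
      (.seq (.tail _) (.head _)) (.seq (.cons (.seq (.tail _) (.head _))
      (.cons (.seq (.tail _) (.tail _)) (.seq (.head _) (.head _)))) h1))) h3, ?_⟩
    simp only [List.length_cons, add_mul]
    omega

theorem run_fold {step : σ → α → σ} {pl pi ps : Prog} {x : Sexp} {l : List α} {s : σ}
    {T t₁ t₂ : ℕ} (hl : Run pl x (enc l) t₁) (hi : Run pi x (enc s) t₂)
    (h : ∀ l₁ a l₂, l = l₁ ++ a :: l₂ → ∃ t,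
        Run ps (.cons x (.cons (enc (l₁.foldl step s)) (enc a)))
          (enc (step (l₁.foldl step s) a)) t ∧ t ≤ T) :
    ∃ t, Run (Prog.fold pl pi ps) x (enc (l.foldl step s)) t ∧
      t ≤ t₁ + t₂ + l.length * (T + 30) + 10 := by
  obtain ⟨u, h3, h4⟩ := run_fold_loop l s h
  exact ⟨_, .seq (.cons hl (.cons (.input _) hi)) (.seq h3 (.seq (.tail _) (.tail _))), by omega⟩

/-- A left fold takes polynomial time if its step does and all intermediate values have polynomial
size. -/
theorem PolyTime.foldl {l : γ → List α} {init : γ → σ} {step : γ → σ → α → σ} {B : γ → ℕ}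
    (hs : PolyTime fun x : γ × σ × α => step x.1 x.2.1 x.2.2) (hl : PolyTime l)
    (hi : PolyTime init) (hB : PolyBd B)
    (h : ∀ c l₁ l₂, l c = l₁ ++ l₂ → sz (l₁.foldl (step c) (init c)) ≤ B c) :
    PolyTime (fun c => (l c).foldl (step c) (init c)) := by
  have hsz := hl.polyBd_sz
  obtain ⟨pl, τl, hτl, hl⟩ := hl
  obtain ⟨pi, τi, hτi, hi⟩ := hi
  obtain ⟨ps, τs, ⟨d, hτs⟩, hs⟩ := hs
  refine .of_run (Prog.fold pl pi ps) (fun c => τl c + τi c + sz (l c) *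
    ((sz c + (B c + sz (l c) + 1) + 1 + 1) ^ d + 30) + 10) ?_
    (hB.mono fun c => h c (l c) [] (by simp)) fun c => ?_
  · exact ((hτl.add hτi).add (hsz.mul ((((((PolyBd.sz.add ((hB.add hsz).add (.const 1))).add
      (.const 1)).add (.const 1)).pow d).add (.const 30))))).add (.const 10)
  · obtain ⟨t₁, h1, h2⟩ := hl c
    obtain ⟨t₂, h3, h4⟩ := hi c
    obtain ⟨t, h5, h6⟩ := run_fold (ps := ps) (step := step c)
      (T := (sz c + (B c + sz (l c) + 1) + 1 + 1) ^ d) h1 h3 fun l₁ a l₂ hla => by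
        obtain ⟨t, h5, h6⟩ := hs (c, l₁.foldl (step c) (init c), a)
        refine ⟨t, h5, ((Nat.le_of_add_right_le h6).trans (hτs _)).trans (Nat.pow_le_pow_left ?_ d)⟩
        have h7 := h c l₁ (a :: l₂) hla
        have h8 : sz a ≤ sz (l c) := sz_le_of_mem (by rw [hla]; simp)
        simp only [sz_pair]
        omega
    refine ⟨t, h5, h6.trans ?_⟩
    have := Nat.mul_le_mul_right ((sz c + (B c + sz (l c) + 1) + 1 + 1) ^ d + 30)
      (length_lt_sz (l c)).le
    omega

/-- The version of `PolyTime.foldl` for steps that preserve an invariant which bounds the size. -/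
theorem PolyTime.foldl_inv {l : γ → List α} {init : γ → σ} {step : γ → σ → α → σ}
    (P : γ → σ → Prop) {B : γ → ℕ}
    (hs : PolyTime fun x : γ × σ × α => step x.1 x.2.1 x.2.2) (hl : PolyTime l)
    (hi : PolyTime init) (hB : PolyBd B) (h₀ : ∀ c, P c (init c))
    (h : ∀ c s, ∀ a ∈ l c, P c s → P c (step c s a)) (hP : ∀ c s, P c s → sz s ≤ B c) :
    PolyTime (fun c => (l c).foldl (step c) (init c)) := by
  refine .foldl hs hl hi hB fun c l₁ l₂ hc => hP c _ ?_
  have hm : ∀ a ∈ l₁, a ∈ l c := fun a ha => by rw [hc]; simp [ha]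
  clear hc
  induction l₁ using List.reverseRecOn with
  | nil => exact h₀ c
  | append_singleton l₁ a ih =>
    rw [List.foldl_append]
    exact h c _ a (hm a (by simp)) (ih fun b hb => hm b (by simp [hb]))

/-- The version of `PolyTime.foldl` for steps that enlarge the accumulator by a bounded amount. -/
theorem PolyTime.foldl_add {l : γ → List α} {init : γ → σ} {step : γ → σ → α → σ} {D : γ → ℕ}
    (hs : PolyTime fun x : γ × σ × α => step x.1 x.2.1 x.2.2) (hl : PolyTime l)
    (hi : PolyTime init) (hD : PolyBd D)
    (h : ∀ c s, ∀ a ∈ l c, sz (step c s a) ≤ sz s + D c) :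
    PolyTime (fun c => (l c).foldl (step c) (init c)) := by
  refine .foldl (B := fun c => sz (init c) + sz (l c) * D c) hs hl hi
    (hi.polyBd_sz.add (hl.polyBd_sz.mul hD)) fun c l₁ l₂ hc => ?_
  have hm : ∀ a ∈ l₁, a ∈ l c := fun a ha => by rw [hc]; simp [ha]
  have hlen : l₁.length ≤ sz (l c) := by
    refine le_trans ?_ (length_lt_sz (l c)).le
    rw [hc, List.length_append]; omega
  refine le_trans ?_ (Nat.add_le_add_left (Nat.mul_le_mul_right (D c) hlen) _)
  clear hc hlen
  induction l₁ using List.reverseRecOn with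
  | nil => simp
  | append_singleton l₁ a ih =>
    rw [List.foldl_append]
    have h1 := h c (l₁.foldl (step c) (init c)) a (hm a (by simp))
    have h2 := ih fun b hb => hm b (by simp [hb])
    simp only [List.foldl_cons, List.foldl_nil, List.length_append, List.length_singleton, add_mul,
      one_mul]
    omega

end Basic


/-! ### Lists and numbers in polynomial time -/

section ListLibrary

variable {α β γ δ σ : Type} [Enc α] [Enc β] [Enc γ] [Enc δ] [Enc σ]

theorem PolyTime.reverseAux {f g : γ → List α} (hf : PolyTime f) (hg : PolyTime g) :
    PolyTime (fun x => (f x).reverseAux (g x)) := by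
  have h : PolyTime (fun c => (f c).foldl (fun s a => a :: s) (g c)) :=
    .foldl_add (D := fun c => sz (f c) + 1) (by fun_prop) hf hg
      (hf.polyBd_sz.add (.const 1)) fun c s a ha => by
        have := sz_le_of_mem ha
        rw [sz_list_cons]; omega
  refine h.of_enc_eq fun c => congrArg enc ?_
  generalize g c = m
  induction f c generalizing m with
  | nil => rfl
  | cons a l ih => exact ih (a :: m)

@[fun_prop]
theorem PolyTime.reverse {f : γ → List α} (hf : PolyTime f) :
    PolyTime (fun x => (f x).reverse) :=
  hf.reverseAux (.const [])

@[fun_prop]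
theorem PolyTime.append {f g : γ → List α} (hf : PolyTime f) (hg : PolyTime g) :
    PolyTime (fun x => f x ++ g x) := by
  have h := hf.reverse.reverseAux hg
  simp only [List.reverseAux_eq, List.reverse_reverse] at h
  exact h

@[fun_prop]
theorem PolyTime.decide_eq_true {f : γ → Bool} (hf : PolyTime f) :
    PolyTime (fun x => decide (f x = true)) :=
  hf.of_enc_eq fun _ => congrArg enc Bool.decide_eq_true

@[fun_prop]
theorem PolyTime.flatMap {f : γ → α → List β} {l : γ → List α}
    (hf : PolyTime fun x : γ × α => f x.1 x.2) (hl : PolyTime l) :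
    PolyTime (fun x => (l x).flatMap (f x)) := by
  obtain ⟨d, hd⟩ := hf.polyBd_sz
  have h : PolyTime (fun c => (l c).foldl (fun s a => s ++ f c a) []) :=
    .foldl_add (D := fun c => (sz c + sz (l c) + 2) ^ d)
      ((by fun_prop : PolyTime fun x : γ × List β × α => x.2.1).append
        (hf.comp (by fun_prop : PolyTime fun x : γ × List β × α => (x.1, x.2.2)))) hl (.const [])
      (((PolyBd.sz.add hl.polyBd_sz).add (.const 2)).pow d) fun c s a ha => by
        have h1 := sz_le_of_mem ha
        have h2 := sz_list_append s (f c a)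
        have h3 := (hd (c, a)).trans (Nat.pow_le_pow_left (m := sz c + sz (l c) + 2)
          (by rw [sz_pair]; omega) d)
        simp only at h3
        omega
  refine h.of_enc_eq fun c => congrArg enc ?_
  rw [List.flatMap_eq_foldl]

@[fun_prop]
theorem PolyTime.map {f : γ → α → β} {l : γ → List α}
    (hf : PolyTime fun x : γ × α => f x.1 x.2) (hl : PolyTime l) :
    PolyTime (fun x => (l x).map (f x)) := by
  have h : PolyTime (fun c => (l c).flatMap fun a => [f c a]) := by fun_prop
  refine h.of_enc_eq fun c => congrArg enc ?_
  rw [List.map_eq_flatMap]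

@[fun_prop]
theorem PolyTime.filter {f : γ → α → Bool} {l : γ → List α}
    (hf : PolyTime fun x : γ × α => f x.1 x.2) (hl : PolyTime l) :
    PolyTime (fun x => (l x).filter (f x)) := by
  have h : PolyTime (fun c => (l c).flatMap fun a => if f c a = true then [a] else []) :=
    PolyTime.flatMap (.ite hf.decide_eq_true (by fun_prop) (by fun_prop)) hl
  refine h.of_enc_eq fun c => congrArg enc ?_
  induction l c with
  | nil => rfl
  | cons a l ih => simp only [List.filter_cons, List.flatMap_cons, ih]; split_ifs <;> simp

@[fun_prop]
theorem PolyTime.not {f : γ → Bool} (hf : PolyTime f) : PolyTime (fun x => !f x) := by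
  have h : PolyTime (fun c => if f c = true then false else true) :=
    .ite hf.decide_eq_true (by fun_prop) (by fun_prop)
  exact h.of_enc_eq fun c => by cases f c <;> rfl

@[fun_prop]
theorem PolyTime.and {f g : γ → Bool} (hf : PolyTime f) (hg : PolyTime g) :
    PolyTime (fun x => f x && g x) := by
  have h : PolyTime (fun c => if f c = true then g c else false) :=
    .ite hf.decide_eq_true (by fun_prop) (by fun_prop)
  exact h.of_enc_eq fun c => by cases f c <;> rfl

@[fun_prop]
theorem PolyTime.decide_and {p q : γ → Prop} [DecidablePred p] [DecidablePred q]
    (hp : PolyTime fun x => decide (p x)) (hq : PolyTime fun x => decide (q x)) :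
    PolyTime (fun x => decide (p x ∧ q x)) :=
  (hp.and hq).of_enc_eq fun c => by simp

@[fun_prop]
theorem PolyTime.decide_not {p : γ → Prop} [DecidablePred p]
    (hp : PolyTime fun x => decide (p x)) :
    PolyTime (fun x => decide (¬ p x)) :=
  hp.not.of_enc_eq fun c => by simp

@[fun_prop]
theorem PolyTime.decide_or {p q : γ → Prop} [DecidablePred p] [DecidablePred q]
    (hp : PolyTime fun x => decide (p x)) (hq : PolyTime fun x => decide (q x)) :
    PolyTime (fun x => decide (p x ∨ q x)) :=
  (hp.not.and hq.not).not.of_enc_eq fun c => by simp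

@[fun_prop]
theorem PolyTime.decide_ball {p : γ → α → Prop} [∀ x, DecidablePred (p x)] {l : γ → List α}
    (hp : PolyTime fun x : γ × α => decide (p x.1 x.2)) (hl : PolyTime l) :
    PolyTime (fun x => decide (∀ a ∈ l x, p x a)) := by
  have h : PolyTime (fun c => ((l c).filter fun a => !decide (p c a)).isEmpty) :=
    (PolyTime.filter hp.not hl).isEmpty
  refine h.of_enc_eq fun c => congrArg enc ?_
  rw [Bool.eq_iff_iff]
  simp [List.filter_eq_nil_iff]

/-- A list of units is a number in unary. -/
@[fun_prop]
theorem PolyTime.length {f : γ → List α} (hf : PolyTime f) :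
    PolyTime (fun x => (f x).length) := by
  have h : PolyTime (fun c => (f c).map fun _ => ()) := by fun_prop
  exact h.of_enc_eq fun c => by rw [enc_nat_eq, List.map_const']

/-- A number in unary is a list of units. -/
theorem PolyTime.units {f : γ → ℕ} (hf : PolyTime f) :
    PolyTime (fun x => List.replicate (f x) ()) :=
  hf.of_enc_eq fun c => by rw [enc_nat_eq]

@[fun_prop]
theorem PolyTime.replicate {f : γ → ℕ} {g : γ → α} (hf : PolyTime f) (hg : PolyTime g) :
    PolyTime (fun x => List.replicate (f x) (g x)) := by
  have h : PolyTime (fun c => (List.replicate (f c) ()).map fun _ => g c) :=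
    PolyTime.map (by fun_prop) hf.units
  exact h.of_enc_eq fun c => congrArg enc (by simp)

theorem iterate_eq_foldl_units {τ : Type} (f : τ → τ) (n : ℕ) (s : τ) :
    f^[n] s = (List.replicate n ()).foldl (fun s _ => f s) s := by
  induction n generalizing s with
  | zero => rfl
  | succ n ih => simp [List.replicate_succ, ih]

/-- Iterating a function that preserves an invariant which bounds the size. -/
theorem PolyTime.iterate {n : γ → ℕ} {init : γ → σ} {step : γ → σ → σ}
    (P : γ → σ → Prop) {B : γ → ℕ}
    (hs : PolyTime fun x : γ × σ => step x.1 x.2) (hn : PolyTime n)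
    (hi : PolyTime init) (hB : PolyBd B) (h₀ : ∀ c, P c (init c))
    (h : ∀ c s, P c s → P c (step c s)) (hP : ∀ c s, P c s → sz s ≤ B c) :
    PolyTime (fun c => (step c)^[n c] (init c)) := by
  simp only [iterate_eq_foldl_units]
  exact .foldl_inv P (hs.comp (by fun_prop : PolyTime fun x : γ × σ × Unit => (x.1, x.2.1)))
    hn.units hi hB h₀ (fun c s _ _ => h c s) hP

/-- Iterating a function that enlarges its argument by a bounded amount. -/
theorem PolyTime.iterate_add {n : γ → ℕ} {init : γ → σ} {step : γ → σ → σ} {D : γ → ℕ}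
    (hs : PolyTime fun x : γ × σ => step x.1 x.2) (hn : PolyTime n)
    (hi : PolyTime init) (hD : PolyBd D) (h : ∀ c s, sz (step c s) ≤ sz s + D c) :
    PolyTime (fun c => (step c)^[n c] (init c)) := by
  simp only [iterate_eq_foldl_units]
  exact .foldl_add (hs.comp (by fun_prop : PolyTime fun x : γ × σ × Unit => (x.1, x.2.1)))
    hn.units hi hD (fun c s _ _ => h c s)

@[fun_prop]
theorem PolyTime.add {f g : γ → ℕ} (hf : PolyTime f) (hg : PolyTime g) :
    PolyTime (fun x => f x + g x) := by
  have h : PolyTime (fun c => (List.replicate (f c) () ++ List.replicate (g c) ()).length) :=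
    (hf.units.append hg.units).length
  exact h.of_enc_eq fun c => congrArg enc (by simp)

@[fun_prop]
theorem PolyTime.pred {f : γ → ℕ} (hf : PolyTime f) : PolyTime (fun x => f x - 1) := by
  have h : PolyTime (fun c => (List.replicate (f c) ()).tail.length) := hf.units.tail.length
  exact h.of_enc_eq fun c => congrArg enc (by simp)

@[fun_prop]
theorem PolyTime.drop {f : γ → ℕ} {l : γ → List α} (hf : PolyTime f) (hl : PolyTime l) :
    PolyTime (fun x => (l x).drop (f x)) := by
  have h : PolyTime (fun c => (List.tail)^[f c] (l c)) :=
    .iterate (fun c m => m.Sublist (l c)) (by fun_prop) hf hl hl.polyBd_sz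
      (fun c => List.Sublist.refl _) (fun c s hs => (List.tail_sublist s).trans hs)
      fun c s hs => sz_sublist hs
  refine h.of_enc_eq fun c => congrArg enc ?_
  generalize l c = m
  induction f c generalizing m with
  | zero => rfl
  | succ n ih => rw [Function.iterate_succ_apply, ← ih, List.drop_tail]

@[fun_prop]
theorem PolyTime.sub {f g : γ → ℕ} (hf : PolyTime f) (hg : PolyTime g) :
    PolyTime (fun x => f x - g x) := by
  have h : PolyTime (fun c => ((List.replicate (f c) ()).drop (g c)).length) :=
    (hg.drop hf.units).length
  exact h.of_enc_eq fun c => congrArg enc (by simp)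

@[fun_prop]
theorem PolyTime.mul {f g : γ → ℕ} (hf : PolyTime f) (hg : PolyTime g) :
    PolyTime (fun x => f x * g x) := by
  have h : PolyTime (fun c => ((List.replicate (f c) ()).flatMap
      fun _ => List.replicate (g c) ()).length) :=
    (PolyTime.flatMap (hg.comp PolyTime.fst').units hf.units).length
  exact h.of_enc_eq fun c => congrArg enc (by simp [List.length_flatMap])

@[fun_prop]
theorem PolyTime.decide_le {f g : γ → ℕ} (hf : PolyTime f) (hg : PolyTime g) :
    PolyTime (fun x => decide (f x ≤ g x)) := by
  have h : PolyTime (fun c => (List.replicate (f c - g c) ()).isEmpty) := (hf.sub hg).units.isEmpty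
  refine h.of_enc_eq fun c => congrArg enc ?_
  rw [Bool.eq_iff_iff]
  simp [Nat.sub_eq_zero_iff_le]

@[fun_prop]
theorem PolyTime.decide_lt {f g : γ → ℕ} (hf : PolyTime f) (hg : PolyTime g) :
    PolyTime (fun x => decide (f x < g x)) :=
  (hg.decide_le hf).not.of_enc_eq fun c => congrArg enc (by
    rw [Bool.eq_iff_iff]; simp)

@[fun_prop]
theorem PolyTime.decide_eq {f g : γ → ℕ} (hf : PolyTime f) (hg : PolyTime g) :
    PolyTime (fun x => decide (f x = g x)) :=
  ((hf.decide_le hg).and (hg.decide_le hf)).of_enc_eq fun c => congrArg enc (by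
    rw [Bool.eq_iff_iff]; simp [le_antisymm_iff])

@[fun_prop]
theorem PolyTime.range {f : γ → ℕ} (hf : PolyTime f) : PolyTime (fun x => List.range (f x)) := by
  have key : ∀ n, (List.replicate n ()).foldl (fun s _ => s ++ [s.length]) [] = List.range n := by
    intro n
    induction n with
    | zero => rfl
    | succ n ih => rw [List.replicate_succ', List.foldl_append, ih]; simp [List.range_succ]
  have h : PolyTime (fun c => (List.replicate (f c) ()).foldl
      (fun (s : List ℕ) _ => s ++ [s.length]) []) := by
    refine .foldl (B := fun c => f c * (2 * f c + 1 + 1) + 1) (by fun_prop) hf.units (.const [])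
      ((hf.polyBd.mul ((((PolyBd.const 2).mul hf.polyBd).add (.const 1)).add (.const 1))).add
        (.const 1)) fun c l₁ l₂ hc => ?_
    obtain ⟨hl, h1, -⟩ := List.replicate_eq_append_iff.1 hc
    rw [h1, key]
    refine (sz_le_of_forall (B := 2 * f c + 1) fun a ha => ?_).trans ?_
    · rw [List.mem_range] at ha
      rw [sz_nat]; omega
    · rw [List.length_range]
      gcongr
      omega
  exact h.of_enc_eq fun c => congrArg enc (key _).symm

@[fun_prop]
theorem PolyTime.decide_forall_lt {p : γ → ℕ → Prop} [∀ x, DecidablePred (p x)] {n : γ → ℕ}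
    (hp : PolyTime fun x : γ × ℕ => decide (p x.1 x.2)) (hn : PolyTime n) :
    PolyTime (fun x => decide (∀ a < n x, p x a)) :=
  (PolyTime.decide_ball hp hn.range).of_enc_eq fun c => congrArg enc (by simp)

@[fun_prop]
theorem PolyTime.sum_list {l : γ → List ℕ} (hl : PolyTime l) : PolyTime (fun x => (l x).sum) := by
  have h : PolyTime (fun c => ((l c).flatMap fun n => List.replicate n ()).length) :=
    (PolyTime.flatMap PolyTime.snd'.units hl).length
  exact h.of_enc_eq fun c => congrArg enc (by simp [List.length_flatMap])

@[fun_prop]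
theorem PolyTime.sum_range {f : γ → ℕ → ℕ} {n : γ → ℕ} (hf : PolyTime fun x : γ × ℕ => f x.1 x.2)
    (hn : PolyTime n) : PolyTime (fun x => ∑ i ∈ Finset.range (n x), f x i) := by
  have h : PolyTime (fun c => ((List.range (n c)).map (f c)).sum) := by fun_prop
  exact h.of_enc_eq fun c => congrArg enc rfl

theorem headD_filter_spec {α : Type} {l : List α} {q : α → Bool} (d : α)
    (h : ∃ a ∈ l, q a = true) :
    (l.filter q).headD d ∈ l ∧ q ((l.filter q).headD d) = true := by
  obtain ⟨a, ha, hq⟩ := h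
  rcases hL : l.filter q with _ | ⟨x, L⟩
  · exact absurd (hL ▸ List.mem_filter.2 ⟨ha, hq⟩) (by simp)
  · exact List.mem_filter.1 (by rw [hL]; exact List.mem_cons_self)

theorem headD_filter_mem_or {α : Type} (l : List α) (q : α → Bool) (d : α) :
    (l.filter q).headD d ∈ l ∨ (l.filter q).headD d = d := by
  rcases hL : l.filter q with _ | ⟨x, L⟩
  · exact .inr rfl
  · have h : x ∈ l.filter q := by rw [hL]; exact List.mem_cons_self
    exact .inl (List.mem_filter.1 h).1

theorem length_filter_range_lt {m n : ℕ} (h : m ≤ n) :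
    ((List.range n).filter fun j => decide (j < m)).length = m := by
  induction n, h using Nat.le_induction with
  | base => rw [List.filter_eq_self.2 (by simp), List.length_range]
  | succ n hn ih => rw [List.range_succ, List.filter_append, List.length_append, ih]; simp [hn]

@[fun_prop]
theorem PolyTime.div {f g : γ → ℕ} (hf : PolyTime f) (hg : PolyTime g) :
    PolyTime (fun x => f x / g x) := by
  have h : PolyTime (fun c => if g c = 0 then 0 else
      ((List.range (f c)).filter fun j => decide ((j + 1) * g c ≤ f c)).length) := by fun_prop
  refine h.of_enc_eq fun c => congrArg enc ?_
  split_ifs with h0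
  · simp [h0]
  · rw [← length_filter_range_lt (Nat.div_le_self (f c) (g c))]
    congr 2
    funext j
    simp only [Nat.lt_iff_add_one_le, Nat.le_div_iff_mul_le (Nat.pos_of_ne_zero h0)]

@[fun_prop]
theorem PolyTime.mod {f g : γ → ℕ} (hf : PolyTime f) (hg : PolyTime g) :
    PolyTime (fun x => f x % g x) := by
  have h : PolyTime (fun c => f c - g c * (f c / g c)) := by fun_prop
  exact h.of_enc_eq fun c => congrArg enc (Nat.mod_eq_sub _ _)

@[fun_prop]
theorem PolyTime.sup_range {f : γ → ℕ → ℕ} {n : γ → ℕ} (hf : PolyTime fun x : γ × ℕ => f x.1 x.2)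
    (hn : PolyTime n) : PolyTime (fun x => (Finset.range (n x)).sup (f x)) := by
  have h : PolyTime (fun c => ((List.range (∑ i ∈ Finset.range (n c), f c i)).filter
      fun v => decide (¬ ∀ i < n c, f c i ≤ v)).length) := by fun_prop
  refine h.of_enc_eq fun c => congrArg enc ?_
  rw [← length_filter_range_lt (m := (Finset.range (n c)).sup (f c))
    (n := ∑ i ∈ Finset.range (n c), f c i)
    (Finset.sup_le fun i hi => Finset.single_le_sum (fun _ _ => Nat.zero_le _) hi)]
  congr 2
  funext j
  simp only [Finset.lt_sup_iff, Finset.mem_range, not_forall, not_le, exists_prop]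

@[fun_prop]
theorem PolyTime.min {f g : γ → ℕ} (hf : PolyTime f) (hg : PolyTime g) :
    PolyTime (fun x => min (f x) (g x)) := by
  have h : PolyTime (fun c => f c - (f c - g c)) := by fun_prop
  exact h.of_enc_eq fun c => congrArg enc (by omega)

@[fun_prop]
theorem PolyTime.max {f g : γ → ℕ} (hf : PolyTime f) (hg : PolyTime g) :
    PolyTime (fun x => max (f x) (g x)) := by
  have h : PolyTime (fun c => f c + (g c - f c)) := by fun_prop
  exact h.of_enc_eq fun c => congrArg enc (by omega)

@[fun_prop]
theorem PolyTime.getD {l : γ → List α} {f : γ → ℕ} {g : γ → α} (hl : PolyTime l) (hf : PolyTime f)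
    (hg : PolyTime g) : PolyTime (fun x => (l x).getD (f x) (g x)) := by
  have h : PolyTime (fun c => ((l c).drop (f c)).headD (g c)) := by fun_prop
  exact h.of_enc_eq fun c => congrArg enc (by
    simp [List.headD_eq_head?_getD, List.head?_drop])

@[fun_prop]
theorem PolyTime.take {f : γ → ℕ} {l : γ → List α} (hf : PolyTime f) (hl : PolyTime l) :
    PolyTime (fun x => (l x).take (f x)) := by
  have h : PolyTime (fun c => (List.range (f c)).flatMap fun j =>
      ((l c).map fun a => [a]).getD j []) := by fun_prop
  refine h.of_enc_eq fun c => congrArg enc ?_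
  induction f c with
  | zero => simp
  | succ n ih =>
    rw [List.range_succ, List.flatMap_append, ← ih, List.take_add_one]
    congr 1
    rcases h : (l c)[n]? <;> simp [h]

@[fun_prop]
theorem PolyTime.decide_eq_bool {f g : γ → Bool} (hf : PolyTime f) (hg : PolyTime g) :
    PolyTime (fun x => decide (f x = g x)) := by
  have h : PolyTime (fun c => if f c = true then g c else !g c) := by fun_prop
  exact h.of_enc_eq fun c => congrArg enc (by cases f c <;> cases g c <;> rfl)

@[fun_prop]
theorem PolyTime.decide_eq_bits {f g : γ → List Bool} (hf : PolyTime f) (hg : PolyTime g) :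
    PolyTime (fun x => decide (f x = g x)) := by
  have h : PolyTime (fun c => decide ((f c).length = (g c).length ∧
      ∀ i < (f c).length, (f c).getD i false = (g c).getD i false)) := by fun_prop
  refine h.of_enc_eq fun c => congrArg enc ?_
  rw [decide_eq_decide]
  constructor
  · intro h; simp [h]
  · rintro ⟨h1, h2⟩
    refine List.ext_getElem h1 fun i h3 h4 => ?_
    simpa [h3, h4] using h2 i h3

/-- The binary digits of a number in unary. -/
@[fun_prop]
theorem PolyTime.bits {f : γ → ℕ} (hf : PolyTime f) : PolyTime (fun x => (f x).bits) := by
  have key : ∀ (k n : ℕ) (s : List Bool), n ≤ k →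
      ((List.replicate k ()).foldl (fun (s : ℕ × List Bool) _ =>
        if s.1 = 0 then s else (s.1 / 2, decide (s.1 % 2 = 1) :: s.2)) (n, s)).2 =
      n.bits.reverse ++ s := by
    intro k
    induction k with
    | zero => intro n s h; obtain rfl : n = 0 := by omega
              simp
    | succ k ih =>
      intro n s h
      rw [List.replicate_succ, List.foldl_cons]
      by_cases h0 : n = 0
      · subst h0
        simpa using ih 0 s (Nat.zero_le _)
      · simp only [h0, if_false]
        rw [ih _ _ (by omega)]
        conv_rhs => rw [← Nat.bit_bodd_div2 n]
        rw [Nat.bits_append_bit _ _ (by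
          intro h1; cases hb : n.bodd
          · have := Nat.bodd_add_div2 n; simp [hb, h1] at this; omega
          · rfl)]
        simp [Nat.div2_val, Nat.mod_two_of_bodd]
  have h : PolyTime (fun c => ((List.replicate (f c) ()).foldl (fun (s : ℕ × List Bool) _ =>
        if s.1 = 0 then s else (s.1 / 2, decide (s.1 % 2 = 1) :: s.2)) (f c, [])).2.reverse) := by
    refine (PolyTime.snd (.foldl_add (D := fun c => 4) (by fun_prop) hf.units (by fun_prop)
      (.const 4) fun c s a ha => ?_)).reverse
    split_ifs
    · omega
    · have := sz_bool (decide (s.1 % 2 = 1))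
      rw [← Prod.mk.eta (p := s)]
      simp only [sz_pair, sz_nat, sz_list_cons]
      omega
  refine h.of_enc_eq fun c => congrArg enc ?_
  rw [key _ _ _ le_rfl]
  simp

end ListLibrary

/-! ### A greedy code without long common subsequences -/

section Greedy

/-- The sum of the weights `wt R Q m'` for `m' < m`, as long as it does not exceed the bound `Q`. -/
def wtSum (R Q m : ℕ) : ℕ := (fun s => min Q (s + (s / R + 1)))^[m] 0

/-- The weight of a position that is followed by `m` positions: a positive integer that is at least
an `R`-th of the sum of the weights of these positions. -/
def wt (R Q m : ℕ) : ℕ := wtSum R Q m / R + 1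

/-- How the values of the positions of the word `b` change when the letter `a` is appended to the
other word. The value of a position of `b` is, up to the bound `Q`, the sum of `2 ^ t` over the
common subsequences of length `t` (with multiplicity) that end at this position. -/
def updateValues (Q : ℕ) (b : List ℕ) (v : List ℕ) (a : ℕ) : List ℕ :=
  (List.range b.length).map fun j =>
    if b.getD j 0 = a then min Q (v.getD j 0 + 2 * (1 + ∑ i ∈ Finset.range j, v.getD i 0))
    else v.getD j 0

/-- The values of the positions of `b` with respect to the word `u`. -/
def values (Q : ℕ) (b u : List ℕ) : List ℕ := u.foldl (updateValues Q b) []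

/-- The weighted sum of the values `v` of the `l` positions of a word. -/
def potential (R Q l : ℕ) (v : List ℕ) : ℕ :=
  wt R Q l + ∑ j ∈ Finset.range l, wt R Q (l - 1 - j) * v.getD j 0

/-- The total potential of `u` with respect to the words in `ws`. -/
def score (R Q l : ℕ) (ws : List (List ℕ)) (u : List ℕ) : ℕ :=
  ∑ i ∈ Finset.range ws.length, potential R Q l (values Q (ws.getD i []) u)

/-- Append to `u` the first letter for which the score grows at most by the factor `1 + 1 / R`. -/
def greedyStep (k R Q l : ℕ) (ws : List (List ℕ)) (u : List ℕ) : List ℕ :=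
  u ++ [((List.range k).filter fun a =>
    decide (R * score R Q l ws (u ++ [a]) ≤ (R + 1) * score R Q l ws u)).headD 0]

/-- The word of length `l` that is built greedily against the words in `ws`. -/
def greedyWord (k R Q l : ℕ) (ws : List (List ℕ)) : List ℕ := (greedyStep k R Q l ws)^[l] []

/-- The greedy code with `M` words of length `l` over the letters below `k`. -/
def greedyCode (k R Q l M : ℕ) : List (List ℕ) :=
  (fun ws => ws ++ [greedyWord k R Q l ws])^[M] []

theorem wtSum_succ (R Q m : ℕ) : wtSum R Q (m + 1) = min Q (wtSum R Q m + wt R Q m) := by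
  simp only [wtSum, wt, Function.iterate_succ_apply']

theorem wtSum_le_mul_wt {R : ℕ} (hR : 0 < R) (Q m : ℕ) : wtSum R Q m ≤ R * wt R Q m :=
  (Nat.lt_mul_div_succ _ hR).le

theorem wtSum_bound (R Q m : ℕ) :
    (wtSum R Q m + R) * R ^ m ≤ R * (R + 1) ^ m := by
  induction m with
  | zero => simp [wtSum]
  | succ m ih =>
    have h1 : wtSum R Q (m + 1) ≤ wtSum R Q m + wt R Q m := by rw [wtSum_succ]; exact min_le_right _ _
    have h2 : wt R Q m * R ≤ wtSum R Q m + R := by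
      rw [wt, add_mul]
      have := Nat.div_mul_le_self (wtSum R Q m) R
      omega
    calc (wtSum R Q (m + 1) + R) * R ^ (m + 1)
        ≤ (wtSum R Q m + wt R Q m + R) * R ^ (m + 1) := by gcongr
      _ = (wtSum R Q m + R) * R ^ m * R + wt R Q m * R * R ^ m := by ring
      _ ≤ (wtSum R Q m + R) * R ^ m * R + (wtSum R Q m + R) * R ^ m := by gcongr
      _ = (wtSum R Q m + R) * R ^ m * (R + 1) := by ring
      _ ≤ R * (R + 1) ^ m * (R + 1) := by gcongr
      _ = R * (R + 1) ^ (m + 1) := by ring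

theorem wt_bound {R : ℕ} (hR : 0 < R) (Q m : ℕ) : wt R Q m * R ^ m ≤ (R + 1) ^ m := by
  have h1 := wtSum_bound R Q m
  have h2 : wt R Q m * R ≤ wtSum R Q m + R := by
    rw [wt, add_mul]
    have := Nat.div_mul_le_self (wtSum R Q m) R
    omega
  refine Nat.le_of_mul_le_mul_left ?_ hR
  calc R * (wt R Q m * R ^ m) = wt R Q m * R * R ^ m := by ring
    _ ≤ (wtSum R Q m + R) * R ^ m := by gcongr
    _ ≤ _ := h1

/-- Below the bound `Q`, the function `wtSum` is the sum of the weights. -/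
theorem sum_wt {R Q l : ℕ} (hR : 0 < R) (hQ : R * (R + 1) ^ l ≤ Q * R ^ l) {m : ℕ} (hm : m ≤ l) :
    ∑ i ∈ Finset.range m, wt R Q i = wtSum R Q m := by
  have hQ' : R * (R + 1) ^ m ≤ Q * R ^ m := by
    refine Nat.le_of_mul_le_mul_right ?_ (pow_pos hR (l - m))
    have h1 : R ^ (l - m) ≤ (R + 1) ^ (l - m) := Nat.pow_le_pow_left (by omega) _
    calc R * (R + 1) ^ m * R ^ (l - m) ≤ R * (R + 1) ^ m * (R + 1) ^ (l - m) := by gcongr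
      _ = R * (R + 1) ^ l := by rw [mul_assoc, ← pow_add, Nat.add_sub_cancel' hm]
      _ ≤ _ := hQ
      _ = Q * R ^ m * R ^ (l - m) := by rw [mul_assoc, ← pow_add, Nat.add_sub_cancel' hm]
  induction m with
  | zero => rfl
  | succ m ih =>
    have hQ'' : R * (R + 1) ^ m ≤ Q * R ^ m := by
      refine le_of_mul_le_mul_right (a := R) ?_ hR
      calc R * (R + 1) ^ m * R ≤ R * (R + 1) ^ m * (R + 1) := by gcongr; omega
        _ = R * (R + 1) ^ (m + 1) := by ring
        _ ≤ _ := hQ'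
        _ = _ := by ring
    rw [Finset.sum_range_succ, ih (by omega) hQ'', wtSum_succ, min_eq_right]
    have h2 : wt R Q m * R ≤ wtSum R Q m + R := by
      rw [wt, add_mul]
      have := Nat.div_mul_le_self (wtSum R Q m) R
      omega
    refine le_of_mul_le_mul_right (a := R ^ (m + 1)) ?_ (by positivity)
    calc (wtSum R Q m + wt R Q m) * R ^ (m + 1)
        = wtSum R Q m * R ^ m * R + wt R Q m * R * R ^ m := by ring
      _ ≤ (wtSum R Q m + R) * R ^ m * R + (wtSum R Q m + R) * R ^ m := by gcongr; omega
      _ = (wtSum R Q m + R) * R ^ m * (R + 1) := by ring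
      _ ≤ R * (R + 1) ^ m * (R + 1) := Nat.mul_le_mul_right _ (wtSum_bound R Q m)
      _ = R * (R + 1) ^ (m + 1) := by ring
      _ ≤ _ := hQ'

theorem sum_mul_sum_lt (c : ℕ → ℕ) (l : ℕ) : ∀ (v : ℕ → ℕ) (A : ℕ),
    ∑ j ∈ Finset.range l, c (l - 1 - j) * (A + ∑ i ∈ Finset.range j, v i) =
      A * ∑ i ∈ Finset.range l, c i +
        ∑ i ∈ Finset.range l, (∑ m ∈ Finset.range (l - 1 - i), c m) * v i := by
  induction l with
  | zero => simp
  | succ l ih =>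
    intro v A
    rw [Finset.sum_range_succ', Finset.sum_range_succ' (fun i => _ * v i)]
    have h := ih (fun i => v (i + 1)) (A + v 0)
    have h1 : ∀ j, l + 1 - 1 - (j + 1) = l - 1 - j := fun j => by omega
    have h2 : ∀ j, A + ∑ i ∈ Finset.range (j + 1), v i =
        A + v 0 + ∑ i ∈ Finset.range j, v (i + 1) := fun j => by
      rw [Finset.sum_range_succ']; ring
    simp only [h1, h2, h]
    rw [Finset.sum_range_succ]
    simp
    ring

theorem length_updateValues (Q : ℕ) (b v : List ℕ) (a : ℕ) :
    (updateValues Q b v a).length = b.length := by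
  simp [updateValues]

theorem getD_updateValues (Q : ℕ) (b v : List ℕ) (a : ℕ) {j : ℕ} (hj : j < b.length) :
    (updateValues Q b v a).getD j 0 =
      if b.getD j 0 = a then min Q (v.getD j 0 + 2 * (1 + ∑ i ∈ Finset.range j, v.getD i 0))
      else v.getD j 0 := by
  simp [updateValues, hj]

theorem sum_updateValues_le (Q k : ℕ) (b v : List ℕ) {j : ℕ} (hj : j < b.length) :
    ∑ a ∈ Finset.range k, (updateValues Q b v a).getD j 0 ≤
      k * v.getD j 0 + 2 * (1 + ∑ i ∈ Finset.range j, v.getD i 0) := by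
  set X := 2 * (1 + ∑ i ∈ Finset.range j, v.getD i 0) with hX
  calc ∑ a ∈ Finset.range k, (updateValues Q b v a).getD j 0
      ≤ ∑ a ∈ Finset.range k, (v.getD j 0 + if b.getD j 0 = a then X else 0) := by
        refine Finset.sum_le_sum fun a _ => ?_
        rw [getD_updateValues Q b v a hj]
        split_ifs
        · exact min_le_right _ _
        · exact Nat.le_add_right _ _
    _ ≤ _ := by
        rw [Finset.sum_add_distrib, Finset.sum_const, Finset.card_range, smul_eq_mul,
          Finset.sum_ite_eq]
        split_ifs <;> omega

/-- On average over the appended letter, the potential grows at most by the factor `1 + 1 / R`. -/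
theorem sum_potential_le {R Q l : ℕ} (hR : 0 < R) (hQ : R * (R + 1) ^ l ≤ Q * R ^ l)
    (k : ℕ) (b v : List ℕ) (hb : b.length = l) :
    ∑ a ∈ Finset.range k, potential R Q l (updateValues Q b v a) ≤
      (k + 2 * R) * potential R Q l v := by
  have h1 := sum_mul_sum_lt (wt R Q) l (fun i => v.getD i 0) 1
  rw [sum_wt hR hQ le_rfl] at h1
  have h2 : ∑ i ∈ Finset.range l, (∑ m ∈ Finset.range (l - 1 - i), wt R Q m) * v.getD i 0 ≤
      R * ∑ i ∈ Finset.range l, wt R Q (l - 1 - i) * v.getD i 0 := by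
    rw [Finset.mul_sum]
    refine Finset.sum_le_sum fun i _ => ?_
    rw [sum_wt hR hQ (by omega), ← mul_assoc]
    exact Nat.mul_le_mul_right _ (wtSum_le_mul_wt hR Q _)
  have h3 := wtSum_le_mul_wt hR Q l
  calc ∑ a ∈ Finset.range k, potential R Q l (updateValues Q b v a)
      = k * wt R Q l + ∑ j ∈ Finset.range l, wt R Q (l - 1 - j) *
          ∑ a ∈ Finset.range k, (updateValues Q b v a).getD j 0 := by
        simp only [potential, Finset.sum_add_distrib, Finset.sum_const, Finset.card_range,
          smul_eq_mul, Finset.mul_sum]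
        rw [Finset.sum_comm]
    _ ≤ k * wt R Q l + ∑ j ∈ Finset.range l, wt R Q (l - 1 - j) *
          (k * v.getD j 0 + 2 * (1 + ∑ i ∈ Finset.range j, v.getD i 0)) := by
        gcongr with j hj
        exact sum_updateValues_le Q k b v (by rw [hb]; exact Finset.mem_range.1 hj)
    _ = k * potential R Q l v + 2 * (∑ j ∈ Finset.range l, wt R Q (l - 1 - j) *
          (1 + ∑ i ∈ Finset.range j, v.getD i 0)) := by
        simp only [potential, mul_add, Finset.mul_sum, Finset.sum_add_distrib]
        rw [add_assoc]
        congr 1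
        congr 1
        · exact Finset.sum_congr rfl fun i _ => by ring
        · congr 1
          · exact Finset.sum_congr rfl fun i _ => by ring
          · exact Finset.sum_congr rfl fun i _ => Finset.sum_congr rfl fun i _ => by ring
    _ ≤ k * potential R Q l v + 2 * (R * potential R Q l v) := by
        rw [h1, one_mul]
        gcongr
        rw [potential, mul_add]
        exact Nat.add_le_add h3 h2
    _ = _ := by ring

theorem values_append (Q : ℕ) (b u : List ℕ) (a : ℕ) :
    values Q b (u ++ [a]) = updateValues Q b (values Q b u) a := by
  simp [values]

theorem values_le (Q : ℕ) (b u : List ℕ) (j : ℕ) (hj : j < b.length) :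
    (values Q b u).getD j 0 ≤ Q := by
  induction u using List.reverseRecOn with
  | nil => simp [values]
  | append_singleton u a ih =>
    rw [values_append, getD_updateValues Q b _ a hj]
    split_ifs
    · exact min_le_left _ _
    · exact ih

theorem exists_of_append_singleton_sublist_take {b z : List ℕ} {a m : ℕ}
    (h : (z ++ [a]).Sublist (b.take m)) :
    ∃ j < m, j < b.length ∧ b.getD j 0 = a ∧ z.Sublist (b.take j) := by
  obtain ⟨y₁, y₂, hy, h3, h4⟩ := List.append_sublist_iff.1 h
  obtain ⟨i, hi, hia⟩ := List.mem_iff_getElem.1 (List.singleton_sublist.1 h4)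
  have hlen : y₁.length + i < m ∧ y₁.length + i < b.length := by
    have := congrArg List.length hy
    simp only [List.length_take, List.length_append] at this
    omega
  refine ⟨y₁.length + i, hlen.1, hlen.2, ?_, h3.trans (List.IsPrefix.sublist ?_)⟩
  · have h5 : (b.take m)[y₁.length + i]? = some a := by
      rw [hy, List.getElem?_append_right (by omega)]
      simp [hi, hia]
    rw [List.getElem?_take_of_lt hlen.1] at h5
    simp [h5]
  · have h6 : y₁ <+: b := (List.prefix_append y₁ y₂).trans (hy ▸ List.take_prefix m b)
    exact List.prefix_of_prefix_length_le h6 (List.take_prefix _ _) (by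
      rw [List.length_take]; omega)

/-- A common subsequence of length `t` makes one of the values at least `2 ^ t`. -/
theorem exists_values_ge (Q : ℕ) (b u : List ℕ) : ∀ (z : List ℕ) (m : ℕ), z ≠ [] → m ≤ b.length →
    z.Sublist u → z.Sublist (b.take m) → ∃ j < m, min Q (2 ^ z.length) ≤ (values Q b u).getD j 0 := by
  induction u using List.reverseRecOn with
  | nil => exact fun z m hz _ h => absurd (List.sublist_nil.1 h) hz
  | append_singleton u a ih =>
    intro z m hz hm hu hb
    rw [values_append]
    obtain ⟨z₁, z₂, rfl, h1, h2⟩ := List.sublist_append_iff.1 hu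
    rcases List.sublist_singleton.1 h2 with rfl | rfl
    · rw [List.append_nil] at hz hb ⊢
      obtain ⟨j, hj, hv⟩ := ih z₁ m hz hm h1 hb
      refine ⟨j, hj, hv.trans ?_⟩
      rw [getD_updateValues Q b _ a (by omega)]
      split_ifs
      · exact le_min (values_le Q b u j (by omega)) (Nat.le_add_right _ _)
      · exact le_rfl
    · obtain ⟨j, hj, -, hja, hsub⟩ := exists_of_append_singleton_sublist_take hb
      refine ⟨j, hj, ?_⟩
      rw [getD_updateValues Q b _ a (by omega), if_pos hja, List.length_append,
        List.length_singleton, pow_succ]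
      refine le_min (min_le_left _ _) ?_
      by_cases hz1 : z₁ = []
      · subst hz1
        simp
        omega
      · obtain ⟨i, hi, hv⟩ := ih z₁ _ hz1 (by omega) h1 hsub
        have h7 : (values Q b u).getD i 0 ≤ ∑ i ∈ Finset.range j, (values Q b u).getD i 0 :=
          Finset.single_le_sum (f := fun i => (values Q b u).getD i 0)
            (fun _ _ => Nat.zero_le _) (Finset.mem_range.2 hi)
        omega

/-- Some letter is not worse than the average. -/
theorem score_append_le {k R Q l : ℕ} (hR : 0 < R) (hk : k = 2 * R ^ 2)
    (hQ : R * (R + 1) ^ l ≤ Q * R ^ l) (ws : List (List ℕ)) (hws : ∀ b ∈ ws, b.length = l)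
    (u : List ℕ) :
    ∃ a < k, R * score R Q l ws (u ++ [a]) ≤ (R + 1) * score R Q l ws u := by
  by_contra! h
  have h1 : ∑ a ∈ Finset.range k, score R Q l ws (u ++ [a]) ≤ (k + 2 * R) * score R Q l ws u := by
    simp only [score, Finset.mul_sum]
    rw [Finset.sum_comm]
    refine Finset.sum_le_sum fun i hi => ?_
    simp only [values_append]
    refine sum_potential_le hR hQ k _ _ (hws _ ?_)
    rw [List.getD_eq_getElem _ _ (Finset.mem_range.1 hi)]
    exact List.getElem_mem _
  have h2 : ∑ a ∈ Finset.range k, (R + 1) * score R Q l ws u <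
      ∑ a ∈ Finset.range k, R * score R Q l ws (u ++ [a]) :=
    Finset.sum_lt_sum_of_nonempty ⟨0, Finset.mem_range.2 (by rw [hk]; positivity)⟩
      fun a ha => h a (Finset.mem_range.1 ha)
  rw [Finset.sum_const, Finset.card_range, smul_eq_mul, ← Finset.mul_sum] at h2
  have h3 : k * ((R + 1) * score R Q l ws u) = R * ((k + 2 * R) * score R Q l ws u) := by
    rw [hk]; ring
  exact absurd (h3 ▸ h2) (not_lt.2 (Nat.mul_le_mul_left R h1))

theorem exists_greedyStep {k R Q l : ℕ} (hR : 0 < R) (hk : k = 2 * R ^ 2)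
    (hQ : R * (R + 1) ^ l ≤ Q * R ^ l) (ws : List (List ℕ)) (hws : ∀ b ∈ ws, b.length = l)
    (u : List ℕ) : ∃ a < k, greedyStep k R Q l ws u = u ++ [a] ∧
      R * score R Q l ws (u ++ [a]) ≤ (R + 1) * score R Q l ws u := by
  obtain ⟨a, ha, h⟩ := score_append_le hR hk hQ ws hws u
  obtain ⟨h1, h2⟩ := headD_filter_spec (l := List.range k) (q := fun a =>
    decide (R * score R Q l ws (u ++ [a]) ≤ (R + 1) * score R Q l ws u)) 0
    ⟨a, List.mem_range.2 ha, by simpa using h⟩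
  exact ⟨_, List.mem_range.1 h1, rfl, by simpa using h2⟩

/-- The score of the greedy word is small. -/
theorem greedyWord_spec {k R Q l : ℕ} (hR : 0 < R) (hk : k = 2 * R ^ 2)
    (hQ : R * (R + 1) ^ l ≤ Q * R ^ l) (ws : List (List ℕ)) (hws : ∀ b ∈ ws, b.length = l) :
    (greedyWord k R Q l ws).length = l ∧ (∀ a ∈ greedyWord k R Q l ws, a < k) ∧
      R ^ (2 * l) * score R Q l ws (greedyWord k R Q l ws) ≤ (R + 1) ^ (2 * l) * ws.length := by
  have key : ∀ m, ((greedyStep k R Q l ws)^[m] []).length = m ∧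
      (∀ a ∈ (greedyStep k R Q l ws)^[m] [], a < k) ∧
      R ^ m * score R Q l ws ((greedyStep k R Q l ws)^[m] []) ≤
        (R + 1) ^ m * (ws.length * wt R Q l) := by
    intro m
    induction m with
    | zero => simp [score, potential, values]
    | succ m ih =>
      obtain ⟨h1, h2, h3⟩ := ih
      obtain ⟨a, ha, h4, h5⟩ := exists_greedyStep hR hk hQ ws hws ((greedyStep k R Q l ws)^[m] [])
      rw [Function.iterate_succ_apply', h4]
      refine ⟨by simp [h1], fun x hx => ?_, ?_⟩
      · rcases List.mem_append.1 hx with hx | hx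
        · exact h2 x hx
        · simp at hx; omega
      · calc _ = R ^ m * (R * score R Q l ws ((greedyStep k R Q l ws)^[m] [] ++ [a])) := by ring
          _ ≤ R ^ m * ((R + 1) * score R Q l ws ((greedyStep k R Q l ws)^[m] [])) := by gcongr
          _ = (R + 1) * (R ^ m * score R Q l ws ((greedyStep k R Q l ws)^[m] [])) := by ring
          _ ≤ (R + 1) * ((R + 1) ^ m * (ws.length * wt R Q l)) := by gcongr
          _ = _ := by ring
  obtain ⟨h1, h2, h3⟩ := key l
  refine ⟨h1, h2, ?_⟩
  calc _ = R ^ l * (R ^ l * score R Q l ws (greedyWord k R Q l ws)) := by ring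
    _ ≤ R ^ l * ((R + 1) ^ l * (ws.length * wt R Q l)) := Nat.mul_le_mul_left _ h3
    _ = (R + 1) ^ l * ws.length * (wt R Q l * R ^ l) := by ring
    _ ≤ (R + 1) ^ l * ws.length * (R + 1) ^ l := by gcongr; exact wt_bound hR Q l
    _ = _ := by ring

/-- A word of small score has no long common subsequence with any of the other words. -/
theorem length_le_of_score {R Q l σ : ℕ} {ws : List (List ℕ)} (hws : ∀ b ∈ ws, b.length = l)
    (hQ : 2 ^ (σ + 1) ≤ Q) {u b z : List ℕ} (hu : score R Q l ws u < 2 ^ (σ + 1)) (hb : b ∈ ws)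
    (hzu : z.Sublist u) (hzb : z.Sublist b) : z.length ≤ σ := by
  by_contra! h
  obtain ⟨j, hj, hv⟩ := exists_values_ge Q b u z b.length (by rintro rfl; simp at h) le_rfl hzu
    (by simpa using hzb)
  obtain ⟨i, hi, rfl⟩ := List.mem_iff_getElem.1 hb
  have h1 : (2 : ℕ) ^ (σ + 1) ≤ 2 ^ z.length := Nat.pow_le_pow_right (by norm_num) h
  have h2 : potential R Q l (values Q ws[i] u) ≤ score R Q l ws u := by
    rw [score, ← List.getD_eq_getElem ws [] hi]
    exact Finset.single_le_sum (f := fun i => potential R Q l (values Q (ws.getD i []) u))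
      (fun _ _ => Nat.zero_le _) (Finset.mem_range.2 hi)
  have h3 : (values Q ws[i] u).getD j 0 ≤ potential R Q l (values Q ws[i] u) := by
    refine le_trans ?_ (Nat.le_add_left _ _)
    refine le_trans ?_ (Finset.single_le_sum
      (f := fun j => wt R Q (l - 1 - j) * (values Q ws[i] u).getD j 0)
      (fun _ _ => Nat.zero_le _) (Finset.mem_range.2 (hws _ hb ▸ hj)))
    exact Nat.le_mul_of_pos_left _ (Nat.succ_pos _)
  have h4 : 2 ^ (σ + 1) ≤ min Q (2 ^ z.length) := le_min hQ h1
  omega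

/-- The words of the greedy code have pairwise no common subsequence that is longer than `σ`, if
`2 ^ σ` is large enough compared with the number of words and their length. -/
theorem greedyCode_spec {k R Q l σ M : ℕ} (hR : 0 < R) (hk : k = 2 * R ^ 2)
    (hQ : R * (R + 1) ^ l ≤ Q * R ^ l) (hQ' : 2 ^ (σ + 1) ≤ Q)
    (hM : M * (R + 1) ^ (2 * l) < 2 ^ (σ + 1) * R ^ (2 * l)) :
    (greedyCode k R Q l M).length = M ∧
    (∀ w ∈ greedyCode k R Q l M, w.length = l ∧ ∀ a ∈ w, a < k) ∧
    (greedyCode k R Q l M).Pairwise fun w w' => ∀ z : List ℕ, z.Sublist w → z.Sublist w' →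
      z.length ≤ σ := by
  induction M with
  | zero => simp [greedyCode]
  | succ M ih =>
    obtain ⟨h1, h2, h3⟩ := ih (lt_of_le_of_lt (by gcongr; omega) hM)
    rw [greedyCode, Function.iterate_succ_apply', ← greedyCode]
    set ws := greedyCode k R Q l M
    obtain ⟨h4, h5, h6⟩ := greedyWord_spec hR hk hQ ws fun b hb => (h2 b hb).1
    refine ⟨by simp [h1], fun w hw => ?_, List.pairwise_append.2 ⟨h3, by simp, ?_⟩⟩
    · rcases List.mem_append.1 hw with hw | hw
      · exact h2 w hw
      · rw [List.mem_singleton.1 hw]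
        exact ⟨h4, h5⟩
    · intro b hb w hw z hzb hzw
      rw [List.mem_singleton.1 hw] at hzw
      refine length_le_of_score (R := R) (fun b hb => (h2 b hb).1) hQ' ?_ hb hzw hzb
      refine lt_of_mul_lt_mul_left (a := R ^ (2 * l)) ?_ (Nat.zero_le _)
      rw [h1] at h6
      calc _ ≤ _ := h6
        _ ≤ (M + 1) * (R + 1) ^ (2 * l) := by rw [mul_comm]; gcongr; omega
        _ < _ := hM
        _ = _ := mul_comm _ _

section PolyTime

variable {γ : Type} [Enc γ]

@[fun_prop]
theorem PolyTime.wtSum {R Q m : γ → ℕ} (hR : PolyTime R) (hQ : PolyTime Q) (hm : PolyTime m) :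
    PolyTime (fun x => wtSum (R x) (Q x) (m x)) := by
  unfold IndelCode.wtSum
  exact .iterate (fun c s => s ≤ Q c) (B := fun c => sz (Q c)) (by fun_prop) hm (.const 0)
    hQ.polyBd_sz (fun _ => Nat.zero_le _) (fun _ _ _ => min_le_left _ _)
    fun c s hs => by rw [sz_nat, sz_nat]; omega

@[fun_prop]
theorem PolyTime.wt {R Q m : γ → ℕ} (hR : PolyTime R) (hQ : PolyTime Q) (hm : PolyTime m) :
    PolyTime (fun x => wt (R x) (Q x) (m x)) := by
  unfold IndelCode.wt
  fun_prop

@[fun_prop]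
theorem PolyTime.updateValues {Q a : γ → ℕ} {b v : γ → List ℕ} (hQ : PolyTime Q) (hb : PolyTime b)
    (hv : PolyTime v) (ha : PolyTime a) :
    PolyTime (fun x => updateValues (Q x) (b x) (v x) (a x)) := by
  unfold IndelCode.updateValues
  fun_prop

theorem sz_list_nat_le {l : List ℕ} {m n : ℕ} (h : l.length ≤ m) (h' : ∀ a ∈ l, a ≤ n) :
    sz l ≤ m * (2 * n + 1 + 1) + 1 :=
  (sz_le_of_forall (B := 2 * n + 1) fun a ha => by have := h' a ha; rw [sz_nat]; omega).trans
    (by gcongr)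

@[fun_prop]
theorem PolyTime.values {Q : γ → ℕ} {b u : γ → List ℕ} (hQ : PolyTime Q) (hb : PolyTime b)
    (hu : PolyTime u) : PolyTime (fun x => values (Q x) (b x) (u x)) := by
  unfold IndelCode.values
  refine .foldl_inv (fun c v => v.length ≤ (b c).length ∧ ∀ j, v.getD j 0 ≤ Q c)
    (B := fun c => (b c).length * (2 * Q c + 1 + 1) + 1) (by fun_prop) hu (.const [])
    (PolyTime.polyBd (by fun_prop)) (by simp) ?_ fun c v hv => sz_list_nat_le hv.1 ?_
  · rintro c v a - ⟨h1, h2⟩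
    refine ⟨(length_updateValues _ _ _ _).le, fun j => ?_⟩
    by_cases hj : j < (b c).length
    · rw [getD_updateValues _ _ _ _ hj]
      split_ifs
      · exact min_le_left _ _
      · exact h2 j
    · rw [List.getD_eq_default _ _ (by rw [length_updateValues]; omega)]
      exact Nat.zero_le _
  · intro a ha
    obtain ⟨j, hj, rfl⟩ := List.mem_iff_getElem.1 ha
    rw [← List.getD_eq_getElem v 0 hj]
    exact hv.2 j

@[fun_prop]
theorem PolyTime.score {R Q l : γ → ℕ} {ws : γ → List (List ℕ)} {u : γ → List ℕ}
    (hR : PolyTime R) (hQ : PolyTime Q) (hl : PolyTime l) (hws : PolyTime ws) (hu : PolyTime u) :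
    PolyTime (fun x => score (R x) (Q x) (l x) (ws x) (u x)) := by
  unfold IndelCode.score IndelCode.potential
  fun_prop

theorem greedyStep_eq (k R Q l : ℕ) (ws : List (List ℕ)) (u : List ℕ) :
    ∃ a ≤ k, greedyStep k R Q l ws u = u ++ [a] := by
  refine ⟨_, ?_, rfl⟩
  rcases headD_filter_mem_or (List.range k) (fun a =>
    decide (R * IndelCode.score R Q l ws (u ++ [a]) ≤ (R + 1) * IndelCode.score R Q l ws u)) 0
    with h | h
  · exact (List.mem_range.1 h).le
  · rw [h]; exact Nat.zero_le _

@[fun_prop]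
theorem PolyTime.greedyStep {k R Q l : γ → ℕ} {ws : γ → List (List ℕ)} {u : γ → List ℕ}
    (hk : PolyTime k) (hR : PolyTime R) (hQ : PolyTime Q) (hl : PolyTime l) (hws : PolyTime ws)
    (hu : PolyTime u) : PolyTime (fun x => greedyStep (k x) (R x) (Q x) (l x) (ws x) (u x)) := by
  unfold IndelCode.greedyStep
  fun_prop

theorem greedyWord_bound (k R Q l : ℕ) (ws : List (List ℕ)) (m : ℕ) :
    ((IndelCode.greedyStep k R Q l ws)^[m] []).length = m ∧
      ∀ a ∈ (IndelCode.greedyStep k R Q l ws)^[m] [], a ≤ k := by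
  induction m with
  | zero => simp
  | succ m ih =>
    obtain ⟨a, ha, h⟩ := greedyStep_eq k R Q l ws ((IndelCode.greedyStep k R Q l ws)^[m] [])
    rw [Function.iterate_succ_apply', h]
    refine ⟨by simp [ih.1], fun x hx => ?_⟩
    rcases List.mem_append.1 hx with hx | hx
    · exact ih.2 x hx
    · rw [List.mem_singleton.1 hx]; exact ha

@[fun_prop]
theorem PolyTime.greedyWord {k R Q l : γ → ℕ} {ws : γ → List (List ℕ)}
    (hk : PolyTime k) (hR : PolyTime R) (hQ : PolyTime Q) (hl : PolyTime l) (hws : PolyTime ws) :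
    PolyTime (fun x => greedyWord (k x) (R x) (Q x) (l x) (ws x)) := by
  unfold IndelCode.greedyWord
  refine .iterate_add (D := fun x => 2 * k x + 1 + 1 + 1) (by fun_prop) hl (.const [])
    (PolyTime.polyBd (by fun_prop)) fun c u => ?_
  obtain ⟨a, ha, h⟩ := greedyStep_eq (k c) (R c) (Q c) (l c) (ws c) u
  have h1 := sz_list_append u [a]
  simp only [sz_list_cons, sz_list_nil, sz_nat] at h1
  rw [h]
  omega

@[fun_prop]
theorem PolyTime.greedyCode {k R Q l M : γ → ℕ} (hk : PolyTime k) (hR : PolyTime R)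
    (hQ : PolyTime Q) (hl : PolyTime l) (hM : PolyTime M) :
    PolyTime (fun x => greedyCode (k x) (R x) (Q x) (l x) (M x)) := by
  unfold IndelCode.greedyCode
  refine .iterate_add (D := fun x => l x * (2 * k x + 1 + 1) + 1 + 1) (by fun_prop) hM (.const [])
    (PolyTime.polyBd (by fun_prop)) fun c ws => ?_
  have h1 := sz_list_append ws [IndelCode.greedyWord (k c) (R c) (Q c) (l c) ws]
  obtain ⟨h2, h3⟩ := greedyWord_bound (k c) (R c) (Q c) (l c) ws (l c)
  have h4 := sz_list_nat_le h2.le h3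
  rw [← IndelCode.greedyWord] at h4
  simp only [sz_list_cons, sz_list_nil] at h1
  omega

end PolyTime

end Greedy

/-! ### Longest common subsequences -/

section Lcs

/-- How the row of the dynamic program changes when the letter `a` is appended to the other word.
The entry at a position of `b` is the length of a longest common subsequence that ends there. -/
def lcsStep (b v : List ℕ) (a : ℕ) : List ℕ :=
  (List.range b.length).map fun j =>
    if b.getD j 0 = a then max (v.getD j 0) (1 + (Finset.range j).sup fun i => v.getD i 0)
    else v.getD j 0

/-- The row of the dynamic program for the words `u` and `b`. -/
def lcsRow (b u : List ℕ) : List ℕ := u.foldl (lcsStep b) []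

/-- The length of a longest common subsequence of `u` and `b`. -/
def lcs (u b : List ℕ) : ℕ := (Finset.range b.length).sup fun j => (lcsRow b u).getD j 0

theorem lcsRow_append (b u : List ℕ) (a : ℕ) : lcsRow b (u ++ [a]) = lcsStep b (lcsRow b u) a := by
  simp [lcsRow]

theorem getD_lcsStep (b v : List ℕ) (a : ℕ) {j : ℕ} (hj : j < b.length) :
    (lcsStep b v a).getD j 0 =
      if b.getD j 0 = a then max (v.getD j 0) (1 + (Finset.range j).sup fun i => v.getD i 0)
      else v.getD j 0 := by
  simp [lcsStep, hj]

theorem length_le_lcsRow (b u : List ℕ) : ∀ (z : List ℕ) (m : ℕ), m ≤ b.length →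
    z.Sublist u → z.Sublist (b.take m) →
    z.length ≤ (Finset.range m).sup fun j => (lcsRow b u).getD j 0 := by
  induction u using List.reverseRecOn with
  | nil => intro z m _ h; simp [List.sublist_nil.1 h]
  | append_singleton u a ih =>
    intro z m hm hu hb
    obtain ⟨z₁, z₂, rfl, h1, h2⟩ := List.sublist_append_iff.1 hu
    rw [lcsRow_append]
    rcases List.sublist_singleton.1 h2 with rfl | rfl
    · rw [List.append_nil] at hb ⊢
      refine (ih z₁ m hm h1 hb).trans (Finset.sup_mono_fun fun j hj => ?_)
      rw [getD_lcsStep _ _ _ (by have := Finset.mem_range.1 hj; omega)]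
      split_ifs
      · exact le_max_left _ _
      · exact le_rfl
    · obtain ⟨j, hj, hj', hja, hsub⟩ := exists_of_append_singleton_sublist_take hb
      refine le_trans ?_ (Finset.le_sup (f := fun j => (lcsStep b (lcsRow b u) a).getD j 0)
        (Finset.mem_range.2 hj))
      rw [getD_lcsStep _ _ _ hj', if_pos hja, List.length_append, List.length_singleton, add_comm]
      exact le_max_of_le_right (Nat.add_le_add_left (ih z₁ j hj'.le h1 hsub) 1)

theorem length_le_lcs {z u b : List ℕ} (hu : z.Sublist u) (hb : z.Sublist b) :
    z.length ≤ lcs u b :=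
  length_le_lcsRow b u z b.length le_rfl hu (by simpa using hb)

theorem exists_sublist_lcsRow (b u : List ℕ) : ∀ j < b.length,
    ∃ z : List ℕ, z.Sublist u ∧ z.Sublist (b.take (j + 1)) ∧ z.length = (lcsRow b u).getD j 0 := by
  induction u using List.reverseRecOn with
  | nil => exact fun j _ => ⟨[], by simp [lcsRow]⟩
  | append_singleton u a ih =>
    intro j hj
    rw [lcsRow_append, getD_lcsStep _ _ _ hj]
    have hold : ∃ z : List ℕ, z.Sublist (u ++ [a]) ∧ z.Sublist (b.take (j + 1)) ∧
        z.length = (lcsRow b u).getD j 0 := by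
      obtain ⟨z, h1, h2, h3⟩ := ih j hj
      exact ⟨z, h1.trans (List.sublist_append_left _ _), h2, h3⟩
    split_ifs with hja
    · rcases max_choice ((lcsRow b u).getD j 0)
        (1 + (Finset.range j).sup fun i => (lcsRow b u).getD i 0) with h | h
      · rw [h]; exact hold
      · rw [h]
        have htake : b.take (j + 1) = b.take j ++ [a] := by
          rw [List.take_succ_eq_append_getElem hj, ← hja, List.getD_eq_getElem _ _ hj]
        rw [htake]
        rcases Nat.eq_zero_or_pos j with rfl | hj0
        · exact ⟨[a], by simp, by simp, by simp⟩
        · obtain ⟨i, hi, hs⟩ := Finset.exists_mem_eq_sup (Finset.range j)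
            ⟨0, Finset.mem_range.2 hj0⟩ fun i => (lcsRow b u).getD i 0
          have hij := Finset.mem_range.1 hi
          obtain ⟨z, h1, h2, h3⟩ := ih i (by omega)
          refine ⟨z ++ [a], h1.append (List.Sublist.refl _), List.Sublist.append
            (h2.trans (List.IsPrefix.sublist (List.take_prefix_take_left (by omega))))
            (List.Sublist.refl _), ?_⟩
          rw [hs, List.length_append, h3, List.length_singleton, add_comm]
    · exact hold

theorem exists_sublist_lcs (u b : List ℕ) :
    ∃ z : List ℕ, z.Sublist u ∧ z.Sublist b ∧ z.length = lcs u b := by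
  rcases Nat.eq_zero_or_pos b.length with h | h
  · exact ⟨[], by simp, by simp, by simp [lcs, h]⟩
  · obtain ⟨j, hj, hs⟩ := Finset.exists_mem_eq_sup (Finset.range b.length)
      ⟨0, Finset.mem_range.2 h⟩ fun j => (lcsRow b u).getD j 0
    obtain ⟨z, h1, h2, h3⟩ := exists_sublist_lcsRow b u j (Finset.mem_range.1 hj)
    exact ⟨z, h1, h2.trans (List.take_sublist _ _), by rw [h3, lcs, hs]⟩

theorem lcs_le_length (u b : List ℕ) : lcs u b ≤ b.length := by
  obtain ⟨z, -, h1, h2⟩ := exists_sublist_lcs u b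
  exact h2 ▸ h1.length_le

theorem lcs_mono {u u' : List ℕ} (h : u.Sublist u') (b : List ℕ) : lcs u b ≤ lcs u' b := by
  obtain ⟨z, h1, h2, h3⟩ := exists_sublist_lcs u b
  exact h3 ▸ length_le_lcs (h1.trans h) h2

/-- The length of a longest common subsequence of `b` and one of the words in `us`. -/
def chunkLcs (us : List (List ℕ)) (b : List ℕ) : ℕ :=
  (Finset.range us.length).sup fun t => lcs (us.getD t []) b

/-- The word `s` cut into pieces of length `L`, the last of which may be shorter. -/
def chunks (L : ℕ) (s : List ℕ) : List (List ℕ) :=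
  (List.range (s.length / L + 1)).map fun t => (s.drop (t * L)).take L

section PolyTime

variable {γ : Type} [Enc γ]

@[fun_prop]
theorem PolyTime.lcsRow {b u : γ → List ℕ} (hb : PolyTime b) (hu : PolyTime u) :
    PolyTime (fun x => lcsRow (b x) (u x)) := by
  unfold IndelCode.lcsRow
  refine .foldl_inv (fun c v => v.length ≤ (b c).length ∧ ∀ j < (b c).length, v.getD j 0 ≤ j + 1)
    (B := fun c => (b c).length * (2 * ((b c).length + 1) + 1 + 1) + 1)
    (by unfold lcsStep; fun_prop) hu (.const [])
    (PolyTime.polyBd (by fun_prop)) (by simp) ?_ fun c v hv => sz_list_nat_le hv.1 ?_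
  · rintro c v a - ⟨h1, h2⟩
    refine ⟨by simp [lcsStep], fun j hj => ?_⟩
    rw [getD_lcsStep _ _ _ hj]
    split_ifs
    · refine max_le (h2 j hj) ?_
      rw [add_comm]
      refine Nat.add_le_add_right (Finset.sup_le fun i hi => ?_) 1
      have hij := Finset.mem_range.1 hi
      have := h2 i (by omega)
      omega
    · exact h2 j hj
  · intro a ha
    obtain ⟨j, hj, rfl⟩ := List.mem_iff_getElem.1 ha
    rw [← List.getD_eq_getElem v 0 hj]
    have := hv.2 j (by omega)
    omega

@[fun_prop]
theorem PolyTime.lcs {u b : γ → List ℕ} (hu : PolyTime u) (hb : PolyTime b) :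
    PolyTime (fun x => lcs (u x) (b x)) := by
  unfold IndelCode.lcs
  fun_prop

@[fun_prop]
theorem PolyTime.chunkLcs {us : γ → List (List ℕ)} {b : γ → List ℕ} (hu : PolyTime us)
    (hb : PolyTime b) : PolyTime (fun x => chunkLcs (us x) (b x)) := by
  unfold IndelCode.chunkLcs
  fun_prop

@[fun_prop]
theorem PolyTime.chunks {L : γ → ℕ} {s : γ → List ℕ} (hL : PolyTime L) (hs : PolyTime s) :
    PolyTime (fun x => chunks (L x) (s x)) := by
  unfold IndelCode.chunks
  fun_prop

end PolyTime

theorem lcs_le_chunkLcs {us : List (List ℕ)} {u : List ℕ} (hu : u ∈ us) (b : List ℕ) :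
    lcs u b ≤ chunkLcs us b := by
  obtain ⟨t, ht, rfl⟩ := List.mem_iff_getElem.1 hu
  rw [← List.getD_eq_getElem us [] ht]
  exact Finset.le_sup (f := fun t => lcs (us.getD t []) b) (Finset.mem_range.2 ht)

theorem chunkLcs_le_iff {us : List (List ℕ)} {b : List ℕ} {m : ℕ} :
    chunkLcs us b ≤ m ↔ ∀ u ∈ us, lcs u b ≤ m := by
  refine ⟨fun h u hu => (lcs_le_chunkLcs hu b).trans h, fun h => Finset.sup_le fun t ht => ?_⟩
  rw [List.getD_eq_getElem us [] (Finset.mem_range.1 ht)]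
  exact h _ (List.getElem_mem _)

theorem chunkLcs_le_length (us : List (List ℕ)) (b : List ℕ) : chunkLcs us b ≤ b.length :=
  chunkLcs_le_iff.2 fun u _ => lcs_le_length u b

theorem length_chunks (L : ℕ) (s : List ℕ) : (chunks L s).length = s.length / L + 1 := by
  simp [chunks]

theorem length_le_of_mem_chunks {L : ℕ} {s u : List ℕ} (hu : u ∈ chunks L s) : u.length ≤ L := by
  obtain ⟨t, -, rfl⟩ := List.mem_map.1 hu
  exact List.length_take_le _ _

theorem flatten_chunks {L : ℕ} (hL : 0 < L) (s : List ℕ) : (chunks L s).flatten = s := by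
  have key : ∀ T, ((List.range T).map fun t => (s.drop (t * L)).take L).flatten =
      s.take (T * L) := by
    intro T
    induction T with
    | zero => simp
    | succ T ih =>
      rw [List.range_succ, List.map_append, List.flatten_append, ih, add_mul, one_mul,
        List.take_add]
      simp
  rw [chunks, key, List.take_of_length_le]
  have := Nat.lt_mul_div_succ s.length hL
  rw [mul_comm]
  exact this.le

/-- A common subsequence of a concatenation of words of length at most `l` and of `s` decomposes
into common subsequences of single words and single chunks of `s`, up to the words that are matched
across one of the boundaries between the chunks. -/
theorem length_le_sum_chunkLcs {l : ℕ} (ws : List (List ℕ)) : ∀ (us : List (List ℕ)) (z : List ℕ),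
    (∀ w ∈ ws, w.length ≤ l) → z.Sublist ws.flatten → z.Sublist us.flatten →
    z.length ≤ (ws.map (chunkLcs us)).sum + us.length * l := by
  induction ws with
  | nil => intro us z _ h; simp [List.sublist_nil.1 h]
  | cons w ws ih =>
    intro us z hws hz hzu
    rcases us with _ | ⟨u, us⟩
    · simp [List.sublist_nil.1 hzu]
    rw [List.flatten_cons] at hz
    obtain ⟨z₁, z₂, rfl, h1, h2⟩ := List.sublist_append_iff.1 hz
    obtain ⟨s₁, s₂, hs, h3, h4⟩ := List.append_sublist_iff.1 hzu
    rw [List.flatten_cons] at hs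
    rw [List.length_append, List.map_cons, List.sum_cons]
    rcases List.append_eq_append_iff.1 hs with ⟨c, hc, hc'⟩ | ⟨c, hc, hc'⟩
    · have h5 := ih us z₂ (fun w hw => hws w (by simp [hw])) h2
        (h4.trans (hc' ▸ List.sublist_append_right c s₂))
      have h6 : (ws.map (chunkLcs us)).sum ≤ (ws.map (chunkLcs (u :: us))).sum :=
        List.sum_le_sum fun w _ => chunkLcs_le_iff.2 fun v hv => lcs_le_chunkLcs (by simp [hv]) w
      have h7 := h1.length_le.trans (hws w (by simp))
      rw [List.length_cons, add_mul, one_mul]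
      omega
    · have h5 := ih (c :: us) z₂ (fun w hw => hws w (by simp [hw])) h2
        (by rw [List.flatten_cons]; exact hc' ▸ h4)
      have h6 : (ws.map (chunkLcs (c :: us))).sum ≤ (ws.map (chunkLcs (u :: us))).sum := by
        refine List.sum_le_sum fun w _ => chunkLcs_le_iff.2 fun v hv => ?_
        rcases List.mem_cons.1 hv with rfl | hv
        · exact (lcs_mono (hc ▸ List.sublist_append_right _ _) w).trans
            (lcs_le_chunkLcs (by simp) w)
        · exact lcs_le_chunkLcs (by simp [hv]) w
      have h7 : z₁.length ≤ chunkLcs (u :: us) w :=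
        (length_le_lcs (h3.trans (hc ▸ List.sublist_append_left _ _)) h1).trans
          (lcs_le_chunkLcs (by simp) w)
      rw [List.length_cons] at h5 ⊢
      omega

/-- Bonferroni's inequality for subsequences of a word: their total length exceeds the length of
the word by at most the total length of pairwise common subsequences. -/
theorem sum_length_le_add {ι : Type} [DecidableEq ι] (F : Finset ι) (u : List ℕ) :
    ∀ z : ι → List ℕ, (∀ i ∈ F, (z i).Sublist u) → ∃ x : ι → ι → List ℕ,
      (∀ i ∈ F, ∀ j ∈ F, (x i j).Sublist (z i) ∧ (x i j).Sublist (z j)) ∧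
      ∑ i ∈ F, (z i).length ≤ u.length + ∑ i ∈ F, ∑ j ∈ F.erase i, (x i j).length := by
  classical
  induction u with
  | nil =>
    intro z hz
    refine ⟨fun _ _ => [], by simp, ?_⟩
    rw [Finset.sum_eq_zero fun i hi => by simp [List.sublist_nil.1 (hz i hi)]]
    exact Nat.zero_le _
  | cons a u ih =>
    intro z hz
    set S := F.filter fun i => ¬ (z i).Sublist u with hS
    have hcase : ∀ i ∈ S, ∃ y, z i = a :: y ∧ y.Sublist u := by
      intro i hi
      obtain ⟨hi, hi'⟩ := Finset.mem_filter.1 hi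
      rcases List.sublist_cons_iff.1 (hz i hi) with h | h
      · exact absurd h hi'
      · exact h
    obtain ⟨x, hx, hsum⟩ := ih (fun i => if i ∈ S then (z i).tail else z i) fun i hi => by
      split_ifs with h
      · obtain ⟨y, h1, h2⟩ := hcase i h
        simpa [h1] using h2
      · simp only [hS, Finset.mem_filter, hi, true_and, not_not] at h
        exact h
    refine ⟨fun i j => if i ∈ S ∧ j ∈ S then a :: x i j else x i j, ?_, ?_⟩
    · intro i hi j hj
      obtain ⟨h1, h2⟩ := hx i hi j hj
      dsimp only at h1 h2 ⊢
      have htail : ∀ {i j : ι}, (x i j).Sublist (if i ∈ S then (z i).tail else z i) →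
          (x i j).Sublist (z i) := fun {i j} h => by
        split_ifs at h
        · exact h.trans (List.tail_sublist _)
        · exact h
      split_ifs with h
      · obtain ⟨y, h3, h4⟩ := hcase i h.1
        obtain ⟨y', h3', h4'⟩ := hcase j h.2
        rw [if_pos h.1, h3] at h1
        rw [if_pos h.2, h3'] at h2
        rw [h3, h3']
        exact ⟨h1.cons_cons a, h2.cons_cons a⟩
      · refine ⟨htail h1, ?_⟩
        split_ifs at h2
        · exact h2.trans (List.tail_sublist _)
        · exact h2
    · have h1 : ∑ i ∈ F, (z i).length =
          ∑ i ∈ F, (if i ∈ S then (z i).tail else z i).length + S.card := by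
        rw [Finset.card_eq_sum_ones, hS, Finset.sum_filter, ← Finset.sum_add_distrib, ← hS]
        refine Finset.sum_congr rfl fun i hi => ?_
        by_cases h : i ∈ S
        · obtain ⟨y, h3, h4⟩ := hcase i h
          have h5 : ¬ (z i).Sublist u := (Finset.mem_filter.1 h).2
          rw [h3] at h5
          simp [h, h5, h3]
        · have h5 : (z i).Sublist u := by
            by_contra h5
            exact h (Finset.mem_filter.2 ⟨hi, h5⟩)
          simp [h, h5]
      have h2 : S.card ≤ 1 + ∑ i ∈ F, ∑ j ∈ F.erase i, if i ∈ S ∧ j ∈ S then 1 else 0 := by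
        rcases S.eq_empty_or_nonempty with h | ⟨s, hs⟩
        · simp [h]
        · rw [← Finset.card_erase_add_one hs, add_comm 1]
          refine Nat.add_le_add_right ?_ 1
          rw [Finset.card_eq_sum_ones]
          refine (Finset.sum_le_sum (g := fun i => ∑ j ∈ F.erase i,
            if i ∈ S ∧ j ∈ S then 1 else 0) fun i hi => ?_).trans
            (Finset.sum_le_sum_of_subset ((Finset.erase_subset _ _).trans (Finset.filter_subset _ _)))
          obtain ⟨hne, hi⟩ := Finset.mem_erase.1 hi
          refine le_trans ?_ (Finset.single_le_sum
            (f := fun j => if i ∈ S ∧ j ∈ S then 1 else 0) (fun _ _ => Nat.zero_le _)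
            (Finset.mem_erase.2 ⟨hne.symm, Finset.mem_of_mem_filter s hs⟩))
          simp [hi, hs]
      have h3 : ∑ i ∈ F, ∑ j ∈ F.erase i, (if i ∈ S ∧ j ∈ S then a :: x i j else x i j).length =
          ∑ i ∈ F, ∑ j ∈ F.erase i, (x i j).length +
          ∑ i ∈ F, ∑ j ∈ F.erase i, if i ∈ S ∧ j ∈ S then 1 else 0 := by
        rw [← Finset.sum_add_distrib]
        refine Finset.sum_congr rfl fun i _ => ?_
        rw [← Finset.sum_add_distrib]
        refine Finset.sum_congr rfl fun j _ => ?_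
        split_ifs <;> simp
      rw [h1, h3, List.length_cons]
      omega

theorem sum_length_le_of_lcs_le {ι : Type} [DecidableEq ι] (F : Finset ι) (u : List ℕ) (σ : ℕ)
    (z : ι → List ℕ) (hz : ∀ i ∈ F, (z i).Sublist u)
    (hσ : ∀ i ∈ F, ∀ j ∈ F, i ≠ j → ∀ x : List ℕ, x.Sublist (z i) → x.Sublist (z j) →
      x.length ≤ σ) :
    ∑ i ∈ F, (z i).length ≤ u.length + F.card ^ 2 * σ := by
  obtain ⟨x, hx, h⟩ := sum_length_le_add F u z hz
  refine h.trans (Nat.add_le_add_left ?_ _)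
  calc ∑ i ∈ F, ∑ j ∈ F.erase i, (x i j).length ≤ ∑ _i ∈ F, ∑ _j ∈ F, σ := by
        refine Finset.sum_le_sum fun i hi => ?_
        refine (Finset.sum_le_sum (g := fun _ => σ) fun j hj => ?_).trans
          (Finset.sum_le_sum_of_subset (Finset.erase_subset _ _))
        obtain ⟨hne, hj⟩ := Finset.mem_erase.1 hj
        exact hσ i hi j hj hne.symm _ (hx i hi j hj).1 (hx i hi j hj).2
    _ = F.card ^ 2 * σ := by simp; ring

/-- A short word cannot have long common subsequences with many words that are pairwise far apart:
up to errors that are small for the right choice of the parameters, the lengths of the common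
subsequences with such words add up to at most the length of the word. -/
theorem sum_lcs_le {ι : Type} [DecidableEq ι] (F : Finset ι) (w : ι → List ℕ) (u : List ℕ)
    {σ g K L : ℕ} (hσ : ∀ i ∈ F, ∀ j ∈ F, i ≠ j → ∀ x : List ℕ, x.Sublist (w i) →
      x.Sublist (w j) → x.length ≤ σ)
    (hu : u.length ≤ L) (hK : L + K ^ 2 * σ < K * g) :
    ∑ i ∈ F, lcs u (w i) ≤ u.length + F.card * g + K ^ 2 * σ := by
  choose z hzu hzw hz using fun i => exists_sublist_lcs u (w i)
  have hB : ∀ G ⊆ F, ∑ i ∈ G, lcs u (w i) ≤ u.length + G.card ^ 2 * σ := fun G hG => by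
    simp only [← hz]
    exact sum_length_le_of_lcs_le G u σ z (fun i _ => hzu i) fun i hi j hj hij x hx hx' =>
      hσ i (hG hi) j (hG hj) hij x (hx.trans (hzw i)) (hx'.trans (hzw j))
  set G := F.filter fun i => g ≤ lcs u (w i) with hG
  have hcard : G.card < K := by
    by_contra! h
    obtain ⟨G', h1, h2⟩ := Finset.exists_subset_card_eq h
    have h3 := hB G' (h1.trans (Finset.filter_subset _ _))
    have h4 := Finset.card_nsmul_le_sum G' (fun i => lcs u (w i)) g
      fun i hi => (Finset.mem_filter.1 (h1 hi)).2
    rw [smul_eq_mul, h2] at h4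
    rw [h2] at h3
    omega
  have h1 := hB G (Finset.filter_subset _ _)
  have h2 : ∑ i ∈ F.filter (fun i => ¬ g ≤ lcs u (w i)), lcs u (w i) ≤ F.card * g := by
    refine (Finset.sum_le_card_nsmul _ _ g fun i hi => ?_).trans ?_
    · exact (not_le.1 (Finset.mem_filter.1 hi).2).le
    · rw [smul_eq_mul]
      exact Nat.mul_le_mul_right _ (Finset.card_filter_le _ _)
  have h3 : G.card ^ 2 * σ ≤ K ^ 2 * σ := by gcongr
  rw [← Finset.sum_filter_add_sum_filter_not F fun i => g ≤ lcs u (w i), ← hG]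
  omega

/-- The version of `sum_lcs_le` for several short words, each of which may be used. -/
theorem sum_chunkLcs_le {ι : Type} [DecidableEq ι] (F : Finset ι) (w : ι → List ℕ)
    (us : List (List ℕ)) {σ g K L : ℕ} (hσ : ∀ i ∈ F, ∀ j ∈ F, i ≠ j → ∀ x : List ℕ,
      x.Sublist (w i) → x.Sublist (w j) → x.length ≤ σ)
    (hu : ∀ u ∈ us, u.length ≤ L) (hK : L + K ^ 2 * σ < K * g) (hus : us ≠ []) :
    ∑ i ∈ F, chunkLcs us (w i) ≤ us.flatten.length + F.card * g + us.length * (K ^ 2 * σ) := by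
  have hne : (Finset.range us.length).Nonempty :=
    ⟨0, Finset.mem_range.2 (List.length_pos_iff.2 hus)⟩
  choose t ht ht' using fun i => Finset.exists_mem_eq_sup (Finset.range us.length) hne
    fun t => lcs (us.getD t []) (w i)
  calc ∑ i ∈ F, chunkLcs us (w i)
      = ∑ r ∈ Finset.range us.length, ∑ i ∈ F with t i = r, chunkLcs us (w i) :=
        (Finset.sum_fiberwise_of_maps_to (fun i _ => ht i) _).symm
    _ ≤ ∑ r ∈ Finset.range us.length, ((us.getD r []).length +
          (F.filter fun i => t i = r).card * g + K ^ 2 * σ) := by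
        refine Finset.sum_le_sum fun r hr => ?_
        have h1 : ∑ i ∈ F with t i = r, chunkLcs us (w i) =
            ∑ i ∈ F with t i = r, lcs (us.getD r []) (w i) := by
          refine Finset.sum_congr rfl fun i hi => ?_
          rw [chunkLcs, ht' i, (Finset.mem_filter.1 hi).2]
        rw [h1]
        refine sum_lcs_le _ w _ (fun i hi j hj => hσ i (Finset.mem_filter.1 hi).1 j
          (Finset.mem_filter.1 hj).1) (hu _ ?_) hK
        rw [List.getD_eq_getElem us [] (Finset.mem_range.1 hr)]
        exact List.getElem_mem _
    _ = _ := by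
        rw [Finset.sum_add_distrib, Finset.sum_add_distrib, ← Finset.sum_mul,
          ← Finset.card_eq_sum_card_fiberwise fun i _ => ht i, Finset.sum_const, Finset.card_range,
          smul_eq_mul]
        congr 2
        rw [List.length_flatten]
        clear ht ht' t hne hus hu
        induction us with
        | nil => rfl
        | cons u us ih =>
          rw [List.length_cons, Finset.sum_range_succ']
          simpa [add_comm] using ih

end Lcs

/-! ### Linear systems over a prime field -/

section Kernel

/-- The remainder modulo `p`, which is bounded by `p` even for `p = 0`. -/
def md (a p : ℕ) : ℕ := if p = 0 then 0 else a % p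

theorem md_le (a p : ℕ) : md a p ≤ p := by
  unfold md
  split_ifs with h
  · exact Nat.zero_le _
  · exact (Nat.mod_lt _ (Nat.pos_of_ne_zero h)).le

theorem md_lt {p : ℕ} (hp : 0 < p) (a : ℕ) : md a p < p := by
  rw [md, if_neg hp.ne']
  exact Nat.mod_lt _ hp

theorem cast_md (a : ℕ) {p : ℕ} [NeZero p] : ((md a p : ℕ) : ZMod p) = a := by
  simp [md, NeZero.ne p]

/-- The scalar product of the vectors `r` and `b` of length `m`, modulo `p`. -/
def dot (p m : ℕ) (r b : List ℕ) : ℕ :=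
  md (∑ j ∈ Finset.range m, r.getD j 0 * b.getD j 0) p

/-- The vector `d • b - d' • v` of length `m`, modulo `p`. -/
def combine (p m d d' : ℕ) (b v : List ℕ) : List ℕ :=
  (List.range m).map fun j => md (d * b.getD j 0 + (p - d') * v.getD j 0) p

/-- One round of Gaussian elimination without divisions: if the vectors in `B` span the solutions of
a linear system, the result spans the solutions that are orthogonal to `r`. -/
def kernelStep (p m : ℕ) (B : List (List ℕ)) (r : List ℕ) : List (List ℕ) :=
  if (B.filter fun b => decide (dot p m r b ≠ 0)).isEmpty = true then B
  else B.map fun b => combine p m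
    (dot p m r ((B.filter fun b => decide (dot p m r b ≠ 0)).headD [])) (dot p m r b) b
    ((B.filter fun b => decide (dot p m r b ≠ 0)).headD [])

/-- The unit vectors of length `m`. -/
def unitVectors (m : ℕ) : List (List ℕ) :=
  (List.range m).map fun i => (List.range m).map fun j => if j = i then 1 else 0

/-- A list of vectors that spans the vectors of length `m` that are orthogonal to all `rows`. -/
def kernel (p m : ℕ) (rows : List (List ℕ)) : List (List ℕ) :=
  rows.foldl (kernelStep p m) (unitVectors m)

section PolyTime

variable {γ : Type} [Enc γ]

@[fun_prop]
theorem PolyTime.md {a p : γ → ℕ} (ha : PolyTime a) (hp : PolyTime p) :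
    PolyTime (fun x => md (a x) (p x)) := by
  unfold IndelCode.md
  fun_prop

@[fun_prop]
theorem PolyTime.dot {p m : γ → ℕ} {r b : γ → List ℕ} (hp : PolyTime p) (hm : PolyTime m)
    (hr : PolyTime r) (hb : PolyTime b) : PolyTime (fun x => dot (p x) (m x) (r x) (b x)) := by
  unfold IndelCode.dot
  fun_prop

@[fun_prop]
theorem PolyTime.combine {p m d d' : γ → ℕ} {b v : γ → List ℕ} (hp : PolyTime p) (hm : PolyTime m)
    (hd : PolyTime d) (hd' : PolyTime d') (hb : PolyTime b) (hv : PolyTime v) :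
    PolyTime (fun x => combine (p x) (m x) (d x) (d' x) (b x) (v x)) := by
  unfold IndelCode.combine
  fun_prop

@[fun_prop]
theorem PolyTime.kernel {p m : γ → ℕ} {rows : γ → List (List ℕ)} (hp : PolyTime p)
    (hm : PolyTime m) (hr : PolyTime rows) :
    PolyTime (fun x => kernel (p x) (m x) (rows x)) := by
  unfold IndelCode.kernel
  refine .foldl_inv (fun c B => B.length ≤ m c ∧ ∀ b ∈ B, b.length ≤ m c ∧ ∀ a ∈ b, a ≤ p c + 1)
    (B := fun c => m c * (m c * (2 * (p c + 1) + 1 + 1) + 1 + 1) + 1)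
    (by unfold kernelStep; fun_prop) hr (by unfold unitVectors; fun_prop)
    (PolyTime.polyBd (by fun_prop)) ?_ ?_ ?_
  · intro c
    simp only [unitVectors, List.length_map, List.length_range, le_refl, List.mem_map, true_and]
    rintro _ ⟨i, -, rfl⟩
    refine ⟨by simp, fun a ha => ?_⟩
    obtain ⟨j, -, rfl⟩ := List.mem_map.1 ha
    split_ifs <;> omega
  · rintro c B r - ⟨h1, h2⟩
    unfold kernelStep
    split_ifs
    · exact ⟨h1, h2⟩
    · refine ⟨by simpa using h1, fun b hb => ?_⟩
      obtain ⟨b', -, rfl⟩ := List.mem_map.1 hb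
      refine ⟨by simp [IndelCode.combine], fun a ha => ?_⟩
      obtain ⟨j, -, rfl⟩ := List.mem_map.1 ha
      exact (md_le _ _).trans (Nat.le_succ _)
  · rintro c B ⟨h1, h2⟩
    refine (sz_le_of_forall fun b hb => sz_list_nat_le (h2 b hb).1 (h2 b hb).2).trans ?_
    gcongr

end PolyTime

variable {p : ℕ} [Fact p.Prime]

/-- The entries of a list of numbers in the field with `p` elements, followed by zeros. -/
def vec (p : ℕ) (b : List ℕ) (j : ℕ) : ZMod p := (b.getD j 0 : ℕ)

/-- The scalar product over the field with `p` elements. -/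
def zdot (p m : ℕ) (r z : ℕ → ZMod p) : ZMod p := ∑ j ∈ Finset.range m, r j * z j

theorem cast_dot (m : ℕ) (r b : List ℕ) : (dot p m r b : ZMod p) = zdot p m (vec p r) (vec p b) := by
  rw [dot, cast_md]
  simp [zdot, vec]

theorem dot_eq_zero_iff (m : ℕ) (r b : List ℕ) :
    dot p m r b = 0 ↔ zdot p m (vec p r) (vec p b) = 0 := by
  rw [← cast_dot, ZMod.natCast_eq_zero_iff]
  exact ⟨fun h => by simp [h], fun h => Nat.eq_zero_of_dvd_of_lt h
    (md_lt (Fact.out : p.Prime).pos _)⟩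

theorem vec_combine (m d : ℕ) {d' : ℕ} (hd' : d' ≤ p) (b v : List ℕ) {j : ℕ} (hj : j < m) :
    vec p (combine p m d d' b v) j = d * vec p b j - d' * vec p v j := by
  have h : (combine p m d d' b v).getD j 0 = md (d * b.getD j 0 + (p - d') * v.getD j 0) p := by
    simp [combine, hj]
  rw [vec, h, cast_md]
  simp only [vec, Nat.cast_add, Nat.cast_mul, Nat.cast_sub hd', CharP.cast_eq_zero]
  ring

theorem zdot_combine (m d : ℕ) {d' : ℕ} (hd' : d' ≤ p) (b v : List ℕ) (r : ℕ → ZMod p) :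
    zdot p m r (vec p (combine p m d d' b v)) =
      d * zdot p m r (vec p b) - d' * zdot p m r (vec p v) := by
  simp only [zdot, Finset.mul_sum, ← Finset.sum_sub_distrib]
  refine Finset.sum_congr rfl fun j hj => ?_
  rw [vec_combine m d hd' b v (Finset.mem_range.1 hj)]
  ring

theorem mem_getD_of_lt {α : Type} {B : List α} {i : ℕ} (d : α) (h : i < B.length) :
    B.getD i d ∈ B := by
  rw [List.getD_eq_getElem B d h]
  exact List.getElem_mem _

/-- The vectors in `kernel p m rows` are orthogonal to all rows, and they span the vectors with this
property. -/
theorem kernel_spec (m : ℕ) (rows : List (List ℕ)) :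
    (∀ b ∈ kernel p m rows, ∀ r ∈ rows, zdot p m (vec p r) (vec p b) = 0) ∧
    ∀ z : ℕ → ZMod p, (∀ r ∈ rows, zdot p m (vec p r) z = 0) → ∃ c : ℕ → ZMod p, ∀ j < m,
      z j = ∑ i ∈ Finset.range (kernel p m rows).length,
        c i * vec p ((kernel p m rows).getD i []) j := by
  induction rows using List.reverseRecOn with
  | nil =>
    refine ⟨by simp, fun z _ => ⟨z, fun j hj => ?_⟩⟩
    simp only [kernel, List.foldl_nil]
    rw [Finset.sum_eq_single_of_mem j (by simpa [unitVectors] using hj)]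
    · simp [unitVectors, vec, hj]
    · intro i hi hij
      have hi' : i < m := by simpa [unitVectors] using hi
      simp [unitVectors, vec, hj, hi', hij.symm]
  | append_singleton rows r ih =>
    have hk : kernel p m (rows ++ [r]) = kernelStep p m (kernel p m rows) r := by simp [kernel]
    rw [hk]
    set B := kernel p m rows with hB
    obtain ⟨ih1, ih2⟩ := ih
    unfold kernelStep
    split_ifs with h
    · have h0 : ∀ b ∈ B, zdot p m (vec p r) (vec p b) = 0 := by
        rw [List.isEmpty_iff, List.filter_eq_nil_iff] at h
        exact fun b hb => (dot_eq_zero_iff m r b).1 (by simpa using h b hb)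
      refine ⟨fun b hb r' hr' => ?_, fun z hz => ih2 z fun r' hr' => hz r' (by simp [hr'])⟩
      rcases List.mem_append.1 hr' with hr' | hr'
      · exact ih1 b hb r' hr'
      · rw [List.mem_singleton.1 hr']
        exact h0 b hb
    · rw [List.isEmpty_iff, List.filter_eq_nil_iff] at h
      push Not at h
      obtain ⟨hv, hv'⟩ := headD_filter_spec [] h
      set v := (B.filter fun b => decide (dot p m r b ≠ 0)).headD []
      have hd : zdot p m (vec p r) (vec p v) ≠ 0 := fun h0 => by
        simp [(dot_eq_zero_iff m r v).2 h0] at hv'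
      have hle : ∀ b, dot p m r b ≤ p := fun b => md_le _ _
      refine ⟨fun b hb r' hr' => ?_, fun z hz => ?_⟩
      · obtain ⟨b', hb', rfl⟩ := List.mem_map.1 hb
        rw [zdot_combine m _ (hle b')]
        rcases List.mem_append.1 hr' with hr' | hr'
        · rw [ih1 b' hb' r' hr', ih1 v hv r' hr']
          ring
        · rw [List.mem_singleton.1 hr', cast_dot, cast_dot]
          ring
      · obtain ⟨c, hc⟩ := ih2 z fun r' hr' => hz r' (by simp [hr'])
        set d := zdot p m (vec p r) (vec p v) with hd_def
        have hsum : ∑ i ∈ Finset.range B.length,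
            c i * zdot p m (vec p r) (vec p (B.getD i [])) = 0 := by
          rw [← hz r (by simp), zdot]
          simp only [zdot, Finset.mul_sum]
          rw [Finset.sum_comm]
          refine Finset.sum_congr rfl fun j hj => ?_
          rw [hc j (Finset.mem_range.1 hj), Finset.mul_sum]
          exact Finset.sum_congr rfl fun i _ => by ring
        refine ⟨fun i => c i / d, fun j hj => ?_⟩
        rw [List.length_map]
        have h1 : ∀ i ∈ Finset.range B.length, c i / d * vec p ((B.map fun b =>
            combine p m (dot p m r v) (dot p m r b) b v).getD i []) j =
            c i * vec p (B.getD i []) j -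
              c i * zdot p m (vec p r) (vec p (B.getD i [])) * (vec p v j / d) := by
          intro i hi
          have hi' := Finset.mem_range.1 hi
          have h2 : (B.map fun b => combine p m (dot p m r v) (dot p m r b) b v).getD i [] =
              combine p m (dot p m r v) (dot p m r (B.getD i [])) (B.getD i []) v := by
            simp [hi']
          rw [h2, vec_combine m _ (hle _) _ _ hj, cast_dot, cast_dot, ← hd_def]
          field_simp
        rw [Finset.sum_congr rfl h1, Finset.sum_sub_distrib, ← Finset.sum_mul, hsum, zero_mul,
          sub_zero]
        exact hc j hj

/-- If a solution of a linear system has a nonzero entry, then so does a vector in the kernel. -/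
theorem exists_mem_kernel {m : ℕ} {rows : List (List ℕ)} {z : ℕ → ZMod p}
    (hz : ∀ r ∈ rows, zdot p m (vec p r) z = 0) {j : ℕ} (hj : j < m) (hzj : z j ≠ 0) :
    ∃ b ∈ kernel p m rows, vec p b j ≠ 0 := by
  obtain ⟨c, hc⟩ := (kernel_spec m rows).2 z hz
  by_contra! h
  refine hzj ((hc j hj).trans (Finset.sum_eq_zero fun i hi => ?_))
  rw [h _ (mem_getD_of_lt _ (Finset.mem_range.1 hi)), mul_zero]

end Kernel

/-! ### Unique decoding of Reed-Solomon codes -/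

section ReedSolomon

/-- The power `x ^ j` modulo `p`. -/
def powMod (p x j : ℕ) : ℕ := (fun a => md (a * x) p)^[j] 1

/-- The value at `x` modulo `p` of the polynomial of degree less than `n` with coefficients `c`. -/
def evalMod (p n : ℕ) (c : List ℕ) (x : ℕ) : ℕ :=
  md (∑ j ∈ Finset.range n, c.getD j 0 * powMod p x j) p

/-- The equation `A x = y * E x` for the unknown coefficients of a polynomial `A` of degree less
than `D + K` and a polynomial `E` of degree at most `D`. -/
def bwRow (p D K : ℕ) (pt : ℕ × ℕ) : List ℕ :=
  ((List.range (D + K)).map fun j => powMod p pt.1 j) ++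
    (List.range (D + 1)).map fun j => (p - 1) * (pt.2 * powMod p pt.1 j)

/-- The coefficients of polynomials `A` and `E`, not both zero, with `A x = y * E x` for all points
`(x, y)`. -/
def bwSolution (p D K : ℕ) (pts : List (ℕ × ℕ)) : List ℕ :=
  ((kernel p (D + K + (D + 1)) (pts.map (bwRow p D K))).filter fun b =>
    decide (¬ ∀ j < D + K + (D + 1), md (b.getD j 0) p = 0)).headD []

/-- The points at which the polynomial `E` does not vanish. These points are correct. -/
def goodPoints (p D K : ℕ) (pts : List (ℕ × ℕ)) : List (ℕ × ℕ) :=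
  pts.filter fun pt =>
    decide (evalMod p (D + 1) ((bwSolution p D K pts).drop (D + K)) pt.1 ≠ 0)

/-- The coefficients of the polynomial of degree less than `K` through the points, up to a common
factor, followed by this factor. -/
def interpolant (p K : ℕ) (pts : List (ℕ × ℕ)) : List ℕ :=
  ((kernel p (K + 1) (pts.map (bwRow p 0 K))).filter fun b =>
    decide (md (b.getD K 0) p ≠ 0)).headD []

/-- The inverse of `a` modulo `p`, found by exhaustive search. -/
def invMod (p a : ℕ) : ℕ := ((List.range p).filter fun u => decide (md (u * a) p = 1)).headD 0

/-- The decoder of Berlekamp and Welch: it returns the coefficients of the polynomial of degree less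
than `K` that passes through most of the points. -/
def rsDecode (p K : ℕ) (pts : List (ℕ × ℕ)) : List ℕ :=
  (List.range K).map fun j =>
    md (invMod p ((interpolant p K (goodPoints p ((pts.length - K) / 2) K pts)).getD K 0) *
      (interpolant p K (goodPoints p ((pts.length - K) / 2) K pts)).getD j 0) p

section PolyTime

variable {γ : Type} [Enc γ]

@[fun_prop]
theorem PolyTime.powMod {p x j : γ → ℕ} (hp : PolyTime p) (hx : PolyTime x) (hj : PolyTime j) :
    PolyTime (fun c => powMod (p c) (x c) (j c)) := by
  unfold IndelCode.powMod
  refine .iterate (fun c s => s ≤ p c + 1) (B := fun c => sz (p c + 1)) (by fun_prop) hj (.const 1)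
    (PolyTime.polyBd_sz (by fun_prop)) (fun c => by omega)
    (fun c s _ => (md_le _ _).trans (Nat.le_succ _)) fun c s hs => ?_
  rw [sz_nat, sz_nat]
  omega

@[fun_prop]
theorem PolyTime.evalMod {p n x : γ → ℕ} {b : γ → List ℕ} (hp : PolyTime p) (hn : PolyTime n)
    (hb : PolyTime b) (hx : PolyTime x) :
    PolyTime (fun c => evalMod (p c) (n c) (b c) (x c)) := by
  unfold IndelCode.evalMod
  fun_prop

@[fun_prop]
theorem PolyTime.bwRow {p D K : γ → ℕ} {pt : γ → ℕ × ℕ} (hp : PolyTime p) (hD : PolyTime D)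
    (hK : PolyTime K) (hpt : PolyTime pt) :
    PolyTime (fun c => bwRow (p c) (D c) (K c) (pt c)) := by
  unfold IndelCode.bwRow
  fun_prop

@[fun_prop]
theorem PolyTime.bwSolution {p D K : γ → ℕ} {pts : γ → List (ℕ × ℕ)} (hp : PolyTime p)
    (hD : PolyTime D) (hK : PolyTime K) (hpts : PolyTime pts) :
    PolyTime (fun c => bwSolution (p c) (D c) (K c) (pts c)) := by
  unfold IndelCode.bwSolution
  fun_prop

@[fun_prop]
theorem PolyTime.goodPoints {p D K : γ → ℕ} {pts : γ → List (ℕ × ℕ)} (hp : PolyTime p)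
    (hD : PolyTime D) (hK : PolyTime K) (hpts : PolyTime pts) :
    PolyTime (fun c => goodPoints (p c) (D c) (K c) (pts c)) := by
  unfold IndelCode.goodPoints
  fun_prop

@[fun_prop]
theorem PolyTime.interpolant {p K : γ → ℕ} {pts : γ → List (ℕ × ℕ)} (hp : PolyTime p)
    (hK : PolyTime K) (hpts : PolyTime pts) :
    PolyTime (fun c => interpolant (p c) (K c) (pts c)) := by
  unfold IndelCode.interpolant
  fun_prop

@[fun_prop]
theorem PolyTime.invMod {p a : γ → ℕ} (hp : PolyTime p) (ha : PolyTime a) :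
    PolyTime (fun c => invMod (p c) (a c)) := by
  unfold IndelCode.invMod
  fun_prop

@[fun_prop]
theorem PolyTime.rsDecode {p K : γ → ℕ} {pts : γ → List (ℕ × ℕ)} (hp : PolyTime p)
    (hK : PolyTime K) (hpts : PolyTime pts) :
    PolyTime (fun c => rsDecode (p c) (K c) (pts c)) := by
  unfold IndelCode.rsDecode
  fun_prop

end PolyTime

open Polynomial

variable {p : ℕ} [Fact p.Prime]

/-- The polynomial of degree less than `n` with the coefficients `c`. -/
noncomputable def toPoly (n : ℕ) (c : ℕ → ZMod p) : (ZMod p)[X] :=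
  ∑ j ∈ Finset.range n, C (c j) * X ^ j

theorem eval_toPoly (n : ℕ) (c : ℕ → ZMod p) (x : ZMod p) :
    (toPoly n c).eval x = ∑ j ∈ Finset.range n, c j * x ^ j := by
  simp [toPoly, eval_finsetSum]

theorem coeff_toPoly (n : ℕ) (c : ℕ → ZMod p) {j : ℕ} (hj : j < n) :
    (toPoly n c).coeff j = c j := by
  simp [toPoly, coeff_C_mul, coeff_X_pow, hj]

theorem degree_toPoly_lt (n : ℕ) (c : ℕ → ZMod p) : (toPoly n c).degree < n := by
  refine (degree_sum_le _ _).trans_lt ((Finset.sup_lt_iff (WithBot.bot_lt_coe n)).2 fun j hj => ?_)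
  exact (degree_C_mul_X_pow_le _ _).trans_lt (Nat.cast_lt.2 (Finset.mem_range.1 hj))

theorem toPoly_coeff {n : ℕ} {P : (ZMod p)[X]} (hP : P.degree < n) :
    toPoly n (fun j => P.coeff j) = P := by
  refine ext fun j => ?_
  by_cases hj : j < n
  · rw [coeff_toPoly n _ hj]
  · have hj' : (n : WithBot ℕ) ≤ j := by exact_mod_cast not_lt.1 hj
    rw [coeff_eq_zero_of_degree_lt ((degree_toPoly_lt n _).trans_le hj'),
      coeff_eq_zero_of_degree_lt (hP.trans_le hj')]

theorem eq_zero_of_eval_eq_zero {P : (ZMod p)[X]} {L : List (ZMod p)} (hL : L.Nodup)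
    (hP : P.degree < L.length) (h : ∀ x ∈ L, P.eval x = 0) : P = 0 := by
  classical
  refine eq_zero_of_degree_lt_of_eval_finset_eq_zero L.toFinset ?_ fun x hx =>
    h x (List.mem_toFinset.1 hx)
  rwa [List.toFinset_card_of_nodup hL]

theorem md_eq_zero_iff (a : ℕ) : md a p = 0 ↔ (a : ZMod p) = 0 := by
  rw [← cast_md, ZMod.natCast_eq_zero_iff]
  exact ⟨fun h => by simp [h], fun h => Nat.eq_zero_of_dvd_of_lt h
    (md_lt (Fact.out : p.Prime).pos _)⟩

theorem cast_powMod (x j : ℕ) : (powMod p x j : ZMod p) = (x : ZMod p) ^ j := by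
  induction j with
  | zero => simp [powMod]
  | succ j ih =>
    rw [powMod, Function.iterate_succ_apply', cast_md, ← powMod, Nat.cast_mul, ih, pow_succ]

theorem cast_evalMod (n : ℕ) (c : List ℕ) (x : ℕ) :
    (evalMod p n c x : ZMod p) = (toPoly n (vec p c)).eval (x : ZMod p) := by
  rw [evalMod, cast_md, eval_toPoly]
  simp [vec, cast_powMod]

theorem zdot_bwRow (D K : ℕ) (pt : ℕ × ℕ) (z : ℕ → ZMod p) :
    zdot p (D + K + (D + 1)) (vec p (bwRow p D K pt)) z =
      (toPoly (D + K) z).eval (pt.1 : ZMod p) -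
        pt.2 * (toPoly (D + 1) fun j => z (D + K + j)).eval (pt.1 : ZMod p) := by
  rw [zdot, Finset.sum_range_add, eval_toPoly, eval_toPoly, Finset.mul_sum, sub_eq_add_neg,
    ← Finset.sum_neg_distrib]
  congr 1
  · refine Finset.sum_congr rfl fun j hj => ?_
    have hj' := Finset.mem_range.1 hj
    rw [vec, bwRow, List.getD_append _ _ _ _ (by simpa using hj')]
    simp [hj', cast_powMod, mul_comm]
  · refine Finset.sum_congr rfl fun j hj => ?_
    have hj' := Finset.mem_range.1 hj
    rw [vec, bwRow, List.getD_append_right _ _ _ _ (by simp)]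
    simp [hj', cast_powMod, Nat.cast_sub (Fact.out : p.Prime).one_le]
    ring

theorem cast_nodup {pts : List (ℕ × ℕ)} (hx : ∀ pt ∈ pts, pt.1 < p)
    (hnd : (pts.map Prod.fst).Nodup) : (pts.map fun pt => (pt.1 : ZMod p)).Nodup := by
  have h : (pts.map fun pt => (pt.1 : ZMod p)) = (pts.map Prod.fst).map (Nat.cast) := by simp
  rw [h]
  refine List.Nodup.map_on (fun x hx' y hy' hxy => ?_) hnd
  obtain ⟨a, ha, rfl⟩ := List.mem_map.1 hx'
  obtain ⟨b, hb, rfl⟩ := List.mem_map.1 hy'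
  exact Nat.mod_eq_of_lt (hx a ha) ▸ Nat.mod_eq_of_lt (hx b hb) ▸ (ZMod.natCast_eq_natCast_iff' _ _ _).1 hxy

/-- The good points are correct, and there are at least `K` of them. -/
theorem goodPoints_spec {D K : ℕ} {f : (ZMod p)[X]} (hf : f.degree < K) {pts : List (ℕ × ℕ)}
    (hnd : (pts.map fun pt => (pt.1 : ZMod p)).Nodup)
    (herr : (pts.filter fun pt => decide (f.eval (pt.1 : ZMod p) ≠ pt.2)).length ≤ D)
    (hD : 2 * D + K ≤ pts.length) :
    (∀ pt ∈ goodPoints p D K pts, f.eval (pt.1 : ZMod p) = pt.2) ∧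
      K ≤ (goodPoints p D K pts).length := by
  classical
  -- the locator of the errors and its product with `f` solve the linear system
  obtain ⟨q, hq⟩ : ∃ q : ℕ × ℕ → Bool,
    ∀ pt, q pt = decide (f.eval (pt.1 : ZMod p) ≠ pt.2) := ⟨_, fun _ => rfl⟩
  simp only [← hq] at herr
  set bad := pts.filter q with hbad
  set S : Multiset (ZMod p) := ↑(bad.map fun pt => (pt.1 : ZMod p)) with hS
  set E₀ : (ZMod p)[X] := (S.map fun a => X - C a).prod with hE₀
  have hE₀m : E₀.Monic := monic_multiset_prod_of_monic _ _ fun a _ => monic_X_sub_C a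
  have hE₀d : E₀.natDegree = bad.length := by
    rw [hE₀, natDegree_multiset_prod_X_sub_C_eq_card, hS, Multiset.coe_card, List.length_map]
  have hE₀D : E₀.degree < ((D + 1 : ℕ) : WithBot ℕ) := by
    rw [degree_eq_natDegree hE₀m.ne_zero, hE₀d]
    exact_mod_cast Nat.lt_succ_of_le herr
  have hfE : ∀ E : (ZMod p)[X], E.degree < ((D + 1 : ℕ) : WithBot ℕ) →
      (f * E).degree < ((D + K : ℕ) : WithBot ℕ) := by
    intro E hE
    rcases eq_or_ne (f * E) 0 with h0 | h0
    · rw [h0, degree_zero]; exact WithBot.bot_lt_coe _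
    · have hf0 : f ≠ 0 := left_ne_zero_of_mul h0
      have hE0 : E ≠ 0 := right_ne_zero_of_mul h0
      rw [degree_eq_natDegree hf0] at hf
      rw [degree_eq_natDegree hE0] at hE
      rw [degree_mul, degree_eq_natDegree hf0, degree_eq_natDegree hE0]
      norm_cast at hf hE ⊢
      omega
  set z : ℕ → ZMod p := fun j =>
    if j < D + K then (f * E₀).coeff j else E₀.coeff (j - (D + K)) with hz
  have hzA : toPoly (D + K) z = f * E₀ := by
    rw [← toPoly_coeff (hfE E₀ hE₀D)]
    exact Finset.sum_congr rfl fun j hj => by simp [hz, Finset.mem_range.1 hj]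
  have hzE : (toPoly (D + 1) fun j => z (D + K + j)) = E₀ := by
    rw [← toPoly_coeff hE₀D]
    exact Finset.sum_congr rfl fun j hj => by simp [hz]
  have hzrows : ∀ r ∈ pts.map (bwRow p D K), zdot p (D + K + (D + 1)) (vec p r) z = 0 := by
    intro r hr
    obtain ⟨pt, hpt, rfl⟩ := List.mem_map.1 hr
    rw [zdot_bwRow, hzA, hzE, eval_mul, ← sub_mul]
    by_cases h : f.eval (pt.1 : ZMod p) = pt.2
    · rw [h, sub_self, zero_mul]
    · have h0 : E₀.eval (pt.1 : ZMod p) = 0 := by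
        refine dvd_iff_isRoot.1 (Multiset.dvd_prod (Multiset.mem_map_of_mem _ ?_))
        exact List.mem_map.2 ⟨pt, List.mem_filter.2 ⟨hpt, by simpa [hq] using h⟩, rfl⟩
      rw [h0, mul_zero]
  obtain ⟨b, hb, hbj⟩ := exists_mem_kernel hzrows (j := D + K + bad.length) (by omega) (by
    simp [hz, ← hE₀d, hE₀m.coeff_natDegree])
  obtain ⟨hv, hv'⟩ := headD_filter_spec (l := kernel p (D + K + (D + 1)) (pts.map (bwRow p D K)))
    (q := fun b => decide (¬ ∀ j < D + K + (D + 1), md (b.getD j 0) p = 0)) [] ⟨b, hb, by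
      simp only [decide_eq_true_eq, not_forall]
      exact ⟨_, by omega, fun h => hbj ((md_eq_zero_iff _).1 h)⟩⟩
  rw [← bwSolution] at hv hv'
  set v := bwSolution p D K pts with hvdef
  set A := toPoly (D + K) (vec p v) with hA
  set E := toPoly (D + 1) (fun j => vec p v (D + K + j)) with hE
  have hAE : ∀ pt ∈ pts, A.eval (pt.1 : ZMod p) = pt.2 * E.eval (pt.1 : ZMod p) := by
    intro pt hpt
    have h := (kernel_spec _ _).1 v hv _ (List.mem_map.2 ⟨pt, hpt, rfl⟩)
    rw [zdot_bwRow] at h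
    exact sub_eq_zero.1 h
  have hAfE : A = f * E := by
    rw [← sub_eq_zero]
    have hsplit := List.length_eq_length_filter_add (l := pts) q
    rw [← hbad] at hsplit
    have hsub : (pts.filter fun pt => !q pt).Sublist pts := List.filter_sublist
    have hDK : ((D + K : ℕ) : WithBot ℕ) ≤
        (((pts.filter fun pt => !q pt).map fun pt => (pt.1 : ZMod p)).length : ℕ) := by
      rw [List.length_map]
      exact Nat.cast_le.2 (by omega)
    refine eq_zero_of_eval_eq_zero (L := (pts.filter fun pt => !q pt).map fun pt =>
      (pt.1 : ZMod p)) (hnd.sublist (hsub.map _)) ?_ ?_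
    · exact (degree_sub_le _ _).trans_lt (max_lt ((degree_toPoly_lt _ _).trans_le hDK)
        ((hfE _ (degree_toPoly_lt _ _)).trans_le hDK))
    · intro x hx
      obtain ⟨pt, hpt, rfl⟩ := List.mem_map.1 hx
      obtain ⟨hpt, h⟩ := List.mem_filter.1 hpt
      rw [eval_sub, eval_mul, hAE pt hpt, (by simpa [hq] using h : f.eval (pt.1 : ZMod p) = pt.2),
        sub_self]
  have hE0 : E ≠ 0 := by
    intro h0
    have hA0 : A = 0 := by rw [hAfE, h0, mul_zero]
    simp only [decide_eq_true_eq, not_forall] at hv'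
    obtain ⟨j, hj, hne⟩ := hv'
    refine hne ((md_eq_zero_iff _).2 ?_)
    change vec p v j = 0
    by_cases hjD : j < D + K
    · rw [← coeff_toPoly (D + K) (vec p v) hjD, ← hA, hA0, coeff_zero]
    · obtain ⟨i, rfl⟩ := Nat.exists_eq_add_of_le (not_lt.1 hjD)
      rw [← coeff_toPoly (D + 1) (fun j => vec p v (D + K + j)) (by omega : i < D + 1), ← hE, h0,
        coeff_zero]
  have hev : ∀ x : ℕ, (evalMod p (D + 1) (v.drop (D + K)) x ≠ 0) ↔ E.eval (x : ZMod p) ≠ 0 := by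
    intro x
    have h1 : vec p (v.drop (D + K)) = fun j => vec p v (D + K + j) := by
      funext j; simp [vec]
    have h2 := cast_evalMod (p := p) (D + 1) (v.drop (D + K)) x
    rw [h1, ← hE] at h2
    rw [← h2, evalMod, cast_md, not_iff_not, md_eq_zero_iff]
  constructor
  · intro pt hpt
    obtain ⟨hpt, h⟩ := List.mem_filter.1 hpt
    have hne := (hev pt.1).1 (by simpa using h)
    have h1 := hAE pt hpt
    rw [hAfE, eval_mul] at h1
    exact mul_right_cancel₀ hne h1
  · -- `E` vanishes at no more than `D` points
    by_contra! hlt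
    obtain ⟨q', hq'⟩ : ∃ q' : ℕ × ℕ → Bool, q' = fun pt : ℕ × ℕ =>
      decide (evalMod p (D + 1) (v.drop (D + K)) pt.1 ≠ 0) := ⟨_, rfl⟩
    have hgood : goodPoints p D K pts = pts.filter q' := by rw [hq']; rfl
    have hsplit := List.length_eq_length_filter_add (l := pts) q'
    rw [← hgood] at hsplit
    have hsub : (pts.filter fun pt => !q' pt).Sublist pts := List.filter_sublist
    refine hE0 (eq_zero_of_eval_eq_zero (L := (pts.filter fun pt => !q' pt).map fun pt =>
      (pt.1 : ZMod p)) (hnd.sublist (hsub.map _)) ((degree_toPoly_lt _ _).trans_le ?_) ?_)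
    · rw [List.length_map]
      exact Nat.cast_le.2 (by omega)
    · intro x hx
      obtain ⟨pt, hpt, rfl⟩ := List.mem_map.1 hx
      obtain ⟨hpt, h⟩ := List.mem_filter.1 hpt
      by_contra hne
      simp [hq', (hev pt.1).2 hne] at h

theorem interpolant_spec {K : ℕ} {f : (ZMod p)[X]} (hf : f.degree < K) {pts : List (ℕ × ℕ)}
    (hnd : (pts.map fun pt => (pt.1 : ZMod p)).Nodup)
    (hpts : ∀ pt ∈ pts, f.eval (pt.1 : ZMod p) = pt.2) (hK : K ≤ pts.length) :
    vec p (interpolant p K pts) K ≠ 0 ∧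
      ∀ j < K, vec p (interpolant p K pts) j = vec p (interpolant p K pts) K * f.coeff j := by
  have hrow : ∀ (pt : ℕ × ℕ) (z : ℕ → ZMod p), zdot p (K + 1) (vec p (bwRow p 0 K pt)) z =
      (toPoly K z).eval (pt.1 : ZMod p) - pt.2 * z K := fun pt z => by
    have h := zdot_bwRow 0 K pt z
    simp only [zero_add] at h
    rw [h, eval_toPoly (0 + 1)]
    simp
  obtain ⟨b, hb, hbK⟩ := exists_mem_kernel (p := p) (m := K + 1) (rows := pts.map (bwRow p 0 K))
    (z := fun j => if j < K then f.coeff j else 1) (j := K) (by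
      intro r hr
      obtain ⟨pt, hpt, rfl⟩ := List.mem_map.1 hr
      rw [hrow, ← hpts pt hpt]
      have h : toPoly K (fun j => if j < K then f.coeff j else 1) = f := by
        rw [← toPoly_coeff hf]
        exact Finset.sum_congr rfl fun j hj => by simp [Finset.mem_range.1 hj, toPoly_coeff hf]
      rw [h]
      simp) (Nat.lt_succ_self K) (by simp)
  obtain ⟨hv, hv'⟩ := headD_filter_spec (l := kernel p (K + 1) (pts.map (bwRow p 0 K)))
    (q := fun b => decide (md (b.getD K 0) p ≠ 0)) [] ⟨b, hb, by
      simp only [decide_eq_true_eq]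
      exact fun h => hbK ((md_eq_zero_iff _).1 h)⟩
  rw [← interpolant] at hv hv'
  set v := interpolant p K pts
  refine ⟨fun h => of_decide_eq_true hv' ((md_eq_zero_iff (v.getD K 0)).2 h), fun j hj => ?_⟩
  have h0 : toPoly K (vec p v) - C (vec p v K) * f = 0 := by
    refine eq_zero_of_eval_eq_zero hnd ?_ ?_
    · rw [List.length_map]
      have hK' : (K : WithBot ℕ) ≤ pts.length := by exact_mod_cast hK
      refine (degree_sub_le _ _).trans_lt (max_lt ((degree_toPoly_lt _ _).trans_le hK') ?_)
      rw [← smul_eq_C_mul]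
      exact (degree_smul_le _ _).trans_lt (hf.trans_le hK')
    · intro x hx
      obtain ⟨pt, hpt, rfl⟩ := List.mem_map.1 hx
      have h := (kernel_spec _ _).1 v hv _ (List.mem_map.2 ⟨pt, hpt, rfl⟩)
      rw [hrow] at h
      rw [eval_sub, eval_mul, eval_C, hpts pt hpt, mul_comm]
      exact h
  have h1 := congrArg (fun P => P.coeff j) (sub_eq_zero.1 h0)
  simpa [coeff_toPoly K _ hj] using h1

theorem cast_invMod {a : ℕ} (ha : (a : ZMod p) ≠ 0) : (invMod p a : ZMod p) * a = 1 := by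
  have h1p := (Fact.out : p.Prime).one_lt
  obtain ⟨-, h⟩ := headD_filter_spec (l := List.range p)
    (q := fun u => decide (md (u * a) p = 1)) 0 ⟨((a : ZMod p)⁻¹).val,
      List.mem_range.2 (ZMod.val_lt _), by
      have h2 : ((md (((a : ZMod p)⁻¹).val * a) p : ℕ) : ZMod p) = (1 : ℕ) := by
        rw [cast_md, Nat.cast_mul, ZMod.natCast_val, ZMod.cast_id, inv_mul_cancel₀ ha, Nat.cast_one]
      have h3 := (ZMod.natCast_eq_natCast_iff' _ _ _).1 h2
      rw [Nat.mod_eq_of_lt (md_lt (by omega) _), Nat.mod_eq_of_lt h1p] at h3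
      simpa using h3⟩
  rw [← invMod] at h
  have h2 : md (invMod p a * a) p = 1 := by simpa using h
  rw [← Nat.cast_mul, ← cast_md, h2, Nat.cast_one]

/-- The decoder corrects any number of errors that is at most half of the redundancy. -/
theorem rsDecode_spec {K : ℕ} {a : List ℕ} (ha : a.length = K) (hap : ∀ c ∈ a, c < p)
    {pts : List (ℕ × ℕ)} (hx : ∀ pt ∈ pts, pt.1 < p) (hnd : (pts.map Prod.fst).Nodup)
    (herr : 2 * (pts.filter fun pt => decide (evalMod p K a pt.1 ≠ pt.2)).length + K ≤
      pts.length) : rsDecode p K pts = a := by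
  have hnd' := cast_nodup hx hnd
  have hf := degree_toPoly_lt K (vec p a)
  have hbad : (pts.filter fun pt =>
      decide ((toPoly K (vec p a)).eval (pt.1 : ZMod p) ≠ pt.2)).length ≤ (pts.length - K) / 2 := by
    have h1 : (pts.filter fun pt =>
        decide ((toPoly K (vec p a)).eval (pt.1 : ZMod p) ≠ pt.2)).length ≤
        (pts.filter fun pt => decide (evalMod p K a pt.1 ≠ pt.2)).length := by
      refine (List.monotone_filter_right pts fun pt h => ?_).length_le
      simp only [decide_eq_true_eq] at h ⊢
      rintro h'
      exact h (by rw [← cast_evalMod, h'])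
    omega
  obtain ⟨h1, h2⟩ := goodPoints_spec hf hnd' hbad (by omega)
  have hsub : (goodPoints p ((pts.length - K) / 2) K pts).Sublist pts := List.filter_sublist
  obtain ⟨h3, h4⟩ := interpolant_spec hf (hnd'.sublist (hsub.map _)) h1 h2
  rw [rsDecode]
  set v := interpolant p K (goodPoints p ((pts.length - K) / 2) K pts)
  refine List.ext_getElem (by simp [ha]) fun j hj hj' => ?_
  have hjK : j < K := by simpa using hj
  rw [List.getElem_map, List.getElem_range]
  have h5 : ((md (invMod p (v.getD K 0) * v.getD j 0) p : ℕ) : ZMod p) = (a[j] : ℕ) := by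
    have h6 := h4 j hjK
    rw [coeff_toPoly K _ hjK] at h6
    have h7 : vec p a j = (a[j] : ℕ) := by rw [vec, List.getD_eq_getElem a 0 hj']
    rw [cast_md, Nat.cast_mul, ← h7, ← one_mul (vec p a j), ← cast_invMod h3]
    change _ * vec p v j = _ * vec p v K * _
    rw [h6, mul_assoc]
  have h8 := (ZMod.natCast_eq_natCast_iff' _ _ _).1 h5
  rwa [Nat.mod_eq_of_lt (md_lt (Fact.out : p.Prime).pos _),
    Nat.mod_eq_of_lt (hap _ (List.getElem_mem _))] at h8

end ReedSolomon

/-! ### Minimum distance decoding of the concatenated code -/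

section Gmd

/-- How well the inner codeword of the value `y` at the point `x` fits into one of the chunks. -/
def weight (p : ℕ) (ws us : List (List ℕ)) (x y : ℕ) : ℕ := chunkLcs us (ws.getD (x * p + y) [])

/-- A value of largest weight at the point `x`. -/
def best (p : ℕ) (ws us : List (List ℕ)) (x : ℕ) : ℕ :=
  ((List.range p).filter fun y => decide (∀ y' < p, weight p ws us x y' ≤ weight p ws us x y)).headD 0

/-- The largest weight at `x` of a value other than `y`. -/
def rival (p : ℕ) (ws us : List (List ℕ)) (x y : ℕ) : ℕ :=
  (Finset.range p).sup fun y' => if y' = y then 0 else weight p ws us x y'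

/-- For every point, a value of largest weight and its reliability, the amount by which its weight
exceeds the weights of the other values. -/
def estimates (n p : ℕ) (ws us : List (List ℕ)) : List (ℕ × ℕ × ℕ) :=
  (List.range n).map fun x =>
    (x, best p ws us x, weight p ws us x (best p ws us x) - rival p ws us x (best p ws us x))

/-- Decode the outer code from the estimates of reliability greater than `τ`. -/
def candidate (p K : ℕ) (est : List (ℕ × ℕ × ℕ)) (τ : ℕ) : List ℕ :=
  rsDecode p K ((est.filter fun e => decide (τ < e.2.2)).map fun e => (e.1, e.2.1))

/-- The total reliability of the estimates that agree with the polynomial with coefficients `a`. -/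
def agreeing (p K : ℕ) (est : List (ℕ × ℕ × ℕ)) (a : List ℕ) : ℕ :=
  (est.map fun e => if evalMod p K a e.1 = e.2.1 then e.2.2 else 0).sum

/-- The total reliability of the estimates that disagree with the polynomial. -/
def disagreeing (p K : ℕ) (est : List (ℕ × ℕ × ℕ)) (a : List ℕ) : ℕ :=
  (est.map fun e => if evalMod p K a e.1 ≠ e.2.1 then e.2.2 else 0).sum

/-- Generalized minimum distance decoding: the polynomial whose agreement with the estimates exceeds
its disagreement by more than `K * l`, where `l` bounds the reliabilities. -/
def gmdDecode (p K l : ℕ) (est : List (ℕ × ℕ × ℕ)) : List ℕ :=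
  (((List.range l).map fun τ => candidate p K est τ).filter fun a =>
    decide (K * l + disagreeing p K est a < agreeing p K est a)).headD []

section PolyTime

variable {γ : Type} [Enc γ]

@[fun_prop]
theorem PolyTime.weight {p x y : γ → ℕ} {ws us : γ → List (List ℕ)} (hp : PolyTime p)
    (hw : PolyTime ws) (hu : PolyTime us) (hx : PolyTime x) (hy : PolyTime y) :
    PolyTime (fun c => weight (p c) (ws c) (us c) (x c) (y c)) := by
  unfold IndelCode.weight
  fun_prop

@[fun_prop]
theorem PolyTime.best {p x : γ → ℕ} {ws us : γ → List (List ℕ)} (hp : PolyTime p)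
    (hw : PolyTime ws) (hu : PolyTime us) (hx : PolyTime x) :
    PolyTime (fun c => best (p c) (ws c) (us c) (x c)) := by
  unfold IndelCode.best
  fun_prop

@[fun_prop]
theorem PolyTime.rival {p x y : γ → ℕ} {ws us : γ → List (List ℕ)} (hp : PolyTime p)
    (hw : PolyTime ws) (hu : PolyTime us) (hx : PolyTime x) (hy : PolyTime y) :
    PolyTime (fun c => rival (p c) (ws c) (us c) (x c) (y c)) := by
  unfold IndelCode.rival
  fun_prop

@[fun_prop]
theorem PolyTime.estimates {n p : γ → ℕ} {ws us : γ → List (List ℕ)} (hn : PolyTime n)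
    (hp : PolyTime p) (hw : PolyTime ws) (hu : PolyTime us) :
    PolyTime (fun c => estimates (n c) (p c) (ws c) (us c)) := by
  unfold IndelCode.estimates
  fun_prop

@[fun_prop]
theorem PolyTime.candidate {p K τ : γ → ℕ} {est : γ → List (ℕ × ℕ × ℕ)} (hp : PolyTime p)
    (hK : PolyTime K) (he : PolyTime est) (hτ : PolyTime τ) :
    PolyTime (fun c => candidate (p c) (K c) (est c) (τ c)) := by
  unfold IndelCode.candidate
  fun_prop

@[fun_prop]
theorem PolyTime.gmdDecode {p K l : γ → ℕ} {est : γ → List (ℕ × ℕ × ℕ)} (hp : PolyTime p)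
    (hK : PolyTime K) (hl : PolyTime l) (he : PolyTime est) :
    PolyTime (fun c => gmdDecode (p c) (K c) (l c) (est c)) := by
  unfold IndelCode.gmdDecode IndelCode.agreeing IndelCode.disagreeing
  fun_prop

end PolyTime

theorem sum_ite_eq_sum_length_filter {α : Type} (q : α → Prop) [DecidablePred q] (g : α → ℕ)
    (l : ℕ) (L : List α) (hg : ∀ e ∈ L, g e ≤ l) :
    (L.map fun e => if q e then g e else 0).sum =
      ∑ τ ∈ Finset.range l, (L.filter fun e => decide (τ < g e ∧ q e)).length := by
  induction L with
  | nil => simp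
  | cons e L ih =>
    rw [List.map_cons, List.sum_cons, ih fun e he => hg e (by simp [he])]
    have h : (if q e then g e else 0) = ∑ τ ∈ Finset.range l, if τ < g e ∧ q e then 1 else 0 := by
      split_ifs with hq
      · simp only [hq, and_true]
        rw [← Finset.sum_filter, ← Finset.card_eq_sum_ones]
        have h1 : (Finset.range l).filter (fun τ => τ < g e) = Finset.range (g e) := by
          ext τ
          have := hg e (by simp)
          simp only [Finset.mem_filter, Finset.mem_range]
          omega
        rw [h1, Finset.card_range]
      · simp [hq]
    rw [h, ← Finset.sum_add_distrib]
    refine Finset.sum_congr rfl fun τ _ => ?_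
    rw [List.filter_cons]
    simp only [decide_eq_true_eq]
    split_ifs <;> simp [add_comm]

variable {p K l : ℕ} {est : List (ℕ × ℕ × ℕ)}

theorem length_rsDecode (pts : List (ℕ × ℕ)) : (rsDecode p K pts).length = K := by simp [rsDecode]

/-- Where two polynomials have different values, at most one of them agrees with the estimate. -/
theorem agreeing_add_le (a b : List ℕ) (hg : ∀ e ∈ est, e.2.2 ≤ l) :
    agreeing p K est a + agreeing p K est b ≤
      disagreeing p K est a + disagreeing p K est b +
      2 * ((est.filter fun e => decide (evalMod p K a e.1 = evalMod p K b e.1)).length * l) := by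
  unfold agreeing disagreeing
  induction est with
  | nil => simp
  | cons e est ih =>
    have h1 := ih fun e he => hg e (by simp [he])
    have h2 := hg e (by simp)
    simp only [List.map_cons, List.sum_cons, List.filter_cons, decide_eq_true_eq]
    by_cases hab : evalMod p K a e.1 = evalMod p K b e.1
    · simp only [hab, if_true, List.length_cons, add_mul] at h1 ⊢
      split_ifs <;> omega
    · simp only [hab, if_false] at h1 ⊢
      split_ifs <;> omega

theorem weight_le_rival {ws us : List (List ℕ)} {x y y' : ℕ} (hy : y < p) (h : y ≠ y') :
    weight p ws us x y ≤ rival p ws us x y' := by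
  refine le_trans ?_ (Finset.le_sup (f := fun i => if i = y' then 0 else weight p ws us x i)
    (Finset.mem_range.2 hy))
  simp [h]

variable [Fact p.Prime]

theorem rsDecode_lt (pts : List (ℕ × ℕ)) : ∀ c ∈ rsDecode p K pts, c < p := by
  intro c hc
  obtain ⟨j, -, rfl⟩ := List.mem_map.1 hc
  exact md_lt (Fact.out : p.Prime).pos _

/-- Two polynomials of degree less than `K` that agree at `K` points are equal. -/
theorem eq_of_evalMod_eq {a b : List ℕ} (ha : a.length = K) (hap : ∀ c ∈ a, c < p)
    (hb : b.length = K) (hbp : ∀ c ∈ b, c < p) {xs : List ℕ} (hx : ∀ x ∈ xs, x < p)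
    (hnd : xs.Nodup) (hK : K ≤ xs.length) (h : ∀ x ∈ xs, evalMod p K a x = evalMod p K b x) :
    a = b := by
  have key : ∀ c : List ℕ, c.length = K → (∀ y ∈ c, y < p) →
      (∀ x ∈ xs, evalMod p K c x = evalMod p K b x) →
      rsDecode p K (xs.map fun x => (x, evalMod p K b x)) = c := by
    intro c hc hcp hcx
    refine rsDecode_spec hc hcp (fun pt hpt => ?_) (by simpa [Function.comp_def] using hnd) ?_
    · obtain ⟨x, hx', rfl⟩ := List.mem_map.1 hpt
      exact hx x hx'
    · rw [List.filter_eq_nil_iff.2]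
      · simpa using hK
      · intro pt hpt
        obtain ⟨x, hx', rfl⟩ := List.mem_map.1 hpt
        simpa using hcx x hx'
  exact (key a ha hap h).symm.trans (key b hb hbp fun _ _ => rfl)

/-- Generalized minimum distance decoding finds every polynomial that satisfies its criterion. -/
theorem gmdDecode_spec (hx : ∀ e ∈ est, e.1 < p) (hnd : (est.map fun e => e.1).Nodup)
    (hg : ∀ e ∈ est, e.2.2 ≤ l) {a : List ℕ} (ha : a.length = K) (hap : ∀ c ∈ a, c < p)
    (hacc : K * l + disagreeing p K est a < agreeing p K est a) : gmdDecode p K l est = a := by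
  -- by averaging over `τ`, some candidate is `a`
  have hex : ∃ τ < l, candidate p K est τ = a := by
    have h1 := sum_ite_eq_sum_length_filter (fun e => evalMod p K a e.1 = e.2.1)
      (fun e => e.2.2) l est hg
    have h2 := sum_ite_eq_sum_length_filter (fun e => evalMod p K a e.1 ≠ e.2.1)
      (fun e => e.2.2) l est hg
    rw [← agreeing] at h1
    rw [← disagreeing] at h2
    have h3 : ∑ τ ∈ Finset.range l, (K +
        (est.filter fun e => decide (τ < e.2.2 ∧ evalMod p K a e.1 ≠ e.2.1)).length) <
        ∑ τ ∈ Finset.range l,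
        (est.filter fun e => decide (τ < e.2.2 ∧ evalMod p K a e.1 = e.2.1)).length := by
      rw [Finset.sum_add_distrib, ← h1, ← h2, Finset.sum_const, Finset.card_range, smul_eq_mul,
        mul_comm]
      exact hacc
    obtain ⟨τ, hτ, h4⟩ := Finset.exists_lt_of_sum_lt h3
    refine ⟨τ, Finset.mem_range.1 hτ, rsDecode_spec ha hap ?_ ?_ ?_⟩
    · intro pt hpt
      obtain ⟨e, he, rfl⟩ := List.mem_map.1 hpt
      exact hx e (List.mem_filter.1 he).1
    · rw [List.map_map]
      exact hnd.sublist (List.filter_sublist.map _)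
    · rw [List.filter_map, List.length_map, List.length_map, List.filter_filter,
        List.length_eq_length_filter_add (l := est.filter fun e => decide (τ < e.2.2))
          fun e => decide (evalMod p K a e.1 ≠ e.2.1), List.filter_filter, List.filter_filter]
      have h5 : (est.filter fun e => ((fun pt : ℕ × ℕ => decide (evalMod p K a pt.1 ≠ pt.2)) ∘
          fun e : ℕ × ℕ × ℕ => (e.1, e.2.1)) e && decide (τ < e.2.2)) =
          est.filter fun e => decide (τ < e.2.2 ∧ evalMod p K a e.1 ≠ e.2.1) :=
        List.filter_congr fun e _ => by simp [Bool.and_comm]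
      have h6 : (est.filter fun e => decide (evalMod p K a e.1 ≠ e.2.1) && decide (τ < e.2.2)) =
          est.filter fun e => decide (τ < e.2.2 ∧ evalMod p K a e.1 ≠ e.2.1) :=
        List.filter_congr fun e _ => by simp [Bool.and_comm]
      have h7 : (est.filter fun e => !decide (evalMod p K a e.1 ≠ e.2.1) && decide (τ < e.2.2)) =
          est.filter fun e => decide (τ < e.2.2 ∧ evalMod p K a e.1 = e.2.1) :=
        List.filter_congr fun e _ => by simp [Bool.and_comm]
      rw [h5, h6, h7]
      omega
  obtain ⟨τ, hτ, hca⟩ := hex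
  obtain ⟨hb, hb'⟩ := headD_filter_spec (l := (List.range l).map fun τ => candidate p K est τ)
    (q := fun a => decide (K * l + disagreeing p K est a < agreeing p K est a)) []
    ⟨a, List.mem_map.2 ⟨τ, List.mem_range.2 hτ, hca⟩, by simpa using hacc⟩
  rw [← gmdDecode] at hb hb'
  set b := gmdDecode p K l est
  obtain ⟨τ', -, hcb⟩ := List.mem_map.1 hb
  have hb'' : K * l + disagreeing p K est b < agreeing p K est b := by simpa using hb'
  -- two polynomials that satisfy the criterion agree at `K` points
  have h1 := agreeing_add_le (p := p) (K := K) a b hg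
  have hK : K ≤ (est.filter fun e => decide (evalMod p K a e.1 = evalMod p K b e.1)).length := by
    by_contra! h
    have := Nat.mul_le_mul_right l h.le
    omega
  refine (eq_of_evalMod_eq ha hap (hcb ▸ length_rsDecode _) (hcb ▸ rsDecode_lt _)
    (xs := (est.filter fun e => decide (evalMod p K a e.1 = evalMod p K b e.1)).map fun e => e.1)
    ?_ (hnd.sublist (List.filter_sublist.map _)) (by simpa using hK) ?_).symm
  · intro x hx'
    obtain ⟨e, he, rfl⟩ := List.mem_map.1 hx'
    exact hx e (List.mem_filter.1 he).1
  · intro x hx'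
    obtain ⟨e, he, rfl⟩ := List.mem_map.1 hx'
    simpa using (List.mem_filter.1 he).2

variable {ws us : List (List ℕ)}

theorem best_spec (x : ℕ) : best p ws us x < p ∧
    ∀ y < p, weight p ws us x y ≤ weight p ws us x (best p ws us x) := by
  have hne : (Finset.range p).Nonempty := ⟨0, Finset.mem_range.2 (Fact.out : p.Prime).pos⟩
  obtain ⟨y, hy, hmax⟩ := Finset.exists_max_image (Finset.range p) (weight p ws us x) hne
  obtain ⟨h1, h2⟩ := headD_filter_spec (l := List.range p)
    (q := fun y => decide (∀ y' < p, weight p ws us x y' ≤ weight p ws us x y)) 0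
    ⟨y, List.mem_range.2 (Finset.mem_range.1 hy), by
      simpa using fun y' hy' => hmax y' (Finset.mem_range.2 hy')⟩
  rw [← best] at h1 h2
  exact ⟨List.mem_range.1 h1, by simpa using h2⟩

theorem exists_rival_eq (x y : ℕ) :
    ∃ y' < p, y' ≠ y ∧ rival p ws us x y = weight p ws us x y' := by
  have h2 := (Fact.out : p.Prime).two_le
  have hne : ((Finset.range p).erase y).Nonempty := by
    rw [← Finset.card_pos]
    have := Finset.pred_card_le_card_erase (s := Finset.range p) (a := y)
    rw [Finset.card_range] at this
    omega
  obtain ⟨y', hy', hs⟩ := Finset.exists_mem_eq_sup _ hne (weight p ws us x)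
  obtain ⟨h3, h4⟩ := Finset.mem_erase.1 hy'
  refine ⟨y', Finset.mem_range.1 h4, h3, hs ▸ le_antisymm ?_ ?_⟩
  · refine Finset.sup_le fun i hi => ?_
    split_ifs with h
    · exact Nat.zero_le _
    · exact Finset.le_sup (f := weight p ws us x) (Finset.mem_erase.2 ⟨h, hi⟩)
  · refine Finset.sup_le fun i hi => ?_
    obtain ⟨h5, h6⟩ := Finset.mem_erase.1 hi
    refine le_trans ?_ (Finset.le_sup (f := fun y' => if y' = y then 0 else weight p ws us x y') h6)
    simp [h5]

/-- The reliability of an estimate is the excess of the weight of the true value over the weights of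
the other values, if the estimate is correct; otherwise it is at most the defect of this weight. -/
theorem agreeing_estimates (n : ℕ) (a : List ℕ) :
    ∑ x ∈ Finset.range n, weight p ws us x (evalMod p K a x) +
        disagreeing p K (estimates n p ws us) a ≤
      agreeing p K (estimates n p ws us) a +
        ∑ x ∈ Finset.range n, rival p ws us x (evalMod p K a x) := by
  have hsum : ∀ f : ℕ → ℕ, ((List.range n).map f).sum = ∑ x ∈ Finset.range n, f x := fun _ => rfl
  rw [agreeing, disagreeing, estimates, List.map_map, List.map_map, hsum, hsum,
    ← Finset.sum_add_distrib, ← Finset.sum_add_distrib]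
  refine Finset.sum_le_sum fun x _ => ?_
  simp only [Function.comp_apply]
  obtain ⟨h1, h2⟩ := best_spec (p := p) (ws := ws) (us := us) x
  have hlt : evalMod p K a x < p := md_lt (Fact.out : p.Prime).pos _
  have h3 := h2 _ hlt
  by_cases h : evalMod p K a x = best p ws us x
  · simp only [h]
    simp
    omega
  · have h4 := weight_le_rival (ws := ws) (us := us) (x := x) hlt h
    have h5 := weight_le_rival (ws := ws) (us := us) (x := x) h1 (Ne.symm h)
    simp only [h, if_false, ne_eq, not_false_eq_true, if_true]
    omega

/-- The outer codeword is recovered from the estimates, if the sent word and the received word have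
a sufficiently long common subsequence. -/
theorem gmdDecode_estimates {n σ g M L : ℕ} (hn : n ≤ p) (hws : ws.length = n * p)
    (hl : ∀ w ∈ ws, w.length = l)
    (hσ : ws.Pairwise fun w w' => ∀ z : List ℕ, z.Sublist w → z.Sublist w' → z.length ≤ σ)
    (hus : us ≠ []) (hL : ∀ u ∈ us, u.length ≤ L) (hM : L + M ^ 2 * σ < M * g)
    {a : List ℕ} (ha : a.length = K) (hap : ∀ c ∈ a, c < p) {z : List ℕ}
    (hz : z.Sublist ((List.range n).flatMap fun x => ws.getD (x * p + evalMod p K a x) []))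
    (hz' : z.Sublist us.flatten)
    (hlen : K * l + 2 * (us.length * l) + 2 * (n * g) + us.length * (M ^ 2 * σ) +
      us.flatten.length < 2 * z.length) :
    gmdDecode p K l (estimates n p ws us) = a := by
  have hsum : ∀ f : ℕ → ℕ, ((List.range n).map f).sum = ∑ x ∈ Finset.range n, f x := fun _ => rfl
  have hp0 := (Fact.out : p.Prime).pos
  have hev : ∀ x, evalMod p K a x < p := fun x => md_lt hp0 _
  have hidx : ∀ {x y : ℕ}, x < n → y < p → x * p + y < ws.length := fun {x y} hx hy => by
    rw [hws]
    have := Nat.mul_le_mul_right p (Nat.succ_le_of_lt hx)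
    rw [Nat.succ_mul] at this
    omega
  have hwt : ∀ x y, weight p ws us x y ≤ l := by
    intro x y
    refine (chunkLcs_le_length _ _).trans ?_
    by_cases h : x * p + y < ws.length
    · exact (hl _ (mem_getD_of_lt _ h)).le
    · rw [List.getD_eq_default _ _ (not_lt.1 h)]
      exact Nat.zero_le _
  -- the transmitted codewords fit into the chunks
  have h1 := length_le_sum_chunkLcs (l := l)
    ((List.range n).map fun x => ws.getD (x * p + evalMod p K a x) []) us z
    (fun w hw => by
      obtain ⟨x, hx, rfl⟩ := List.mem_map.1 hw
      exact (hl _ (mem_getD_of_lt _ (hidx (List.mem_range.1 hx) (hev x)))).le)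
    (by rwa [← List.flatMap_def]) hz'
  rw [List.map_map, hsum] at h1
  -- no other codewords fit at the same time
  choose y hyp hyne hyw using fun x => exists_rival_eq (p := p) (ws := ws) (us := us) x
    (evalMod p K a x)
  set v : ℕ × Bool → ℕ := fun i => if i.2 = true then evalMod p K a i.1 else y i.1 with hv
  have hvp : ∀ i, v i < p := fun i => by
    rw [hv]; dsimp only; split_ifs
    · exact hev _
    · exact hyp _
  have h2 := sum_chunkLcs_le (Finset.range n ×ˢ (Finset.univ : Finset Bool))
    (fun i => ws.getD (i.1 * p + v i) []) us (σ := σ) (g := g) (K := M) (L := L)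
    (fun i hi j hj hij x hx hx' => by
      have hi' := hidx (Finset.mem_range.1 (Finset.mem_product.1 hi).1) (hvp i)
      have hj' := hidx (Finset.mem_range.1 (Finset.mem_product.1 hj).1) (hvp j)
      rw [List.getD_eq_getElem _ _ hi'] at hx
      rw [List.getD_eq_getElem _ _ hj'] at hx'
      have hne : i.1 * p + v i ≠ j.1 * p + v j := by
        intro h
        have hdiv := congrArg (· / p) h
        simp only [mul_comm _ p, Nat.mul_add_div hp0, Nat.div_eq_of_lt (hvp _), add_zero] at hdiv
        have hve : v i = v j := by rw [hdiv] at h; omega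
        refine hij (Prod.ext hdiv ?_)
        simp only [hv, hdiv] at hve
        have := hyne j.1
        rcases hib : i.2 <;> rcases hjb : j.2 <;> simp_all
      rcases Nat.lt_or_gt_of_ne hne with h | h
      · exact List.pairwise_iff_getElem.1 hσ _ _ hi' hj' h x hx hx'
      · exact List.pairwise_iff_getElem.1 hσ _ _ hj' hi' h x hx' hx)
    hL hM hus
  rw [Finset.sum_product, Finset.card_product, Finset.card_range, Finset.card_univ,
    Fintype.card_bool] at h2
  have h3 : ∑ x ∈ Finset.range n, ∑ b : Bool, chunkLcs us (ws.getD (x * p + v (x, b)) []) =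
      ∑ x ∈ Finset.range n, weight p ws us x (evalMod p K a x) +
      ∑ x ∈ Finset.range n, rival p ws us x (evalMod p K a x) := by
    rw [← Finset.sum_add_distrib]
    refine Finset.sum_congr rfl fun x _ => ?_
    rw [Fintype.sum_bool, hyw]
    simp [hv, weight]
  rw [h3] at h2
  have h4 := agreeing_estimates (p := p) (K := K) (ws := ws) (us := us) n a
  have h5 : ∑ x ∈ Finset.range n, (chunkLcs us ∘ fun x => ws.getD (x * p + evalMod p K a x) []) x =
    ∑ x ∈ Finset.range n, weight p ws us x (evalMod p K a x) := rfl
  rw [h5] at h1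
  refine gmdDecode_spec (fun e he => ?_) ?_ (fun e he => ?_) ha hap ?_
  · obtain ⟨x, hx, rfl⟩ := List.mem_map.1 he
    exact (List.mem_range.1 hx).trans_le hn
  · rw [estimates, List.map_map]
    simpa [Function.comp_def] using List.nodup_range
  · obtain ⟨x, hx, rfl⟩ := List.mem_map.1 he
    exact (Nat.sub_le _ _).trans (hwt _ _)
  · have h6 : n * 2 * g = 2 * (n * g) := by ring
    rw [h6] at h2
    omega

end Gmd

/-! ### Insertions and deletions and common subsequences -/

theorem exists_sublist_of_indelSteps {α : Type} {t : ℕ} {s s' : List α} (h : IndelSteps t s s') :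
    ∃ z : List α, z.Sublist s ∧ z.Sublist s' ∧ s.length + s'.length ≤ t + 2 * z.length := by
  induction h with
  | refl s => exact ⟨s, List.Sublist.refl s, List.Sublist.refl s, by omega⟩
  | insertion a _ ih =>
    obtain ⟨z, h1, h2, h3⟩ := ih
    refine ⟨z, h1, h2.trans ((List.sublist_cons_self _ _).append_left _), ?_⟩
    simp only [List.length_append, List.length_cons] at h3 ⊢
    omega
  | deletion a _ ih =>
    obtain ⟨z, h1, h2, h3⟩ := ih
    obtain ⟨z₁, z₂, rfl, h4, h5⟩ := List.sublist_append_iff.1 h2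
    simp only [List.length_append, List.length_cons] at h3 ⊢
    rcases List.sublist_cons_iff.1 h5 with h6 | ⟨y, rfl, h6⟩
    · exact ⟨z₁ ++ z₂, h1, h4.append h6, by rw [List.length_append]; omega⟩
    · refine ⟨z₁ ++ y, ((List.sublist_cons_self a y).append_left z₁).trans h1, h4.append h6, ?_⟩
      simp only [List.length_append, List.length_cons] at h3 ⊢
      omega

theorem exists_sublist_of_indelDist {α : Type} (s s' : List α) :
    ∃ z : List α, z.Sublist s ∧ z.Sublist s' ∧
      s.length + s'.length ≤ indelDist s s' + 2 * z.length :=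
  exists_sublist_of_indelSteps (Nat.sInf_mem (exists_indelSteps s s'))

/-! ### The concatenated code -/

section Code

/-- The number of words that fit well into a chunk is less than this number. It also determines the
length `blowup e ^ 2 * σ` of the inner code, whose words have no common subsequences that are longer
than `σ`. -/
def blowup (e : ℕ) : ℕ := 1536 * (e * e)

/-- The bound on the length of common subsequences of the inner code. -/
def innerLcs (r : ℕ) : ℕ := 4 * (r + 1)

/-- The block length of the inner code. -/
def innerLength (e r : ℕ) : ℕ := blowup e * blowup e * innerLcs r

/-- The reciprocal of the rate of growth of the scores in the construction of the inner code. -/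
def growth (e : ℕ) : ℕ := 8 * (blowup e * blowup e)

/-- The size of the alphabet. -/
def alphabetSize (e : ℕ) : ℕ := 2 * (growth e * growth e)

/-- The first prime number above `n`. -/
def fieldSize (n : ℕ) : ℕ :=
  ((List.range (2 * n + 1)).filter fun q =>
    decide (n < q ∧ ∀ d < q, 2 ≤ d → ¬ q % d = 0)).headD 2

/-- The dimension of the outer code of length `n`. -/
def outerDim (e n : ℕ) : ℕ := n / (4 * e)

/-- The inner code for the parameter `n = 2 ^ r`. The codeword number `x * fieldSize n + y` stands
for the value `y` at the point `x`. -/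
def innerCode (e r n : ℕ) : List (List ℕ) :=
  greedyCode (alphabetSize e) (growth e) (32 * (n * n * n * n) * growth e) (innerLength e r)
    (n * fieldSize n)

/-- The codeword that belongs to the polynomial with coefficients `a`: the values of the polynomial
at the points below `n`, together with these points, are encoded by the inner code. -/
def codeword (e r n : ℕ) (a : List ℕ) : List ℕ :=
  (List.range n).flatMap fun x => (innerCode e r n).getD
    (x * fieldSize n + evalMod (fieldSize n) (outerDim e n) a x) []

/-- The `j`-th block of `r` bits of the message `m`, as a number below `n = 2 ^ r`. -/
def messageBlock (r n : ℕ) (m : List Bool) (j : ℕ) : ℕ :=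
  ((List.range n).filter fun y =>
    decide (∀ t < r, y.bits.getD t false = m.getD (j * r + t) false)).headD 0

/-- The coefficients of the polynomial that belongs to the message `m`. -/
def messageCoeffs (e r n : ℕ) (m : List Bool) : List ℕ :=
  (List.range (outerDim e n)).map fun j => messageBlock r n m j

/-- The encoding function, in terms of the binary digits of the message and of the letters. -/
def encode (e r n : ℕ) (m : List Bool) : List (List Bool) :=
  (codeword e r n (messageCoeffs e r n m)).map fun a => a.bits

/-- The letter below `k` with the given binary digits. -/
def letterOfBits (k : ℕ) (b : List Bool) : ℕ :=
  ((List.range k).filter fun y => decide (y.bits = b)).headD 0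

/-- The coefficients of the polynomial that the decoder finds in the received word `s`. -/
def decodeCoeffs (e r n : ℕ) (s : List ℕ) : List ℕ :=
  gmdDecode (fieldSize n) (outerDim e n) (innerLength e r)
    (estimates n (fieldSize n) (innerCode e r n) (chunks (48 * e * innerLength e r) s))

/-- The decoding function, in terms of the binary digits of the letters. -/
def decode (e r n : ℕ) (s : List (List Bool)) : List (List Bool) :=
  (codeword e r n (decodeCoeffs e r n (s.map fun b => letterOfBits (alphabetSize e) b))).map
    fun a => a.bits

section PolyTime

variable {γ : Type} [Enc γ]

@[fun_prop]
theorem PolyTime.innerLength {e r : γ → ℕ} (he : PolyTime e) (hr : PolyTime r) :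
    PolyTime (fun c => innerLength (e c) (r c)) := by
  unfold IndelCode.innerLength blowup innerLcs
  fun_prop

@[fun_prop]
theorem PolyTime.growth {e : γ → ℕ} (he : PolyTime e) : PolyTime (fun c => growth (e c)) := by
  unfold IndelCode.growth blowup
  fun_prop

@[fun_prop]
theorem PolyTime.alphabetSize {e : γ → ℕ} (he : PolyTime e) :
    PolyTime (fun c => alphabetSize (e c)) := by
  unfold IndelCode.alphabetSize
  fun_prop

theorem forall_lt_imp_iff (q : ℕ) :
    (∀ d < q, 2 ≤ d → ¬ q % d = 0) ↔ ∀ d < q, ¬ 2 ≤ d ∨ ¬ q % d = 0 := by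
  simp only [imp_iff_not_or]

@[fun_prop]
theorem PolyTime.fieldSize {n : γ → ℕ} (hn : PolyTime n) : PolyTime (fun c => fieldSize (n c)) := by
  unfold IndelCode.fieldSize
  simp only [forall_lt_imp_iff]
  fun_prop

@[fun_prop]
theorem PolyTime.outerDim {e n : γ → ℕ} (he : PolyTime e) (hn : PolyTime n) :
    PolyTime (fun c => outerDim (e c) (n c)) := by
  unfold IndelCode.outerDim
  fun_prop

@[fun_prop]
theorem PolyTime.innerCode {e r n : γ → ℕ} (he : PolyTime e) (hr : PolyTime r) (hn : PolyTime n) :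
    PolyTime (fun c => innerCode (e c) (r c) (n c)) := by
  unfold IndelCode.innerCode
  fun_prop

@[fun_prop]
theorem PolyTime.codeword {e r n : γ → ℕ} {a : γ → List ℕ} (he : PolyTime e) (hr : PolyTime r)
    (hn : PolyTime n) (ha : PolyTime a) :
    PolyTime (fun c => codeword (e c) (r c) (n c) (a c)) := by
  unfold IndelCode.codeword
  fun_prop

@[fun_prop]
theorem PolyTime.encode {e r n : γ → ℕ} {m : γ → List Bool} (he : PolyTime e) (hr : PolyTime r)
    (hn : PolyTime n) (hm : PolyTime m) :
    PolyTime (fun c => encode (e c) (r c) (n c) (m c)) := by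
  unfold IndelCode.encode messageCoeffs messageBlock
  fun_prop

@[fun_prop]
theorem PolyTime.decode {e r n : γ → ℕ} {s : γ → List (List Bool)} (he : PolyTime e)
    (hr : PolyTime r) (hn : PolyTime n) (hs : PolyTime s) :
    PolyTime (fun c => decode (e c) (r c) (n c) (s c)) := by
  unfold IndelCode.decode decodeCoeffs letterOfBits
  fun_prop

end PolyTime

theorem getD_bits (n i : ℕ) : n.bits.getD i false = n.testBit i := by
  rw [Nat.testBit_eq_inth, List.getI_eq_getElem?_getD, List.getD_eq_getElem?_getD]
  rfl

theorem bits_injective : Function.Injective Nat.bits := fun a b h =>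
  Nat.eq_of_testBit_eq fun i => by rw [← getD_bits, ← getD_bits, h]

theorem letterOfBits_bits {k a : ℕ} (ha : a < k) : letterOfBits k a.bits = a := by
  obtain ⟨-, h⟩ := headD_filter_spec (l := List.range k) (q := fun y => decide (y.bits = a.bits)) 0
    ⟨a, List.mem_range.2 ha, by simp⟩
  exact bits_injective (of_decide_eq_true h)

theorem fieldSize_spec {n : ℕ} (hn : n ≠ 0) :
    (fieldSize n).Prime ∧ n < fieldSize n ∧ fieldSize n ≤ 2 * n := by
  obtain ⟨q, hq, hq1, hq2⟩ := Nat.exists_prime_lt_and_le_two_mul n hn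
  obtain ⟨h1, h2⟩ := headD_filter_spec (l := List.range (2 * n + 1))
    (q := fun q => decide (n < q ∧ ∀ d < q, 2 ≤ d → ¬ q % d = 0)) 2
    ⟨q, List.mem_range.2 (by omega), by
      simp only [decide_eq_true_eq]
      refine ⟨hq1, fun d hd hd2 hmod => ?_⟩
      rcases (Nat.dvd_prime hq).1 (Nat.dvd_of_mod_eq_zero hmod) with rfl | rfl <;> omega⟩
  rw [← fieldSize] at h1 h2
  simp only [decide_eq_true_eq] at h2
  refine ⟨Nat.prime_def_lt.2 ⟨by omega, fun d hd hdvd => ?_⟩, h2.1, by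
    have := List.mem_range.1 h1; omega⟩
  by_contra hd1
  refine h2.2 d hd ?_ (Nat.mod_eq_zero_of_dvd hdvd)
  rcases d with _ | _ | d
  · have := Nat.eq_zero_of_zero_dvd hdvd; omega
  · omega
  · omega

variable {e r n : ℕ}

theorem blowup_pos (he : 0 < e) : 0 < blowup e := by unfold blowup; positivity

theorem innerLength_pos (he : 0 < e) (r : ℕ) : 0 < innerLength e r := by
  have := blowup_pos he
  unfold innerLength innerLcs
  positivity

theorem add_one_pow_self_le (R : ℕ) : (R + 1) ^ R ≤ 4 * R ^ R := by
  rcases Nat.eq_zero_or_pos R with rfl | hR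
  · simp
  · have hR' : (0 : ℝ) < R := by exact_mod_cast hR
    have h1 : (1 + 1 / (R : ℝ)) ^ R ≤ 4 := by
      calc (1 + 1 / (R : ℝ)) ^ R ≤ Real.exp (1 / R) ^ R := by
            gcongr
            rw [add_comm]
            exact Real.add_one_le_exp _
        _ = Real.exp 1 := by
            rw [← Real.exp_nat_mul]
            congr 1
            field_simp
        _ ≤ 4 := by
            have := Real.exp_one_lt_d9
            linarith
    have h2 : ((R : ℝ) + 1) ^ R = (1 + 1 / (R : ℝ)) ^ R * R ^ R := by
      rw [← mul_pow]
      congr 1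
      field_simp
    have h3 : ((R : ℝ) + 1) ^ R ≤ 4 * R ^ R := by
      rw [h2]
      gcongr
    exact_mod_cast h3

theorem innerCode_spec (he : 0 < e) (hn : n = 2 ^ r) :
    (innerCode e r n).length = n * fieldSize n ∧
    (∀ w ∈ innerCode e r n, w.length = innerLength e r ∧ ∀ a ∈ w, a < alphabetSize e) ∧
    (innerCode e r n).Pairwise fun w w' => ∀ z : List ℕ, z.Sublist w → z.Sublist w' →
      z.length ≤ innerLcs r := by
  have hb := blowup_pos he
  set R := growth e with hR
  have hR0 : 0 < R := by rw [hR, growth]; positivity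
  have hn0 : 0 < n := by rw [hn]; positivity
  have h2l : 2 * innerLength e r = R * (r + 1) := by
    rw [hR, innerLength, growth, innerLcs]; ring
  have hpow : (R + 1) ^ (2 * innerLength e r) ≤ 4 * n ^ 2 * R ^ (2 * innerLength e r) := by
    have h4 : 4 * n ^ 2 = 4 ^ (r + 1) := by
      rw [hn, ← pow_mul, mul_comm r 2, pow_mul, pow_succ, mul_comm]; rfl
    rw [h2l, pow_mul, pow_mul, h4, ← mul_pow]
    exact Nat.pow_le_pow_left (add_one_pow_self_le R) _
  have hpow' : (R + 1) ^ innerLength e r ≤ 4 * n ^ 2 * R ^ innerLength e r := by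
    refine Nat.le_of_mul_le_mul_right ?_ (pow_pos hR0 (innerLength e r))
    calc (R + 1) ^ innerLength e r * R ^ innerLength e r
        ≤ (R + 1) ^ innerLength e r * (R + 1) ^ innerLength e r := by gcongr; omega
      _ = (R + 1) ^ (2 * innerLength e r) := by rw [two_mul, pow_add]
      _ ≤ _ := hpow
      _ = _ := by rw [two_mul, pow_add]; ring
  have hσ : 2 ^ (innerLcs r + 1) = 32 * n ^ 4 := by
    rw [hn, innerLcs, ← pow_mul, show 4 * (r + 1) + 1 = r * 4 + 5 by ring, pow_add, mul_comm]
    norm_num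
  refine greedyCode_spec hR0 (by rw [alphabetSize]; ring) ?_ ?_ ?_
  · have : 4 * n ^ 2 ≤ 32 * n ^ 4 := by
      have := Nat.pow_le_pow_right hn0 (show 2 ≤ 4 by norm_num)
      omega
    calc R * (R + 1) ^ innerLength e r ≤ R * (4 * n ^ 2 * R ^ innerLength e r) := by gcongr
      _ ≤ R * (32 * n ^ 4 * R ^ innerLength e r) := by gcongr
      _ = _ := by ring
  · rw [hσ]
    calc 32 * n ^ 4 = 32 * (n * n * n * n) * 1 := by ring
      _ ≤ _ := by gcongr; omega
  · have hp := (fieldSize_spec hn0.ne').2.2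
    have hRl : 0 < R ^ (2 * innerLength e r) := pow_pos hR0 _
    rw [hσ]
    calc n * fieldSize n * (R + 1) ^ (2 * innerLength e r)
        ≤ n * (2 * n) * (4 * n ^ 2 * R ^ (2 * innerLength e r)) := by gcongr
      _ = 8 * n ^ 4 * R ^ (2 * innerLength e r) := by ring
      _ < 32 * n ^ 4 * R ^ (2 * innerLength e r) := by gcongr; norm_num

theorem codeword_spec (he : 0 < e) (hn : n = 2 ^ r) (a : List ℕ) :
    (codeword e r n a).length = n * innerLength e r ∧ ∀ x ∈ codeword e r n a, x < alphabetSize e := by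
  have hn0 : n ≠ 0 := by rw [hn]; positivity
  obtain ⟨hp, -, -⟩ := fieldSize_spec hn0
  obtain ⟨h1, h2, -⟩ := innerCode_spec he hn
  have hmem : ∀ x < n, (innerCode e r n).getD
      (x * fieldSize n + evalMod (fieldSize n) (outerDim e n) a x) [] ∈ innerCode e r n := by
    intro x hx
    refine mem_getD_of_lt _ ?_
    have h3 : evalMod (fieldSize n) (outerDim e n) a x < fieldSize n := md_lt hp.pos _
    have h4 := Nat.mul_le_mul_right (fieldSize n) (Nat.succ_le_of_lt hx)
    rw [Nat.succ_mul] at h4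
    rw [h1]
    omega
  constructor
  · rw [codeword, List.length_flatMap, List.map_congr_left (g := fun _ => innerLength e r) fun x hx =>
      (h2 _ (hmem x (List.mem_range.1 hx))).1]
    simp
  · intro y hy
    obtain ⟨x, hx, hy⟩ := List.mem_flatMap.1 hy
    exact (h2 _ (hmem x (List.mem_range.1 hx))).2 y hy

/-- The decoder corrects a fraction `1 - 1 / e` of insertions and deletions. -/
theorem decodeCoeffs_spec (he : 0 < e) (hn : n = 2 ^ r) (hne : 16 * e ≤ n) {a : List ℕ}
    (ha : a.length = outerDim e n) (hap : ∀ c ∈ a, c < fieldSize n) {s z : List ℕ}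
    (hz : z.Sublist (codeword e r n a)) (hzs : z.Sublist s)
    (hs : s.length ≤ 2 * (n * innerLength e r))
    (hdist : e * s.length + n * innerLength e r ≤ e * (2 * z.length)) :
    decodeCoeffs e r n s = a := by
  have hn0 : n ≠ 0 := by omega
  obtain ⟨hp, hnp, -⟩ := fieldSize_spec hn0
  have : Fact (fieldSize n).Prime := ⟨hp⟩
  obtain ⟨h1, h2, h3⟩ := innerCode_spec he hn
  have hl := innerLength_pos he r
  set l := innerLength e r with hl_def
  have hL : 0 < 48 * e * l := by positivity
  have hblow : blowup e ^ 2 * innerLcs r = l := by rw [hl_def, innerLength]; ring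
  set g := 147456 * (e * e * e) * innerLcs r with hg
  have hg' : 16 * e * g = l := by rw [hl_def, hg, innerLength, blowup]; ring
  have hbg : blowup e * g = 96 * e * l := by rw [← hg', blowup]; ring
  refine gmdDecode_estimates (M := blowup e) (g := g) (L := 48 * e * l) hnp.le h1
    (fun w hw => (h2 w hw).1) h3 (by simp [chunks])
    (fun u hu => length_le_of_mem_chunks hu) ?_ ha hap hz (by rwa [flatten_chunks hL]) ?_
  · rw [hblow, hbg]
    have : l ≤ e * l := Nat.le_mul_of_pos_left _ he
    nlinarith
  · rw [flatten_chunks hL, length_chunks, hblow]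
    set T := s.length / (48 * e * l) + 1 with hT
    have hT' : 24 * e * T ≤ n + 24 * e := by
      have h4 : s.length / (48 * e * l) * (48 * e * l) ≤ 2 * (n * l) :=
        (Nat.div_mul_le_self _ _).trans hs
      have h5 : 24 * e * (s.length / (48 * e * l)) ≤ n := by
        refine le_of_mul_le_mul_right (a := 2 * l) ?_ (by positivity)
        calc _ = s.length / (48 * e * l) * (48 * e * l) := by ring
          _ ≤ _ := h4
          _ = _ := by ring
      rw [hT, mul_add, mul_one]
      omega
    have hK : outerDim e n * (4 * e) ≤ n := Nat.div_mul_le_self _ _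
    refine lt_of_mul_lt_mul_left (a := e) (lt_of_lt_of_le ?_ hdist) (Nat.zero_le _)
    have h6 : 8 * (e * (outerDim e n * l + 2 * (T * l) + 2 * (n * g) + T * l)) < 8 * (n * l) := by
      calc 8 * (e * (outerDim e n * l + 2 * (T * l) + 2 * (n * g) + T * l))
          = 2 * (outerDim e n * (4 * e)) * l + (24 * e * T) * l + n * (16 * e * g) := by ring
        _ ≤ 2 * n * l + (n + 24 * e) * l + n * l := by rw [hg']; gcongr
        _ < 8 * (n * l) := by nlinarith
    have h7 : e * (outerDim e n * l + 2 * (T * l) + 2 * (n * g) + T * l + s.length) =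
        e * (outerDim e n * l + 2 * (T * l) + 2 * (n * g) + T * l) + e * s.length := by ring
    rw [h7]
    omega

theorem messageBlock_spec (hn : n = 2 ^ r) (m j : ℕ) :
    messageBlock r n m.bits j < n ∧
      ∀ t < r, (messageBlock r n m.bits j).testBit t = m.testBit (j * r + t) := by
  obtain ⟨h1, h2⟩ := headD_filter_spec (l := List.range n) (q := fun y =>
    decide (∀ t < r, y.bits.getD t false = m.bits.getD (j * r + t) false)) 0
    ⟨m / 2 ^ (j * r) % 2 ^ r, List.mem_range.2 (by rw [hn]; exact Nat.mod_lt _ (by positivity)), by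
      simp only [decide_eq_true_eq]
      intro t ht
      rw [getD_bits, getD_bits, Nat.testBit_mod_two_pow, Nat.testBit_div_two_pow]
      simp [ht, add_comm]⟩
  rw [← messageBlock] at h1 h2
  simp only [decide_eq_true_eq, getD_bits] at h2
  exact ⟨List.mem_range.1 h1, h2⟩

theorem messageCoeffs_spec (hn : n = 2 ^ r) (m : ℕ) :
    (messageCoeffs e r n m.bits).length = outerDim e n ∧
      ∀ c ∈ messageCoeffs e r n m.bits, c < fieldSize n := by
  refine ⟨by simp [messageCoeffs], fun c hc => ?_⟩
  obtain ⟨j, -, rfl⟩ := List.mem_map.1 hc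
  exact (messageBlock_spec hn m j).1.trans (fieldSize_spec (by rw [hn]; positivity)).2.1

theorem messageCoeffs_injective (hn : n = 2 ^ r) {m m' : ℕ} (hm : m < 2 ^ (outerDim e n * r))
    (hm' : m' < 2 ^ (outerDim e n * r))
    (h : messageCoeffs e r n m.bits = messageCoeffs e r n m'.bits) : m = m' := by
  refine Nat.eq_of_testBit_eq fun i => ?_
  by_cases hi : i < outerDim e n * r
  · have hr : 0 < r := Nat.pos_of_ne_zero (by rintro rfl; simp at hi)
    have hj : i / r < outerDim e n := (Nat.div_lt_iff_lt_mul hr).2 hi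
    have h1 := congrArg (fun L => L.getD (i / r) 0) h
    simp only [messageCoeffs, List.getD_eq_getElem?_getD, List.getElem?_map,
      List.getElem?_range hj, Option.map_some, Option.getD_some] at h1
    have h2 := (messageBlock_spec hn m (i / r)).2 (i % r) (Nat.mod_lt _ hr)
    have h3 := (messageBlock_spec hn m' (i / r)).2 (i % r) (Nat.mod_lt _ hr)
    rw [Nat.div_add_mod'] at h2 h3
    rw [← h2, ← h3, h1]
  · have hle : 2 ^ (outerDim e n * r) ≤ 2 ^ i := Nat.pow_le_pow_right (by norm_num) (not_lt.1 hi)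
    rw [Nat.testBit_lt_two_pow (hm.trans_le hle), Nat.testBit_lt_two_pow (hm'.trans_le hle)]

theorem codeword_injective (he : 0 < e) (hn : n = 2 ^ r) (hne : 16 * e ≤ n) {a b : List ℕ}
    (ha : a.length = outerDim e n) (hap : ∀ c ∈ a, c < fieldSize n)
    (hb : b.length = outerDim e n) (hbp : ∀ c ∈ b, c < fieldSize n)
    (h : codeword e r n a = codeword e r n b) : a = b := by
  have hlen := (codeword_spec he hn a).1
  have h1 : n * innerLength e r ≤ e * (n * innerLength e r) := Nat.le_mul_of_pos_left _ he
  rw [← decodeCoeffs_spec he hn hne ha hap (List.Sublist.refl _) (List.Sublist.refl _)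
    (by omega) (by rw [hlen]; nlinarith)]
  exact decodeCoeffs_spec he hn hne hb hbp (h ▸ List.Sublist.refl _) (List.Sublist.refl _)
    (by omega) (by rw [hlen]; nlinarith)

end Code

/-! ### Programs for the code -/

section Programs

variable {γ α : Type} [Enc γ] [Enc α]

/-- Powers of two are computed in unary, in time polynomial in the result. -/
theorem exists_run_two_pow {l : γ → List α} (hl : PolyTime l) :
    ∃ (p : Prog) (τ : γ × ℕ → ℕ), PolyBd τ ∧ ∀ c, ∃ t,
      Run p (enc c) (enc (c, 2 ^ (l c).length)) t ∧ t ≤ τ (c, 2 ^ (l c).length) := by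
  have hfold : ∀ m : List α, m.foldl (fun (s : ℕ) _ => s + s) 1 = 2 ^ m.length := by
    intro m
    induction m using List.reverseRecOn with
    | nil => rfl
    | append_singleton m a ih => simp [ih, pow_succ, mul_two]
  have hstep : PolyTime fun x : γ × ℕ × α => x.2.1 + x.2.1 := by fun_prop
  have hfst : PolyTime fun x : γ × ℕ => x.1 := by fun_prop
  have hsnd : PolyTime fun x : γ × ℕ => x.2 := by fun_prop
  have hsz := hl.polyBd_sz
  obtain ⟨pl, τl, hτl, hl⟩ := hl
  obtain ⟨ps, τs, ⟨d, hτs⟩, hs⟩ := hstep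
  refine ⟨.cons .input (Prog.fold pl (Prog.const (enc 1)) ps), fun x => 1 + (τl x.1 + sz 1 +
    sz (l x.1) * ((sz x.1 + (sz x.2 + sz (l x.1) + 1) + 1 + 1) ^ d + 30) + 10) + 1, ?_,
    fun c => ?_⟩
  · have h1 := hsz.comp hfst.polyBd_sz
    exact ((PolyBd.const 1).add ((((hτl.comp hfst.polyBd_sz).add (.const _)).add (h1.mul
      ((((hfst.polyBd_sz.add ((hsnd.polyBd_sz.add h1).add (.const 1))).add (.const 1)).add
      (.const 1)).pow d |>.add (.const 30)))).add (.const 10))).add (.const 1)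
  · obtain ⟨t₁, h1, h2⟩ := hl c
    obtain ⟨t, h5, h6⟩ := run_fold (ps := ps) (step := fun (s : ℕ) (_ : α) => s + s)
      (T := (sz c + (sz (2 ^ (l c).length) + sz (l c) + 1) + 1 + 1) ^ d) h1
      (run_const (enc c) (enc 1)) fun l₁ a l₂ hla => by
        obtain ⟨t, h5, h6⟩ := hs (c, l₁.foldl (fun (s : ℕ) _ => s + s) 1, a)
        refine ⟨t, h5, ((Nat.le_of_add_right_le h6).trans (hτs _)).trans (Nat.pow_le_pow_left ?_ d)⟩
        have h7 : 2 ^ l₁.length ≤ 2 ^ (l c).length :=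
          Nat.pow_le_pow_right (by norm_num) (by rw [hla, List.length_append]; omega)
        have h8 : sz a ≤ sz (l c) := sz_le_of_mem (by rw [hla]; simp)
        simp only [sz_pair, hfold, sz_nat]
        omega
    rw [hfold] at h5
    refine ⟨_, .cons (.input _) h5, ?_⟩
    have := Nat.mul_le_mul_right
      ((sz c + (sz (2 ^ (l c).length) + sz (l c) + 1) + 1 + 1) ^ d + 30) (length_lt_sz (l c)).le
    simp only [sz] at *
    omega

/-- The program `p` with the first component of its input fixed. -/
def Prog.withConst (x : Sexp) (p : Prog) : Prog := .seq (.cons (Prog.const x) .input) p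

theorem run_withConst {x y z : Sexp} {p : Prog} {t : ℕ} (h : Run p (.cons x y) z t) :
    Run (Prog.withConst x p) y z (x.size + t + 3) := by
  have h1 := Run.seq (.cons (run_const y x) (.input y)) h
  rwa [show x.size + 1 + 1 + t + 1 = x.size + t + 3 by ring] at h1

@[fun_prop]
theorem PolyTime.const_text {f : γ → ℕ} (hf : PolyTime f) :
    PolyTime (fun x => (Prog.const (enc (f x))).text) := by
  have hstep : PolyTime fun x : γ × Sexp =>
      Sexp.ofList [Sexp.ofNat 4, Prog.nil.text, x.2] :=
    (by fun_prop : PolyTime fun x : γ × Sexp =>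
      (Sexp.ofNat 4, Prog.nil.text, x.2, ())).of_enc_eq fun _ => rfl
  have h : PolyTime fun c =>
      (fun s => Sexp.ofList [Sexp.ofNat 4, Prog.nil.text, s])^[f c] Prog.nil.text :=
    .iterate_add (D := fun _ => (Sexp.ofList [Sexp.ofNat 4, Prog.nil.text]).size + 1) hstep hf
      (.const _) (.const _) fun c s => by
        simp only [sz, enc, _root_.id, Sexp.ofList, Sexp.size]; omega
  refine h.of_enc_eq fun c => congrArg enc ?_
  induction f c with
  | zero => rfl
  | succ n ih => rw [Function.iterate_succ_apply', ← ih]; rfl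

@[fun_prop]
theorem PolyTime.withConst_text {e r n : γ → ℕ} (he : PolyTime e) (hr : PolyTime r)
    (hn : PolyTime n) (p : Prog) :
    PolyTime (fun c => (Prog.withConst (enc (e c, r c, n c)) p).text) := by
  have h : PolyTime fun c => (Sexp.ofNat 5, (Sexp.ofNat 4, (Sexp.ofNat 4,
      (Prog.const (enc (e c))).text, (Sexp.ofNat 4, (Prog.const (enc (r c))).text,
        (Prog.const (enc (n c))).text, ()), ()), Prog.input.text, ()), p.text, ()) := by fun_prop
  exact h.of_enc_eq fun _ => rfl

theorem bits_two_pow (m : ℕ) : (2 ^ m).bits = List.replicate m false ++ [true] := by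
  induction m with
  | zero => simp
  | succ m ih =>
    rw [pow_succ', Nat.bit0_bits _ (by positivity), ih, List.replicate_succ, List.cons_append]

/-- The description of the code with the parameters `e`, `r` and `n`, where the encoding and the
decoding program are those for all codes, `pe` and `pd`, with fixed parameters. -/
def descriptionOf (pe pd : Prog) (e r n : ℕ) : Sexp :=
  Sexp.ofList [Sexp.ofNat (n * innerLength e r), Sexp.ofNat (2 ^ (outerDim e n * r)),
    (Prog.withConst (enc (e, r, n)) pe).text, (Prog.withConst (enc (e, r, n)) pd).text]

theorem PolyTime.descriptionOf (pe pd : Prog) {e r n : γ → ℕ} (he : PolyTime e) (hr : PolyTime r)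
    (hn : PolyTime n) : PolyTime (fun c => descriptionOf pe pd (e c) (r c) (n c)) := by
  have h : PolyTime fun c => ((n c * IndelCode.innerLength (e c) (r c)).bits,
      List.replicate (IndelCode.outerDim (e c) (n c) * r c) false ++ [true],
      (Prog.withConst (enc (e c, r c, n c)) pe).text,
      (Prog.withConst (enc (e c, r c, n c)) pd).text, ()) := by fun_prop
  refine h.of_enc_eq fun c => ?_
  rw [← bits_two_pow]
  rfl

theorem sz_bits_le (a : ℕ) : sz a.bits ≤ 4 * a.size + 1 := by
  refine (sz_le_of_forall fun b _ => sz_bool b).trans ?_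
  rw [Nat.size_eq_bits_len]
  omega

theorem size_le_self (a : ℕ) : a.size ≤ a := Nat.size_le.2 Nat.lt_two_pow_self

theorem two_pow_size_le (i : ℕ) : 2 ^ i.size ≤ 2 * i + 1 := by
  rcases h : i.size with _ | s
  · omega
  · have := Nat.lt_size.1 (show s < i.size by omega)
    rw [pow_succ]
    omega

/-- One program constructs the codes for all `e` and `i`; the number `2 ^ (i + e + 10)` is the
length of the outer code. -/
theorem exists_run_descriptionOf (pe pd : Prog) :
    ∃ (p : Prog) (D : ℕ), ∀ e i n : ℕ, n = 2 ^ (i + e + 10) →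
      ∃ t, Run p (enc (e, i.bits)) (descriptionOf pe pd e (i + e + 10) n) t ∧
        t + sz (e, i.bits) + (descriptionOf pe pd e (i + e + 10) n).size + 3 ≤ n ^ D := by
  obtain ⟨p₁, τ₁, hτ₁, h₁⟩ := exists_run_two_pow
    (by fun_prop : PolyTime fun x : ℕ × List Bool => x.2)
  obtain ⟨p₂, τ₂, hτ₂, h₂⟩ : PolyTime fun x : (ℕ × List Bool) × ℕ =>
      (x.1.1, letterOfBits x.2 x.1.2 + x.1.1 + 10) := by
    unfold letterOfBits; fun_prop
  obtain ⟨p₃, τ₃, hτ₃, h₃⟩ := exists_run_two_pow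
    (by fun_prop : PolyTime fun x : ℕ × ℕ => List.replicate x.2 ())
  obtain ⟨p₄, τ₄, hτ₄, h₄⟩ := PolyTime.descriptionOf pe pd
    (by fun_prop : PolyTime fun x : (ℕ × ℕ) × ℕ => x.1.1)
    (by fun_prop : PolyTime fun x : (ℕ × ℕ) × ℕ => x.1.2)
    (by fun_prop : PolyTime fun x : (ℕ × ℕ) × ℕ => x.2)
  have hfst : PolyTime fun x : ((ℕ × List Bool) × ℕ) × (ℕ × ℕ) × ℕ => x.1 := by fun_prop
  have hsnd : PolyTime fun x : ((ℕ × List Bool) × ℕ) × (ℕ × ℕ) × ℕ => x.2 := by fun_prop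
  obtain ⟨d, hd⟩ := ((((((hτ₁.comp hfst.polyBd_sz).add (hτ₂.comp hfst.polyBd_sz)).add
    (hτ₃.comp hsnd.polyBd_sz)).add (hτ₄.comp hsnd.polyBd_sz)).add (hfst.polyBd_sz)).add
    (.const 6))
  refine ⟨.seq p₁ (.seq p₂ (.seq p₃ p₄)), 2 * d, fun e i n hn => ?_⟩
  obtain ⟨t₁, hr₁, ht₁⟩ := h₁ (e, i.bits)
  obtain ⟨t₂, hr₂, ht₂⟩ := h₂ ((e, i.bits), 2 ^ i.bits.length)
  obtain ⟨t₃, hr₃, ht₃⟩ := h₃ (e, i + e + 10)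
  obtain ⟨t₄, hr₄, ht₄⟩ := h₄ ((e, i + e + 10), n)
  have hi : i < 2 ^ i.bits.length := by rw [Nat.size_eq_bits_len]; exact Nat.lt_size_self i
  simp only [letterOfBits_bits hi] at hr₂ ht₂
  simp only [List.length_replicate, ← hn] at hr₃ ht₃
  have hd' := hd (((e, i.bits), 2 ^ i.bits.length), ((e, i + e + 10), n))
  have hu : 2 ^ i.bits.length ≤ 2 * i + 1 := by
    rw [Nat.size_eq_bits_len]; exact two_pow_size_le i
  have hb := sz_bits_le i
  have hb' := size_le_self i
  have hn' : 1024 * (i + e + 1) ≤ n := by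
    have h5 : i + e < 2 ^ (i + e) := Nat.lt_two_pow_self
    rw [hn, pow_add]
    omega
  refine ⟨_, .seq hr₁ (.seq hr₂ (.seq hr₃ hr₄)), ?_⟩
  have hle : sz (((e, i.bits), 2 ^ i.bits.length), ((e, i + e + 10), n)) + 1 ≤ n ^ 2 := by
    simp only [sz_pair, sz_nat]
    nlinarith
  refine le_trans ?_ ((hd'.trans (Nat.pow_le_pow_left hle d)).trans_eq (pow_mul n 2 d).symm)
  simp only [sz_pair] at *
  have : sz (descriptionOf pe pd e (i + e + 10) n) =
    (descriptionOf pe pd e (i + e + 10) n).size := rfl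
  omega

/-- The size bounds that turn polynomial time into time polynomial in the block length. -/
theorem parameter_bounds {e r n : ℕ} (he : 0 < e) (hne : 1024 * e ≤ n) :
    1024 * (n * (r + 1)) ≤ n * innerLength e r ∧
      alphabetSize e ≤ (n * innerLength e r) ^ 2 := by
  have h1 : 1 ≤ e * e * (e * e) := Nat.one_le_iff_ne_zero.2 (by positivity)
  constructor
  · calc 1024 * (n * (r + 1)) = 1024 * (n * (r + 1)) * 1 := (mul_one _).symm
      _ ≤ 9437184 * (n * (r + 1)) * (e * e * (e * e)) := by gcongr; norm_num
      _ = _ := by rw [innerLength, blowup, innerLcs]; ring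
  · calc alphabetSize e = 128 * (1536 ^ 4 * (e * e * (e * e)) ^ 2) := by
          rw [alphabetSize, growth, blowup]; ring
      _ ≤ 1024 ^ 2 * (1536 ^ 4 * (e * e * (e * e)) ^ 2) := by gcongr; norm_num
      _ = (1024 * 1 * (1536 ^ 2 * (e * e * (e * e)) * 1)) ^ 2 := by ring
      _ ≤ (1024 * e * (1536 ^ 2 * (e * e * (e * e)) * innerLcs r)) ^ 2 := by
          gcongr
          · exact he
          · rw [innerLcs]; omega
      _ ≤ (n * (1536 ^ 2 * (e * e * (e * e)) * innerLcs r)) ^ 2 := by gcongr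
      _ = _ := by rw [innerLength, blowup]; ring

/-- A function in polynomial time is computed, for fixed values of the parameters, by a program that
takes time polynomial in `N`, if the parameters and the size of the input are. -/
theorem exists_run_withConst {β : Type} [Enc β] {f : (ℕ × ℕ × ℕ) × α → β} (hf : PolyTime f) :
    ∃ (p : Prog) (D : ℕ), ∀ e r n N : ℕ, ∀ x : α, e ≤ N → r ≤ N → n ≤ N → 2 ≤ N →
      sz x ≤ N ^ 5 → ∃ t, Run (Prog.withConst (enc (e, r, n)) p) (enc x) (enc (f ((e, r, n), x))) t ∧
        t + sz (f ((e, r, n), x)) ≤ N ^ D := by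
  obtain ⟨p, τ, hτ, h⟩ := hf
  obtain ⟨d, hd⟩ := (hτ.add .sz).add (.const 3)
  refine ⟨p, 9 * d, fun e r n N x he hr hn hN hx => ?_⟩
  obtain ⟨t, h1, h2⟩ := h ((e, r, n), x)
  refine ⟨_, run_withConst h1, ?_⟩
  have h3 := hd ((e, r, n), x)
  have h4 : sz ((e, r, n), x) + 1 ≤ N ^ 9 := by
    have h5 : N ≤ N ^ 5 := Nat.le_self_pow (by norm_num) N
    have h6 : 2 ^ 4 * N ^ 5 ≤ N ^ 9 := by
      rw [show 9 = 4 + 5 by norm_num, pow_add]; gcongr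
    simp only [sz_pair, sz_nat]
    omega
  refine le_trans ?_ ((h3.trans (Nat.pow_le_pow_left h4 d)).trans_eq (pow_mul N 9 d).symm)
  have h7 : (enc (e, r, n)).size = sz (e, r, n) := rfl
  simp only [sz_pair] at *
  omega

end Programs


/-! ### The family of codes -/

section Family

variable {e r n : ℕ}

theorem exists_map_ofFn_eq {l : List ℕ} {N k : ℕ} (hl : l.length = N) (hk : ∀ a ∈ l, a < k) :
    ∃ c : Fin N → Fin k, (List.ofFn c).map Fin.val = l := by
  subst hl
  exact ⟨fun i => ⟨l[i], hk _ (List.getElem_mem _)⟩, by simp [List.map_ofFn, Function.comp_def]⟩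

/-- The codewords of all messages are distinct words over `Fin (alphabetSize e)`. -/
theorem exists_code (he : 0 < e) (hn : n = 2 ^ r) (hne : 16 * e ≤ n) :
    ∃ (C : Finset (Fin (n * innerLength e r) → Fin (alphabetSize e)))
      (f : Fin C.card → (Fin (n * innerLength e r) → Fin (alphabetSize e))),
      C.card = 2 ^ (outerDim e n * r) ∧ Set.range f = C ∧ ∀ m,
        (List.ofFn (f m)).map Fin.val =
          codeword e r n (messageCoeffs e r n (m : ℕ).bits) := by
  classical
  choose f hf using fun m : Fin (2 ^ (outerDim e n * r)) =>
    exists_map_ofFn_eq (codeword_spec he hn (messageCoeffs e r n (m : ℕ).bits)).1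
      (codeword_spec he hn (messageCoeffs e r n (m : ℕ).bits)).2
  have hinj : Function.Injective f := fun m m' h => by
    have h1 := hf m
    rw [h, hf m'] at h1
    have ha := messageCoeffs_spec (e := e) hn m
    have hb := messageCoeffs_spec (e := e) hn m'
    exact Fin.ext (messageCoeffs_injective hn m.2 m'.2
      (codeword_injective he hn hne ha.1 ha.2 hb.1 hb.2 h1.symm))
  have hcard : (Finset.univ.image f).card = 2 ^ (outerDim e n * r) := by
    rw [Finset.card_image_of_injective _ hinj, Finset.card_univ, Fintype.card_fin]
  refine ⟨Finset.univ.image f, fun m => f (Fin.cast hcard m), hcard, ?_, fun m => hf _⟩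
  ext c
  simp only [Set.mem_range, Finset.coe_image, Finset.coe_univ, Set.image_univ]
  exact ⟨fun ⟨m, hm⟩ => ⟨_, hm⟩, fun ⟨m, hm⟩ => ⟨Fin.cast hcard.symm m, by simpa using hm⟩⟩

/-- The letters of the word are coerced to numbers before they are written in binary. -/
theorem ofWord_eq {k : ℕ} (s : List (Fin k)) :
    Sexp.ofWord s = enc ((s.map Fin.val).map Nat.bits) := by
  rw [Sexp.ofWord, List.bind_eq_flatMap]
  simp only [List.pure_def, ← List.map_eq_flatMap, enc, List.map_map]
  rfl

/-- The decoder corrects all words `s` whose insertion/deletion distance from a codeword is at most a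
fraction `1 - 1 / e` of the block length. -/
theorem decode_eq (he : 0 < e) (hn : n = 2 ^ r) (hne : 16 * e ≤ n) {a : List ℕ}
    (ha : a.length = outerDim e n) (hap : ∀ c ∈ a, c < fieldSize n)
    {c : Fin (n * innerLength e r) → Fin (alphabetSize e)}
    (hc : (List.ofFn c).map Fin.val = codeword e r n a)
    {s : List (Fin (alphabetSize e))}
    (hs : e * indelDist (List.ofFn c) s + n * innerLength e r ≤ e * (n * innerLength e r)) :
    s.length ≤ 2 * (n * innerLength e r) ∧
      decode e r n ((s.map Fin.val).map Nat.bits) =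
        ((List.ofFn c).map Fin.val).map Nat.bits := by
  obtain ⟨z, h1, h2, h3⟩ := exists_sublist_of_indelDist (List.ofFn c) s
  have hz := h1.length_le
  rw [List.length_ofFn] at h3 hz
  have hD : indelDist (List.ofFn c) s ≤ n * innerLength e r :=
    le_of_mul_le_mul_left ((Nat.le_add_right _ _).trans hs) he
  have hlen : s.length ≤ 2 * (n * innerLength e r) := by omega
  refine ⟨hlen, ?_⟩
  have hmap : ((s.map Fin.val).map Nat.bits).map
      (fun b => letterOfBits (alphabetSize e) b) = s.map Fin.val := by
    rw [List.map_map, List.map_map]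
    exact List.map_congr_left fun x _ => letterOfBits_bits x.2
  rw [decode, hmap, hc, decodeCoeffs_spec he hn hne ha hap (hc ▸ h1.map _) (h2.map _)
    (by rwa [List.length_map])]
  rw [List.length_map, List.length_map]
  have h4 := Nat.mul_le_mul_left e h3
  rw [mul_add, mul_add] at h4
  omega

theorem alphabetSize_eq (e : ℕ) : alphabetSize e = 128 * 1536 ^ 4 * e ^ 8 := by
  rw [alphabetSize, growth, blowup]; ring

theorem log_alphabetSize_le (he : 0 < e) :
    Real.log (alphabetSize e) ≤ 59 * e * Real.log 2 := by
  have h1 : alphabetSize e ≤ 2 ^ (59 * e) := by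
    calc alphabetSize e = 128 * 1536 ^ 4 * e ^ 8 := alphabetSize_eq e
      _ ≤ 2 ^ (51 * 1) * (2 ^ e) ^ 8 := by
        gcongr
        · norm_num
        · exact Nat.lt_two_pow_self.le
      _ ≤ 2 ^ (51 * e) * (2 ^ e) ^ 8 := by
        gcongr
        · norm_num
        · exact he
      _ = 2 ^ (59 * e) := by rw [← pow_mul, ← pow_add]; congr 1; ring
  have h2 : 0 < alphabetSize e := by rw [alphabetSize_eq]; positivity
  calc Real.log (alphabetSize e) ≤ Real.log ((2 : ℝ) ^ (59 * e)) :=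
        Real.log_le_log (by exact_mod_cast h2) (by exact_mod_cast h1)
    _ = 59 * e * Real.log 2 := by rw [Real.log_pow]; push_cast; ring

/-- The outer code has rate `1 / (4 e)`, up to rounding, and the inner code has rate of the order
`1 / e ^ 5`, because its length is of the order `e ^ 4 * r`. -/
theorem le_rate (he : 0 < e) (hr : 0 < r) (hne : 16 * e ≤ n)
    (C : Finset (Fin (n * innerLength e r) → Fin (alphabetSize e)))
    (hC : C.card = 2 ^ (outerDim e n * r)) :
    1 / (8908701696 * (e : ℝ) ^ 6) ≤ rate C := by
  have hK : n ≤ 8 * e * outerDim e n := by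
    have h1 : n < 4 * e * (outerDim e n + 1) := Nat.lt_mul_div_succ n (by positivity)
    have h2 : 4 ≤ outerDim e n := (Nat.le_div_iff_mul_le (by positivity)).2 (by linarith)
    nlinarith
  have hN : n * innerLength e r * (59 * e) ≤ 8908701696 * e ^ 6 * (outerDim e n * r) := by
    calc n * innerLength e r * (59 * e)
        = n * (1536 ^ 2 * e ^ 4 * (4 * (r + 1))) * (59 * e) := by
          rw [innerLength, blowup, innerLcs]; ring
      _ ≤ (8 * e * outerDim e n) * (1536 ^ 2 * e ^ 4 * (8 * r)) * (59 * e) := by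
          gcongr ?_ * (_ * ?_) * _
          omega
      _ = _ := by ring
  have hn0 : 0 < n := by omega
  have hk : 1 < alphabetSize e := by
    rw [alphabetSize_eq]
    have : 0 < e ^ 8 := by positivity
    omega
  have hl := innerLength_pos he r
  have hlogk : 0 < Real.log (alphabetSize e) := Real.log_pos (by exact_mod_cast hk)
  have hlog2 : 0 < Real.log 2 := Real.log_pos (by norm_num)
  rw [rate, hC, div_le_div_iff₀ (by positivity) (by positivity), one_mul]
  have hN' : ((n * innerLength e r : ℕ) : ℝ) * (59 * e) ≤
      8908701696 * (e : ℝ) ^ 6 * ((outerDim e n * r : ℕ) : ℝ) := by exact_mod_cast hN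
  calc ((n * innerLength e r : ℕ) : ℝ) * Real.log (alphabetSize e)
      ≤ ((n * innerLength e r : ℕ) : ℝ) * (59 * e * Real.log 2) := by
        gcongr; exact log_alphabetSize_le he
    _ = ((n * innerLength e r : ℕ) : ℝ) * (59 * e) * Real.log 2 := by ring
    _ ≤ 8908701696 * (e : ℝ) ^ 6 * ((outerDim e n * r : ℕ) : ℝ) * Real.log 2 := by gcongr
    _ = _ := by push_cast; rw [Real.log_pow]; push_cast; ring

end Family

end IndelCode

open IndelCode IndelCode.Enc in
theorem theorem6 :
    ∃ (c₀ A κ B : ℝ) (a d b : ℕ), 0 < c₀ ∧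
      ∀ ε : ℝ, 0 < ε → ε ≤ 1 →
        ∃ k : ℕ, 2 ≤ k ∧ (k : ℝ) ≤ A * (1 / ε) ^ a ∧
        ∃ (N : ℕ → ℕ) (C : ∀ i : ℕ, Finset (Fin (N i) → Fin k))
          (T : ℕ → ℝ) (construct : IndelCode.Prog) (enc dec : ℕ → IndelCode.Prog),
          StrictMono N ∧
          (∀ i : ℕ, T i = κ * (N i : ℝ) ^ d * Real.logb 2 (N i : ℝ) ^ (B * (1 / ε) ^ b)) ∧
          ∀ i : ℕ,
            c₀ * ε ^ 9 ≤ IndelCode.rate (C i) ∧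
            IndelCode.ComputesWithin construct (IndelCode.Sexp.ofNat i)
              (IndelCode.description (C i) (enc i) (dec i)) (T i) ∧
            IndelCode.EncodesWithin (C i) (enc i) (T i) ∧
            IndelCode.DecodesWithin (C i) (dec i) (1 - ε) (T i) := by
  obtain ⟨pe, De, he⟩ := exists_run_withConst
    (by fun_prop : PolyTime fun x : (ℕ × ℕ × ℕ) × List Bool => encode x.1.1 x.1.2.1 x.1.2.2 x.2)
  obtain ⟨pd, Dd, hd⟩ := exists_run_withConst
    (by fun_prop : PolyTime fun x : (ℕ × ℕ × ℕ) × List (List Bool) =>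
      decode x.1.1 x.1.2.1 x.1.2.2 x.2)
  obtain ⟨pc, Dc, hc⟩ := exists_run_descriptionOf pe pd
  -- `8908701696` is the constant in `le_rate`; the powers of two come from `e ≤ 2 / ε`
  refine ⟨1 / (8908701696 * 512), 128 * 1536 ^ 4 * 256, 1, 0, 8, max (max De Dd) Dc, 0,
    by norm_num, fun ε hε hε1 => ?_⟩
  set e := ⌈1 / ε⌉₊ with he_def
  have hle : 1 / ε ≤ e := Nat.le_ceil _
  have he0 : 0 < e := Nat.ceil_pos.2 (by positivity)
  have hεe : 1 ≤ ε * e := by rwa [div_le_iff₀' hε] at hle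
  have hεe2 : ε * e ≤ 2 := by
    have h1 := Nat.ceil_lt_add_one (show 0 ≤ 1 / ε by positivity)
    have h2 : ε * e ≤ ε * (1 / ε + 1) := by gcongr
    rw [mul_add, mul_one_div_cancel hε.ne'] at h2
    linarith
  -- the summand `e + 10` makes the length `2 ^ r i` of the outer code at least `1024 * e`
  let r : ℕ → ℕ := fun i => i + e + 10
  have hr : ∀ i, 1024 * (r i) ≤ 1024 * 2 ^ (r i) ∧ 1024 * e ≤ 2 ^ r i := fun i => by
    have h1 : r i < 2 ^ r i := Nat.lt_two_pow_self
    have h2 : i + e < 2 ^ (i + e) := Nat.lt_two_pow_self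
    have h3 : 2 ^ r i = 2 ^ (i + e) * 1024 := by rw [show r i = i + e + 10 from rfl, pow_add]; norm_num
    omega
  choose C f hcard hrange hf using fun i =>
    exists_code (n := 2 ^ r i) he0 rfl (by have := (hr i).2; omega)
  have hT : ∀ i (D t : ℕ), D ≤ max (max De Dd) Dc → t ≤ (2 ^ r i * innerLength e (r i)) ^ D →
      (t : ℝ) ≤ 1 * ((2 ^ r i * innerLength e (r i) : ℕ) : ℝ) ^ max (max De Dd) Dc *
        Real.logb 2 ((2 ^ r i * innerLength e (r i) : ℕ) : ℝ) ^ ((0 : ℝ) * (1 / ε) ^ 0) := by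
    intro i D t hD ht
    have h1 : 0 < 2 ^ r i * innerLength e (r i) :=
      Nat.mul_pos (by positivity) (innerLength_pos he0 _)
    rw [zero_mul, Real.rpow_zero, mul_one, one_mul]
    exact_mod_cast ht.trans (Nat.pow_le_pow_right h1 hD)
  refine ⟨alphabetSize e, ?_, ?_, fun i => 2 ^ r i * innerLength e (r i), C, _,
    Prog.withConst (Enc.enc e) pc, fun i => Prog.withConst (Enc.enc (e, r i, 2 ^ r i)) pe,
    fun i => Prog.withConst (Enc.enc (e, r i, 2 ^ r i)) pd, ?_, fun i => rfl, fun i => ?_⟩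
  · rw [alphabetSize_eq]
    have : 0 < e ^ 8 := by positivity
    omega
  · have h1 : (e : ℝ) ≤ 2 * (1 / ε) := by rw [mul_one_div, le_div_iff₀' hε]; exact hεe2
    calc (alphabetSize e : ℝ) = 128 * 1536 ^ 4 * (e : ℝ) ^ 8 := by
          rw [alphabetSize_eq, Nat.cast_mul, Nat.cast_pow]; norm_num
      _ ≤ 128 * 1536 ^ 4 * (2 * (1 / ε)) ^ 8 := by gcongr
      _ = 128 * 1536 ^ 4 * 256 * (1 / ε) ^ 8 := by rw [mul_pow]; ring
  · refine strictMono_nat_of_lt_succ fun i => Nat.mul_lt_mul_of_lt_of_le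
      (Nat.pow_lt_pow_right (by norm_num) (by simp only [r]; omega)) ?_ (innerLength_pos he0 _)
    simp only [innerLength, innerLcs, r]
    gcongr
    omega
  have hne := (hr i).2
  have hr' := (hr i).1
  have hri : r i = i + e + 10 := rfl
  obtain ⟨hN, hk⟩ := parameter_bounds (r := r i) he0 hne
  specialize hT i
  specialize hrange i
  specialize hf i
  have hcardi := hcard i
  have hratei := le_rate he0 (by omega) (by omega) (C i) hcardi
  set n := 2 ^ r i with hn
  set N := n * innerLength e (r i) with hN_def
  have hnN : 1024 * n ≤ N := le_trans (by gcongr; exact Nat.le_mul_of_pos_right _ (by omega)) hN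
  have hnr : 1024 * (outerDim e n * r i) ≤ N := by
    refine le_trans ?_ hN
    gcongr
    · exact Nat.div_le_self _ _
    · omega
  refine ⟨le_trans ?_ hratei, ?_, ⟨f i, hrange, fun m => ?_⟩, fun c hcC s hs => ?_⟩
  · have h1 : (ε * e) ^ 9 ≤ 2 ^ 9 := by gcongr
    have h2 : (e : ℝ) ^ 6 ≤ (e : ℝ) ^ 9 :=
      pow_le_pow_right₀ (by exact_mod_cast he0) (by norm_num)
    rw [le_div_iff₀ (by positivity)]
    calc 1 / (8908701696 * 512) * ε ^ 9 * (8908701696 * (e : ℝ) ^ 6)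
        ≤ 1 / (8908701696 * 512) * ε ^ 9 * (8908701696 * (e : ℝ) ^ 9) := by gcongr
      _ = (ε * e) ^ 9 / 512 := by ring
      _ ≤ 1 := by norm_num at h1 ⊢; linarith
  · obtain ⟨t, h1, h2⟩ := hc e i n hn
    have h3 : description (C i) (Prog.withConst (Enc.enc (e, r i, n)) pe)
        (Prog.withConst (Enc.enc (e, r i, n)) pd) = descriptionOf pe pd e (r i) n := by
      rw [description, descriptionOf, hcardi]
    rw [h3]
    refine ⟨_, run_withConst h1, hT Dc _ (le_max_right _ _) ?_⟩
    have h4 : (Enc.enc e).size = sz e := rfl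
    rw [sz_pair, ← hri] at h2
    refine le_trans ?_ (h2.trans (Nat.pow_le_pow_left (by omega : n ≤ N) _))
    omega
  · have hm : (m : ℕ) < 2 ^ (outerDim e n * r i) := hcardi ▸ m.2
    have hsz : sz (m : ℕ).bits ≤ N ^ 5 := by
      have h1 := sz_bits_le m
      have h2 := Nat.size_le.2 hm
      have h3 : N ≤ N ^ 5 := Nat.le_self_pow (by norm_num) N
      omega
    obtain ⟨t, h1, h2⟩ := he e (r i) n N (m : ℕ).bits (by omega) (by omega) (by omega) (by omega)
      hsz
    rw [ofWord_eq, hf]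
    exact ⟨t, h1, hT De _ (le_max_of_le_left (le_max_left _ _)) h2⟩
  · obtain ⟨m, rfl⟩ : c ∈ Set.range (f i) := by rw [hrange]; exact hcC
    have hs' : e * indelDist (List.ofFn (f i m)) s + N ≤ e * N := by
      have h1 : (e : ℝ) * indelDist (List.ofFn (f i m)) s ≤ e * ((1 - ε) * (N : ℝ)) := by gcongr
      have h2 : (N : ℝ) ≤ ε * e * N := le_mul_of_one_le_left (Nat.cast_nonneg _) hεe
      have h3 : (e : ℝ) * indelDist (List.ofFn (f i m)) s + N ≤ e * N := by linarith
      exact_mod_cast h3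
    have ha := messageCoeffs_spec (e := e) (r := r i) hn m
    obtain ⟨hlen, hdec⟩ := decode_eq he0 hn (by omega) ha.1 ha.2 (hf m) hs'
    have hsz : sz ((s.map Fin.val).map Nat.bits) ≤ N ^ 5 := by
      have h1 : ∀ b ∈ (s.map Fin.val).map Nat.bits, sz b ≤ 4 * N ^ 2 + 1 := by
        intro b hb
        simp only [List.mem_map] at hb
        obtain ⟨_, ⟨x, -, rfl⟩, rfl⟩ := hb
        have h2 := sz_bits_le x
        have h3 := size_le_self x
        have h4 := x.2
        omega
      have h5 := sz_le_of_forall h1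
      rw [List.length_map, List.length_map] at h5
      have h6 : 16 ≤ N := by omega
      calc _ ≤ _ := h5
        _ ≤ 2 * N * (4 * N ^ 2 + 1 + 1) + 1 := by gcongr
        _ = 8 * N ^ 3 + 4 * N + 1 := by ring
        _ ≤ 16 * 16 * N ^ 3 := by
          have h7 : N ≤ N ^ 3 := Nat.le_self_pow (by norm_num) N
          omega
        _ ≤ N * N * N ^ 3 := by gcongr
        _ = N ^ 5 := by ring
    obtain ⟨t, h1, h2⟩ := hd e (r i) n N _ (by omega) (by omega) (by omega) (by omega) hsz
    simp only [hdec] at h1 h2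
    rw [ofWord_eq, ofWord_eq]
    exact ⟨t, h1, hT Dd _ (le_max_of_le_left (le_max_right _ _)) h2⟩
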